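/- **Setting.** The base field is $\mathbb C$, and $V$, $V'$ are finite-dimensional vector spaces. Let $1\le m_1<\dots<m_k$ and $1\le n_1<\dots<n_{\tilde k}$ be integers. We consider one of the following three cases. * *Ordinary case:* $\dim V,\dim V'\ge 2$, $m_k<\dim V$, $n_{\tilde k}<\dim V'$; $\mathbf G(m,V)=G(m,V)$ is the Grassmannian of $m$-dimensional subspaces. * *Orthogonal case:* $V$, $V'$ carry non-degenerate symmetric bilinear forms, $\dim V,\dim V'\ge 7$, $m_k\le\frac12\dim V$, $n_{\tilde k}\le\frac12\dim V'$; $\mathbf G(m,V)=GO(m,V)$ is the variety of isotropic $m$-dimensional subspaces, where for $\dim V=2m$ we fix one of its two components and denote only this component by $GO(m,V)$. * *Symplectic case:* $V$, $V'$ carry symplectic forms, $m_k\le\frac12\dim V$, $n_{\tilde k}\le\frac12\dim V'$; $\mathbf G(m,V)=GS(m,V)$ is the variety of isotropic $m$-dimensional subspaces. Let $X$ be the variety of flags $V_{m_1}\subset\dots\subset V_{m_k}$ with $V_{m_i}\in\mathbf G(m_i,V)$, that is $Fl(m_1,\dots,m_k,V)$, $FlO(m_1,\dots,m_k,V)$ or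 $FlS(m_1,\dots,m_k,V)$, with its projections $\pi_i:X\to\mathbf G(m_i,V)$. In the orthogonal case with $m_k=\frac12\dim V-1$, put in addition $m_{k+1}:=\frac12\dim V$ and $\pi_{k+1}:=\theta\circ\pi_k:X\to GO(m_{k+1},V)$, where $\theta$ sends $V_{m_k}$ to the unique element of $GO(m_{k+1},V)$ containing it. Let $I$ be the resulting set of indices ($\{1,\dots,k\}$, or $\{1,\dots,k+1\}$ in the exceptional case). Put $L_i:=\pi_i^*\mathcal O_{\mathbf G(m_i,V)}(1)$ for $i\in I$; the classes $[L_i]$ are the preferred generators of $\operatorname{Pic}X$. Here $\mathcal O_{\mathbf G(m,V)}(1)$ is the restriction of the Plücker line bundle $\mathcal O_{G(m,V)}(1)$, except that $\mathcal O_{GO(m,V)}(1)$ is its square root if $m=\lfloor\frac12\dim V\rfloor$. Define $Y$ (the variety of flags of type $(n_1,\dots,n_{\tilde k})$ in $V'$, of the same kind), the index set $J$, the projections $\pi'_j:Y\to\mathbf G(n_j,V')$ and the line bundles $M_j$, $j\in J$, in the same way. The natural maps are $j_X=(\pi_i)_{i\in I}:X\to\prod_{i\in I}\mathbf G(m_i,V)$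 and $j_Y=(\pi'_j)_{j\in J}:Y\to\prod_{j\in J}\mathbf G(n_j,V')$. An embedding $\varphi:X\hookrightarrow Y$ (an isomorphism onto a closed subvariety) is *linear* if for every $j\in J$ either $[\varphi^*M_j]=0$ or $[\varphi^*M_j]=[L_i]$ for some $i\in I$. Then there is a map $p:J\to\{0\}\sqcup I$ such that $[\varphi^*M_j]=0$ if $p(j)=0$ and $[\varphi^*M_j]=[L_i]$ if $p(j)=i\in I$. **Proposition.** Let $\varphi:X\hookrightarrow Y$ be a linear embedding, in the ordinary, orthogonal or symplectic case, and let $p$ be such a map. Then there are unique morphisms $$\varphi_{[i]}:\ \mathbf G(m_i,V)\to\prod_{j\in J:\,p(j)=i}\mathbf G(n_j,V')\quad(i\in I),\qquad \varphi_{[0]}:\ G_0\to\prod_{j\in J:\,p(j)=0}\mathbf G(n_j,V'),$$ where $G_0$ is a single point, such that the diagram $$\begin{array}{ccc}X&\xrightarrow{\ \varphi\ }&Y\\ {\scriptstyle j_X}\downarrow&&\downarrow{\scriptstyle j_Y}\\ G_0\times\prod_{i\in I}\mathbf G(m_i,V)&\xrightarrow{\ \varphi_{[0]}\times\prod_i\varphi_{[i]}\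 }&\prod_{j\in J}\mathbf G(n_j,V')\end{array}$$ commutes. -/

import Mathlib

open Module Topology

universe u v w

noncomputable section

/-! ### Spaces with functions, morphisms, line bundles -/

/-- A space with `ℂ`-valued functions: a topological space together with the relation
"`f` is regular near `x`". A function is regular on an open set `U` iff it is regular near every
point of `U`; this is the classical description of the structure sheaf of a complex variety. -/
structure FunctionSpace where
  carrier : Type u
  top : TopologicalSpace carrier
  RegularAt : (carrier → ℂ) → carrier → Prop

instance : CoeSort FunctionSpace.{u} (Type u) := ⟨FunctionSpace.carrier⟩

instance (X : FunctionSpace.{u}) : TopologicalSpace X := X.top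

/-- Morphisms: continuous maps along which regular functions pull back to regular functions. -/
structure Morphism (X : FunctionSpace.{u}) (Y : FunctionSpace.{v}) where
  toFun : X → Y
  continuous : Continuous toFun
  regular : ∀ (f : Y → ℂ) (x : X), Y.RegularAt f (toFun x) → X.RegularAt (f ∘ toFun) x

instance (X : FunctionSpace.{u}) (Y : FunctionSpace.{v}) :
    CoeFun (Morphism X Y) (fun _ => X → Y) := ⟨Morphism.toFun⟩

/-- A (closed) embedding of varieties: a morphism that is a homeomorphism onto a closed subset and
such that the regular functions on the source are locally the restrictions of regular functions on
the target. -/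
structure Morphism.IsEmbedding {X : FunctionSpace.{u}} {Y : FunctionSpace.{v}}
    (φ : Morphism X Y) : Prop where
  isClosedEmbedding : IsClosedEmbedding φ.toFun
  restrict : ∀ (f : X → ℂ) (x : X), X.RegularAt f x →
    ∃ g : Y → ℂ, Y.RegularAt g (φ x) ∧ f =ᶠ[𝓝 x] g ∘ φ.toFun

/-- Gluing data on `X`: a family of subsets `U i` and transition functions `g i j` (whose values
matter only on `U i ∩ U j`). -/
structure GluingData (X : FunctionSpace.{u}) where
  ι : Type w
  U : ι → Set X
  g : ι → ι → X → ℂ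

namespace GluingData

variable {X : FunctionSpace.{u}}

/-- Gluing data define a line bundle (an invertible sheaf) if the `U i` form an open cover and the
`g i j` are a cocycle of invertible regular functions. The line bundle has a frame `s i` over `U i`
with `s i = g i j • s j`. -/
structure IsLineBundle (L : GluingData.{u, w} X) : Prop where
  isOpen : ∀ i, IsOpen (L.U i)
  cover : ∀ x, ∃ i, x ∈ L.U i
  regular : ∀ i j, ∀ x ∈ L.U i ∩ L.U j, X.RegularAt (L.g i j) x
  ne_zero : ∀ i j, ∀ x ∈ L.U i ∩ L.U j, L.g i j x ≠ 0
  cocycle : ∀ i j k, ∀ x ∈ L.U i ∩ L.U j ∩ L.U k, L.g i j x * L.g j k x = L.g i k x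

/-- Isomorphism of line bundles, i.e. equality of their classes in `Pic X`: the frames
`s i` of `L` and `t a` of `M` correspond by `s i = h i a • t a`, where `h i a` is an invertible
regular function on the intersection of the two charts. -/
def Iso (L : GluingData.{u, v} X) (M : GluingData.{u, w} X) : Prop :=
  ∃ h : L.ι → M.ι → X → ℂ,
    (∀ i a, ∀ x ∈ L.U i ∩ M.U a, X.RegularAt (h i a) x ∧ h i a x ≠ 0) ∧
    ∀ i j a b, ∀ x ∈ L.U i ∩ L.U j ∩ (M.U a ∩ M.U b),
      h i a x * M.g a b x = L.g i j x * h j b x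

/-- The trivial line bundle, the zero of `Pic X`. -/
def trivial (X : FunctionSpace.{u}) : GluingData.{u, 0} X where
  ι := Unit
  U := fun _ => Set.univ
  g := fun _ _ _ => 1

/-- The tensor product. -/
def tensor (L : GluingData.{u, v} X) (M : GluingData.{u, w} X) : GluingData.{u, max v w} X where
  ι := L.ι × M.ι
  U := fun i => L.U i.1 ∩ M.U i.2
  g := fun i j x => L.g i.1 j.1 x * M.g i.2 j.2 x

/-- The pullback along a map. -/
def pullback {Y : FunctionSpace.{v}} (f : X → Y) (L : GluingData.{v, w} Y) :
    GluingData.{u, w} X where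
  ι := L.ι
  U := fun i => f ⁻¹' L.U i
  g := fun i j x => L.g i j (f x)

end GluingData

/-! ### Subvarieties of products of projective spaces -/

/-- `P` is a multihomogeneous polynomial function of multidegree `d` on `∏ a, E a`
(`A` is finite in all uses). -/
def IsMultihomogeneous {A : Type} {E : A → Type u} [∀ a, AddCommGroup (E a)]
    [∀ a, Module ℂ (E a)] (d : A → ℕ) (P : (∀ a, E a) → ℂ) : Prop :=
  P ∈ Algebra.adjoin ℂ
      {f : (∀ a, E a) → ℂ | ∃ (a : A) (l : Dual ℂ (E a)), f = fun e => l (e a)} ∧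
    ∀ (t : A → ℂ) (e : ∀ a, E a), P (fun a => t a • e a) = (∏ᶠ a, t a ^ d a) * P e

/-- The structure of a variety on a set `X` whose points `x` have homogeneous coordinates
`c x a ∈ E a \ {0}`, i.e. the structure induced from `∏ a, ℙ (E a)`: the Zariski topology, and the
functions that are locally quotients of multihomogeneous polynomials of equal multidegree.
It does not depend on the choice of the representatives `c x a` of the points of `ℙ (E a)`. -/
def ofCoordinates (X : Type v) {A : Type} {E : A → Type u} [∀ a, AddCommGroup (E a)]
    [∀ a, Module ℂ (E a)] (c : X → ∀ a, E a) : FunctionSpace.{v} :=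
  letI top : TopologicalSpace X := TopologicalSpace.generateFrom
    {U | ∃ (d : A → ℕ) (P : (∀ a, E a) → ℂ), IsMultihomogeneous d P ∧ U = {x | P (c x) ≠ 0}}
  { carrier := X
    top := top
    RegularAt := fun f x => ∃ (d : A → ℕ) (P Q : (∀ a, E a) → ℂ),
      IsMultihomogeneous d P ∧ IsMultihomogeneous d Q ∧
        ∀ᶠ y in 𝓝 x, Q (c y) ≠ 0 ∧ f y = P (c y) / Q (c y) }

/-- The variety consisting of a single point. -/
def pointVariety : FunctionSpace.{0} :=
  ofCoordinates Unit (A := Empty) (E := fun _ => ℂ) (fun _ a => a.elim)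

section Grassmannians

variable {V : Type u} [AddCommGroup V] [Module ℂ V] [FiniteDimensional ℂ V]

/-- The `m`-dimensional subspaces of `V` satisfying the condition `C`. -/
@[ext] structure Grass (C : Submodule ℂ V → Prop) (m : ℕ) where
  space : Submodule ℂ V
  finrank_eq : finrank ℂ space = m
  cond : C space

/-- The flags of type `(m 0, m 1, …)` of subspaces of `V` satisfying the condition `C`. -/
@[ext] structure PartialFlag (C : Submodule ℂ V → Prop) {k : ℕ} (m : Fin k → ℕ) where
  space : Fin k → Submodule ℂ V
  finrank_eq : ∀ i, finrank ℂ (space i) = m i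
  cond : ∀ i, C (space i)
  mono : Monotone space

/-- The member of index `i` of a flag. -/
def PartialFlag.get {C : Submodule ℂ V → Prop} {k : ℕ} {m : Fin k → ℕ} (F : PartialFlag C m)
    (i : Fin k) :
    Grass C (m i) :=
  ⟨F.space i, F.finrank_eq i, F.cond i⟩

/-- The Plücker vector `w₁ ∧ ⋯ ∧ w_m` of an `m`-dimensional subspace, `w₁, …, w_m` a basis. -/
def Grass.plucker {C : Submodule ℂ V → Prop} {m : ℕ} (W : Grass C m) : ⋀[ℂ]^m V :=
  exteriorPower.ιMulti ℂ m
    (fun i => ((finBasisOfFinrankEq ℂ W.space W.finrank_eq i : W.space) : V))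

/-- The variety of `m`-dimensional subspaces satisfying `C`, inside `ℙ (⋀^m V)`. -/
def grassVariety (C : Submodule ℂ V → Prop) (m : ℕ) : FunctionSpace.{u} :=
  ofCoordinates (Grass C m) (A := Unit) (fun W _ => W.plucker)

/-- A finite product of such varieties, inside `∏ j, ℙ (⋀^(n j) V)`. -/
def prodGrassVariety (C : Submodule ℂ V → Prop) {J : Type} (n : J → ℕ) : FunctionSpace.{u} :=
  ofCoordinates (∀ j, Grass C (n j)) (fun W j => (W j).plucker)

/-- The variety of flags of type `m`, inside `∏ i, ℙ (⋀^(m i) V)`. -/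
def flagVariety (C : Submodule ℂ V → Prop) {k : ℕ} (m : Fin k → ℕ) : FunctionSpace.{u} :=
  ofCoordinates (PartialFlag C m) (fun F i => (F.get i).plucker)

/-- The restriction of the Plücker line bundle `𝒪(1)`: every linear form `l` on `⋀^m V` is a global
section, which is a frame over the set where it does not vanish. -/
def pluckerBundle (C : Submodule ℂ V → Prop) (m : ℕ) : GluingData.{u, u} (grassVariety C m) where
  ι := Dual ℂ (⋀[ℂ]^m V)
  U := fun l => {W : Grass C m | l W.plucker ≠ 0}
  g := fun l l' (W : Grass C m) => l W.plucker / l' W.plucker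

end Grassmannians

/-! ### Flag varieties with their preferred generators of the Picard group -/

/-- The package of a flag variety (of flags of type `m` with members satisfying `C`) and its
preferred generators of the Picard group. The generators are indexed by `Node`; the one of index `i`
is the pullback of the line bundle `𝒪(1)` on the Grassmannian of `dim i`-dimensional
subspaces along `proj i`. Here `𝒪(1)` is the Plücker line bundle, or its square root if `half i`. -/
structure MarkedFlagVariety (V : Type u) [AddCommGroup V] [Module ℂ V]
    [FiniteDimensional ℂ V] where
  C : Submodule ℂ V → Prop
  k : ℕ
  m : Fin k → ℕ
  Node : Type
  dim : Node → ℕ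
  proj : PartialFlag C m → ∀ i, Grass C (dim i)
  half : Node → Prop

/-- The ordinary flag variety `Fl(m₁, …, m_k, V)`. -/
def Fl (V : Type u) [AddCommGroup V] [Module ℂ V] [FiniteDimensional ℂ V] {k : ℕ}
    (m : Fin k → ℕ) : MarkedFlagVariety V where
  C := fun _ => True
  k := k
  m := m
  Node := Fin k
  dim := m
  proj := PartialFlag.get
  half := fun _ => False

section Forms

variable {V : Type u} [AddCommGroup V] [Module ℂ V] [FiniteDimensional ℂ V]

/-- `B` vanishes on `W`. -/
def IsIsotropic (B : LinearMap.BilinForm ℂ V) (W : Submodule ℂ V) : Prop :=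
  ∀ x ∈ W, ∀ y ∈ W, B x y = 0

/-- The symplectic flag variety `FlS(m₁, …, m_k, V)`. -/
def FlS (B : LinearMap.BilinForm ℂ V) {k : ℕ} (m : Fin k → ℕ) : MarkedFlagVariety V where
  C := IsIsotropic B
  k := k
  m := m
  Node := Fin k
  dim := m
  proj := PartialFlag.get
  half := fun _ => False

/-- An isotropic subspace of the maximal dimension `⌊dim V / 2⌋`. If `dim V` is even it selects one
of the two components of the variety of maximal isotropic subspaces. -/
structure MaxIsotropic (B : LinearMap.BilinForm ℂ V) where
  space : Submodule ℂ V
  isotropic : IsIsotropic B space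
  finrank_eq : finrank ℂ space = finrank ℂ V / 2

/-- `W` is isotropic and, if `dim V = 2 dim W`, it lies in the component of `W₀`, which is the orbit
of `W₀` under the special orthogonal group. -/
def IsOrthogonalMember (B : LinearMap.BilinForm ℂ V) (W₀ : MaxIsotropic B) (W : Submodule ℂ V) :
    Prop :=
  IsIsotropic B W ∧ (2 * finrank ℂ W = finrank ℂ V →
    ∃ g : V ≃ₗ[ℂ] V, (∀ x y, B (g x) (g y) = B x y) ∧
      LinearMap.det (g : V →ₗ[ℂ] V) = 1 ∧ W = W₀.space.map (g : V →ₗ[ℂ] V))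

/-- `W₀` as a point of its component. -/
def MaxIsotropic.toGrass {B : LinearMap.BilinForm ℂ V} (W₀ : MaxIsotropic B) :
    Grass (IsOrthogonalMember B W₀) (finrank ℂ V / 2) where
  space := W₀.space
  finrank_eq := W₀.finrank_eq
  cond := ⟨W₀.isotropic, fun _ => ⟨LinearEquiv.refl ℂ V, fun _ _ => rfl, by simp, by simp⟩⟩

/-- The map `θ`: for `dim V = 2l` and `U` isotropic of dimension `l - 1`, the unique
`l`-dimensional isotropic subspace in the component of `W₀` that contains `U`. -/
def theta (B : LinearMap.BilinForm ℂ V) (W₀ : MaxIsotropic B) (U : Submodule ℂ V) :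
    Grass (IsOrthogonalMember B W₀) (finrank ℂ V / 2) :=
  haveI : Nonempty (Grass (IsOrthogonalMember B W₀) (finrank ℂ V / 2)) := ⟨W₀.toGrass⟩
  Classical.epsilon fun W => U ≤ W.space

/-- The last entry `m_k` of the type equals `N / 2 - 1`. -/
def HasExtraNode (N : ℕ) {k : ℕ} (m : Fin k → ℕ) : Prop :=
  ∃ i : Fin k, (∀ i', i' ≤ i) ∧ 2 * (m i + 1) = N

/-- The orthogonal flag variety `FlO(m₁, …, m_k, V)`. If `m_k = dim V / 2 - 1`, there is an
additional generator, which comes from `GO(m_k + 1, V)` through `θ`. On `GO(⌊dim V / 2⌋, V)` the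
generator of the Picard group is the square root of the Plücker line bundle. -/
def FlO (B : LinearMap.BilinForm ℂ V) (W₀ : MaxIsotropic B) {k : ℕ} (m : Fin k → ℕ) :
    MarkedFlagVariety V where
  C := IsOrthogonalMember B W₀
  k := k
  m := m
  Node := Fin k ⊕ PLift (HasExtraNode (finrank ℂ V) m)
  dim := Sum.elim m (fun _ => finrank ℂ V / 2)
  proj := fun F => Sum.rec (fun i => F.get i) (fun h => theta B W₀ (F.space h.down.choose))
  half := fun i => Sum.elim m (fun _ => finrank ℂ V / 2) i = finrank ℂ V / 2

end Forms

/-! ### Linear embeddings and the induced morphisms of Grassmannians -/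

namespace MarkedFlagVariety

variable {V : Type u} [AddCommGroup V] [Module ℂ V] [FiniteDimensional ℂ V]
  {V' : Type v} [AddCommGroup V'] [Module ℂ V'] [FiniteDimensional ℂ V']

/-- The underlying variety. -/
def variety (X : MarkedFlagVariety V) : FunctionSpace.{u} := flagVariety X.C X.m

/-- The Grassmannian belonging to the generator of index `i`. -/
def grass (X : MarkedFlagVariety V) (i : X.Node) : FunctionSpace.{u} := grassVariety X.C (X.dim i)

/-- The product of the Grassmannians belonging to the generators `j` with `S j`. -/
def prodGrass (X : MarkedFlagVariety V) (S : X.Node → Prop) : FunctionSpace.{u} :=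
  prodGrassVariety X.C (fun j : {j : X.Node // S j} => X.dim j.1)

/-- The natural map to the product of the Grassmannians. -/
def toGrass (X : MarkedFlagVariety V) (F : X.variety) (i : X.Node) : X.grass i := X.proj F i

/-- `N` is a line bundle on the Grassmannian of index `i` in the class of `𝒪(1)`. -/
def IsHyperplaneBundle (X : MarkedFlagVariety V) (i : X.Node) (N : GluingData.{u, u} (X.grass i)) :
    Prop :=
  N.IsLineBundle ∧
    (¬ X.half i → N.Iso (pluckerBundle X.C (X.dim i))) ∧
    (X.half i → (N.tensor N).Iso (pluckerBundle X.C (X.dim i)))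

/-- `L` is in the class of the preferred generator of index `i`. -/
def IsGenerator (X : MarkedFlagVariety V) (i : X.Node) (L : GluingData.{u, u} X.variety) : Prop :=
  ∃ N : GluingData.{u, u} (X.grass i), X.IsHyperplaneBundle i N ∧
    L = N.pullback (fun F => X.toGrass F i)

variable {X : MarkedFlagVariety V} {Y : MarkedFlagVariety V'}

/-- `[φ^* M_j] = 0`. -/
def PullsBackToZero (φ : Morphism X.variety Y.variety) (j : Y.Node) : Prop :=
  ∃ M, Y.IsGenerator j M ∧ (M.pullback φ.toFun).Iso (GluingData.trivial X.variety)

/-- `[φ^* M_j] = [L_i]`. -/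
def PullsBackTo (φ : Morphism X.variety Y.variety) (j : Y.Node) (i : X.Node) : Prop :=
  ∃ M, Y.IsGenerator j M ∧ ∃ L, X.IsGenerator i L ∧ (M.pullback φ.toFun).Iso L

/-- `φ` is a linear embedding. -/
def IsLinearEmbedding (φ : Morphism X.variety Y.variety) : Prop :=
  φ.IsEmbedding ∧ ∀ j, PullsBackToZero φ j ∨ ∃ i, PullsBackTo φ j i

/-- `p` is a map `j ↦ p(j)` with `[φ^* M_j] = 0` if `p(j) = 0` (written `none`) and
`[φ^* M_j] = [L_i]` if `p(j) = i` (written `some i`). -/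
def IsIndexMap (φ : Morphism X.variety Y.variety) (p : Y.Node → Option X.Node) : Prop :=
  ∀ j, (p j = none → PullsBackToZero φ j) ∧ ∀ i, p j = some i → PullsBackTo φ j i

/-- The morphisms `φ_{[0]} : G₀ → ∏_{p(j) = 0} G(n_j, V')` from a point and
`φ_{[i]} : G(m_i, V) → ∏_{p(j) = i} G(n_j, V')`. -/
structure GrassMorphisms (X : MarkedFlagVariety V) (Y : MarkedFlagVariety V')
    (p : Y.Node → Option X.Node) where
  zero : Morphism pointVariety (Y.prodGrass fun j => p j = none)
  comp : ∀ i, Morphism (X.grass i) (Y.prodGrass fun j => p j = some i)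

/-- The product map `G₀ × ∏ i, G(m_i, V) → ∏ j, G(n_j, V')` of the morphisms `φ_{[i]}`. -/
def GrassMorphisms.prodMap {p : Y.Node → Option X.Node} (Φ : GrassMorphisms X Y p)
    (x : pointVariety × ∀ i, X.grass i) (j : Y.Node) : Y.grass j :=
  match h : p j with
  | none => (Φ.zero x.1 : ∀ j : {j : Y.Node // p j = none}, Grass Y.C (Y.dim j.1)) ⟨j, h⟩
  | some i => (Φ.comp i (x.2 i) :
      ∀ j : {j : Y.Node // p j = some i}, Grass Y.C (Y.dim j.1)) ⟨j, h⟩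

/-- The assertion that every linear embedding `X ↪ Y` has an index map `p`, and that it induces (for
every such `p`) unique morphisms of Grassmannians `φ_{[i]}` for which the square formed by `φ`, the
product of the `φ_{[i]}` and the natural maps to products of Grassmannians commutes. -/
def LinearEmbeddingsInduce (X : MarkedFlagVariety V) (Y : MarkedFlagVariety V') : Prop :=
  ∀ φ : Morphism X.variety Y.variety, IsLinearEmbedding φ →
    (∃ p : Y.Node → Option X.Node, IsIndexMap φ p) ∧
    ∀ p : Y.Node → Option X.Node, IsIndexMap φ p →
      ∃! Φ : GrassMorphisms X Y p,
        ∀ (pt : pointVariety) (F : X.variety), Y.toGrass (φ F) = Φ.prodMap (pt, X.toGrass F)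

end MarkedFlagVariety

end

/-! Write f_j for the composite of φ with the projection π'_j. The square asks that f_j factor
through π_i when p(j) = i, and that f_j be constant when p(j) = 0. So the point is that f_j is
constant on the fibres of π_i.

Near a fibre of π_i, that is, over the preimage of a chart of 𝒪(1), the bundle L_i is trivial, and
hence so is φ^*M_j. A trivialization rescales the Plücker coordinates of f_j to functions regular on
that open set (`hasRegularCoordinates_of_trivial`); if M_j is a square root of the Plücker bundle,
the square of the trivialization is used. Along a projective line a regular function is constant by
Liouville's theorem (`regular_eq_of_curve`). Hence f_j is constant along every rational curve in the
fibre, and it remains to join any two flags of a fibre by chains of such curves. For p(j) = 0 the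
same argument runs with all of X in place of the fibre.

For connectedness, a flag is replaced by an adapted basis `e` of some M-dimensional T satisfying
`C`: the members of the flag are the spans `head e n` of initial segments, and π_i records `head e
w`. Inside a fixed T, pencils `e i + t • e j` swap two basis vectors, which suffices to sort one
basis into another (`IsCurveInvariant.eq_of_head_eq`). Then T is moved towards T', each curve
enlarging T ∩ T' while fixing a subspace of T that contains it
(`IsCurveInvariant.eq_of_exists_curve`). The curve is a line in the ordinary and the symplectic
case. For a symmetric form it is a line or a conic below the middle dimension, and a pencil of
Lagrangian subspaces with common part of codimension two in the middle dimension. There the parity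
of codim (T ∩ T') separates the two components (`IsOrthogonalMember.iff_even`).

Finally π_i is surjective and has local sections: the basis of W dual to fixed linear forms depends
regularly on W and is completed by explicit vectors (`sectionFrame`). The factorization of f_j is
locally f_j composed with a section, hence a morphism, and surjectivity of π_i gives uniqueness. The
extra projection through θ fits the same scheme: θ(V_{m_k}) is the span of an adapted frame of
length dim V / 2. -/

/-! ### Regular functions and pointwise morphisms -/

/-- Near every point the regular functions form a local ring of germs of functions. -/
class LocallyRinged (X : FunctionSpace.{u}) : Prop where
  congr : ∀ {f g : X → ℂ} {x : X}, X.RegularAt f x → f =ᶠ[𝓝 x] g → X.RegularAt g x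
  const : ∀ (c : ℂ) (x : X), X.RegularAt (fun _ => c) x
  add : ∀ {f g : X → ℂ} {x : X}, X.RegularAt f x → X.RegularAt g x →
    X.RegularAt (fun y => f y + g y) x
  mul : ∀ {f g : X → ℂ} {x : X}, X.RegularAt f x → X.RegularAt g x →
    X.RegularAt (fun y => f y * g y) x
  inv : ∀ {f : X → ℂ} {x : X}, X.RegularAt f x → f x ≠ 0 → X.RegularAt (fun y => (f y)⁻¹) x
  eventually_ne : ∀ {f : X → ℂ} {x : X}, X.RegularAt f x → f x ≠ 0 → ∀ᶠ y in 𝓝 x, f y ≠ 0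

namespace LocallyRinged

variable {X : FunctionSpace.{u}} [LocallyRinged X]

theorem div {f g : X → ℂ} {x : X} (hf : X.RegularAt f x) (hg : X.RegularAt g x) (h : g x ≠ 0) :
    X.RegularAt (fun y => f y / g y) x := by
  simpa only [div_eq_mul_inv] using mul hf (inv hg h)

theorem pow {f : X → ℂ} {x : X} (hf : X.RegularAt f x) (n : ℕ) :
    X.RegularAt (fun y => f y ^ n) x := by
  induction n with
  | zero => simpa using const 1 x
  | succ n ih => simpa only [pow_succ] using mul ih hf

theorem sum {ι : Type*} (s : Finset ι) {f : ι → X → ℂ} {x : X}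
    (hf : ∀ i ∈ s, X.RegularAt (f i) x) : X.RegularAt (fun y => ∑ i ∈ s, f i y) x := by
  classical
  induction s using Finset.induction_on with
  | empty => simpa using const 0 x
  | insert a s ha ih =>
    simp only [Finset.sum_insert ha]
    exact add (hf a (Finset.mem_insert_self _ _))
      (ih fun i hi => hf i (Finset.mem_insert_of_mem hi))

theorem prod {ι : Type*} (s : Finset ι) {f : ι → X → ℂ} {x : X}
    (hf : ∀ i ∈ s, X.RegularAt (f i) x) : X.RegularAt (fun y => ∏ i ∈ s, f i y) x := by
  classical
  induction s using Finset.induction_on with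
  | empty => simpa using const 1 x
  | insert a s ha ih =>
    simp only [Finset.prod_insert ha]
    exact mul (hf a (Finset.mem_insert_self _ _))
      (ih fun i hi => hf i (Finset.mem_insert_of_mem hi))

end LocallyRinged

/-- A map that is a morphism near the point `x`. -/
structure MorphAt {X : FunctionSpace.{u}} {Y : FunctionSpace.{v}} (s : X → Y) (x : X) : Prop where
  continuousAt : ContinuousAt s x
  regular : ∀ f : Y → ℂ, Y.RegularAt f (s x) → X.RegularAt (f ∘ s) x

theorem Morphism.morphAt {X : FunctionSpace.{u}} {Y : FunctionSpace.{v}} (φ : Morphism X Y)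
    (x : X) : MorphAt φ.toFun x :=
  ⟨φ.continuous.continuousAt, fun f => φ.regular f x⟩

theorem MorphAt.comp {X : FunctionSpace.{u}} {Y : FunctionSpace.{v}} {Z : FunctionSpace.{w}}
    {t : Y → Z} {s : X → Y} {x : X} (ht : MorphAt t (s x)) (hs : MorphAt s x) :
    MorphAt (fun y => t (s y)) x :=
  ⟨ContinuousAt.comp (f := s) (g := t) ht.continuousAt hs.continuousAt,
    fun f hf => hs.regular _ (ht.regular f hf)⟩

theorem MorphAt.congr {X : FunctionSpace.{u}} {Y : FunctionSpace.{v}} [LocallyRinged X]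
    {s t : X → Y} {x : X} (hs : MorphAt s x) (h : s =ᶠ[𝓝 x] t) : MorphAt t x := by
  refine ⟨hs.continuousAt.congr h, fun f hf => ?_⟩
  rw [← h.eq_of_nhds] at hf
  exact LocallyRinged.congr (hs.regular f hf) (h.fun_comp f)

/-- The morphism given by a map that is a morphism near every point. -/
def Morphism.ofMorphAt {X : FunctionSpace.{u}} {Y : FunctionSpace.{v}} (s : X → Y)
    (h : ∀ x, MorphAt s x) : Morphism X Y where
  toFun := s
  continuous := continuous_iff_continuousAt.2 fun x => (h x).continuousAt
  regular := fun f x => (h x).regular f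

theorem Morphism.ext' {X : FunctionSpace.{u}} {Y : FunctionSpace.{v}} {φ ψ : Morphism X Y}
    (h : ∀ x, φ x = ψ x) : φ = ψ := by
  cases φ; cases ψ
  congr
  exact funext h

/-! ### Varieties given by coordinates -/

section Multihomogeneous

variable {A : Type} {E : A → Type u} [∀ a, AddCommGroup (E a)] [∀ a, Module ℂ (E a)]

theorem IsMultihomogeneous.const (c : ℂ) :
    IsMultihomogeneous (E := E) (0 : A → ℕ) (fun _ => c) := by
  refine ⟨?_, fun t e => by simp⟩
  exact Subalgebra.algebraMap_mem (Algebra.adjoin ℂ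
    {f : (∀ a, E a) → ℂ | ∃ (a : A) (l : Dual ℂ (E a)), f = fun e => l (e a)}) c

open Classical in
theorem IsMultihomogeneous.linear (a : A) (l : Dual ℂ (E a)) :
    IsMultihomogeneous (E := E) (Pi.single a 1 : A → ℕ) (fun e => l (e a)) := by
  refine ⟨Algebra.subset_adjoin ⟨a, l, rfl⟩, fun t e => ?_⟩
  rw [finprod_eq_single _ a (fun b hb => by simp [Pi.single_eq_of_ne hb])]
  simp

theorem IsMultihomogeneous.add {d : A → ℕ} {P Q : (∀ a, E a) → ℂ} (hP : IsMultihomogeneous d P)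
    (hQ : IsMultihomogeneous d Q) : IsMultihomogeneous d (fun e => P e + Q e) :=
  ⟨Subalgebra.add_mem _ hP.1 hQ.1, fun t e => by simp only [hP.2 t e, hQ.2 t e, mul_add]⟩

theorem IsMultihomogeneous.mul [Finite A] {d d' : A → ℕ} {P Q : (∀ a, E a) → ℂ}
    (hP : IsMultihomogeneous d P) (hQ : IsMultihomogeneous d' Q) :
    IsMultihomogeneous (d + d') (fun e => P e * Q e) := by
  refine ⟨Subalgebra.mul_mem _ hP.1 hQ.1, fun t e => ?_⟩
  simp only [hP.2 t e, hQ.2 t e, Pi.add_apply, pow_add]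
  rw [finprod_mul_distrib (Set.toFinite _) (Set.toFinite _)]
  ring

variable {X : Type v} {c : X → ∀ a, E a}

theorem eventually_ne_zero_ofCoordinates {d : A → ℕ} {P : (∀ a, E a) → ℂ}
    (hP : IsMultihomogeneous d P) {x : ofCoordinates X c} (hx : P (c x) ≠ 0) :
    ∀ᶠ y : ofCoordinates X c in 𝓝 x, P (c y) ≠ 0 := by
  refine IsOpen.mem_nhds ?_ hx
  exact TopologicalSpace.isOpen_generateFrom_of_mem ⟨d, P, hP, rfl⟩

theorem regularAt_ratio (a : A) (l l' : Dual ℂ (E a)) (x : ofCoordinates X c)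
    (hx : l' (c x a) ≠ 0) :
    (ofCoordinates X c).RegularAt (fun y => l (c y a) / l' (c y a)) x := by
  refine ⟨_, _, _, IsMultihomogeneous.linear a l, IsMultihomogeneous.linear a l', ?_⟩
  filter_upwards [eventually_ne_zero_ofCoordinates (IsMultihomogeneous.linear a l') hx]
    with y hy
  exact ⟨hy, rfl⟩

instance [Finite A] : LocallyRinged (ofCoordinates X c) where
  congr := by
    rintro f g x ⟨d, P, Q, hP, hQ, h⟩ hfg
    refine ⟨d, P, Q, hP, hQ, ?_⟩
    filter_upwards [h, hfg] with y hy hy'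
    exact ⟨hy.1, hy' ▸ hy.2⟩
  const := fun k x => ⟨0, _, _, IsMultihomogeneous.const k, IsMultihomogeneous.const 1, by simp⟩
  add := by
    rintro f g x ⟨d, P, Q, hP, hQ, h⟩ ⟨d', P', Q', hP', hQ', h'⟩
    refine ⟨d + d', _, _, (hP.mul hQ').add (by simpa [add_comm] using hP'.mul hQ),
      hQ.mul hQ', ?_⟩
    filter_upwards [h, h'] with y hy hy'
    refine ⟨mul_ne_zero hy.1 hy'.1, ?_⟩
    have h1 := hy.1
    have h2 := hy'.1
    rw [hy.2, hy'.2]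
    field_simp
  mul := by
    rintro f g x ⟨d, P, Q, hP, hQ, h⟩ ⟨d', P', Q', hP', hQ', h'⟩
    refine ⟨d + d', _, _, hP.mul hP', hQ.mul hQ', ?_⟩
    filter_upwards [h, h'] with y hy hy'
    exact ⟨mul_ne_zero hy.1 hy'.1, by rw [hy.2, hy'.2, div_mul_div_comm]⟩
  inv := by
    rintro f x ⟨d, P, Q, hP, hQ, h⟩ hx
    refine ⟨d, _, _, hQ, hP, ?_⟩
    have hPx : P (c x) ≠ 0 := fun h0 => hx (by
      rw [(Filter.Eventually.self_of_nhds (X := ofCoordinates X c) h).2, h0, zero_div])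
    filter_upwards [h, eventually_ne_zero_ofCoordinates hP hPx] with y hy hy'
    exact ⟨hy', by rw [hy.2, inv_div]⟩
  eventually_ne := by
    rintro f x ⟨d, P, Q, hP, hQ, h⟩ hx
    have hPx : P (c x) ≠ 0 := fun h0 => hx (by
      rw [(Filter.Eventually.self_of_nhds (X := ofCoordinates X c) h).2, h0, zero_div])
    filter_upwards [h, eventually_ne_zero_ofCoordinates hP hPx] with y hy hy'
    rw [hy.2]
    exact div_ne_zero hy' hy.1

/-- Germs regular at a point form a ℂ-algebra, so induction over the generated algebra reduces the
claim to linear coordinates. -/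
theorem regularAt_adjoin {S : FunctionSpace.{w}} [LocallyRinged S] {x : S} {e : S → ∀ a, E a}
    (he : ∀ a (l : Dual ℂ (E a)), S.RegularAt (fun y => l (e y a)) x) {P : (∀ a, E a) → ℂ}
    (hP : P ∈ Algebra.adjoin ℂ
      {f : (∀ a, E a) → ℂ | ∃ (a : A) (l : Dual ℂ (E a)), f = fun e => l (e a)}) :
    S.RegularAt (fun y => P (e y)) x := by
  induction hP using Algebra.adjoin_induction with
  | mem f hf => obtain ⟨a, l, rfl⟩ := hf; exact he a l
  | algebraMap r => exact LocallyRinged.const r x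
  | add f g _ _ hf hg => exact LocallyRinged.add hf hg
  | mul f g _ _ hf hg => exact LocallyRinged.mul hf hg

/-- A map to a variety given by coordinates is a morphism near `x` if its homogeneous coordinates
can be chosen regular at `x`. -/
theorem morphAt_of_coordinates [Finite A] {S : FunctionSpace.{w}} [LocallyRinged S] {x : S}
    (s : S → ofCoordinates X c) (e : S → ∀ a, E a)
    (hs : ∀ᶠ y in 𝓝 x, ∀ a, ∃ r : ℂ, r ≠ 0 ∧ c (s y) a = r • e y a)
    (he : ∀ a (l : Dual ℂ (E a)), S.RegularAt (fun y => l (e y a)) x) : MorphAt s x := by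
  -- The scalars of the individual factors enter a multihomogeneous polynomial only through the
  -- common factor `∏ r a ^ d a`. It is nonzero, so it affects neither the vanishing of `P` nor a
  -- quotient `P / Q` of equal multidegree.
  have hs' : ∀ᶠ y in 𝓝 x, ∃ r : A → ℂ, (∀ d : A → ℕ, ∏ᶠ a, r a ^ d a ≠ 0) ∧
      c (s y) = fun a => r a • e y a := by
    filter_upwards [hs] with y hy
    choose r hr using hy
    refine ⟨r, fun d => ?_, funext fun a => (hr a).2⟩
    have := Fintype.ofFinite A
    rw [finprod_eq_prod_of_fintype]
    exact Finset.prod_ne_zero_iff.2 fun a _ => pow_ne_zero _ (hr a).1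
  have ne_iff : ∀ {d : A → ℕ} {P : (∀ a, E a) → ℂ}, IsMultihomogeneous d P →
      ∀ᶠ y in 𝓝 x, (P (c (s y)) ≠ 0 ↔ P (e y) ≠ 0) := by
    intro d P hP
    filter_upwards [hs'] with y ⟨r, hr, hc⟩
    rw [hc, hP.2]
    exact ⟨right_ne_zero_of_mul, mul_ne_zero (hr d)⟩
  have cont : ContinuousAt s x := by
    refine TopologicalSpace.tendsto_nhds_generateFrom_iff.2 ?_
    rintro _ ⟨d, P, hP, rfl⟩ hx
    have hx' : P (e x) ≠ 0 := (ne_iff hP).self_of_nhds.1 hx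
    filter_upwards [LocallyRinged.eventually_ne (regularAt_adjoin he hP.1) hx', ne_iff hP]
      with y hy hy'
    exact hy'.2 hy
  refine ⟨cont, ?_⟩
  rintro f ⟨d, P, Q, hP, hQ, h⟩
  have h' := cont.eventually h
  have hQx : Q (e x) ≠ 0 := (ne_iff hQ).self_of_nhds.1 h'.self_of_nhds.1
  refine LocallyRinged.congr (LocallyRinged.div (regularAt_adjoin he hP.1)
    (regularAt_adjoin he hQ.1) hQx) ?_
  filter_upwards [h', hs'] with y hy ⟨r, hr, hc⟩
  rw [Function.comp_apply, hy.2, hc, hP.2, hQ.2, mul_div_mul_left _ _ (hr d)]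

end Multihomogeneous

/-! ### Rational curves -/

/-- The complex line with its holomorphic functions. -/
noncomputable def complexLine : FunctionSpace.{0} where
  carrier := ℂ
  top := inferInstance
  RegularAt := fun f x => DifferentiableAt ℂ f x

instance : LocallyRinged complexLine where
  congr := fun hf h =>
    DifferentiableAt.congr_of_eventuallyEq (𝕜 := ℂ) (E := ℂ) hf (Filter.EventuallyEq.symm h)
  const := fun k _ => differentiableAt_const (𝕜 := ℂ) (E := ℂ) k
  add := fun hf hg => DifferentiableAt.fun_add (𝕜 := ℂ) (E := ℂ) hf hg
  mul := fun hf hg => DifferentiableAt.fun_mul (𝕜 := ℂ) (E := ℂ) hf hg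
  inv := fun hf h => DifferentiableAt.fun_inv (𝕜 := ℂ) (E := ℂ) hf h
  eventually_ne := fun hf h =>
    (DifferentiableAt.continuousAt (𝕜 := ℂ) (E := ℂ) hf).eventually_ne h

/-- A function that is regular along a projective line, given by two affine charts `γ` and `γ'`,
is constant on it. -/
theorem regular_eq_of_curve {X : FunctionSpace.{u}} (γ γ' : ℂ → X)
    (hγ : ∀ t, MorphAt (X := complexLine) γ t) (hγ' : ∀ t, MorphAt (X := complexLine) γ' t)
    (h : ∀ t : ℂ, t ≠ 0 → γ t = γ' t⁻¹) (S : X → ℂ) (hS : ∀ t, X.RegularAt S (γ t))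
    (hS' : ∀ t, X.RegularAt S (γ' t)) : S (γ 0) = S (γ' 0) := by
  have h1 : Differentiable ℂ (fun t : ℂ => S (γ t)) := fun t => (hγ t).regular S (hS t)
  have h2 : Differentiable ℂ (fun t : ℂ => S (γ' t)) := fun t => (hγ' t).regular S (hS' t)
  -- Liouville: `S ∘ γ` is entire, and through the second chart it has the finite limit `S (γ' 0)`
  -- at infinity.
  refine h1.apply_eq_of_tendsto_cocompact 0 ?_
  have h3 : Filter.Tendsto (fun t : ℂ => S (γ' t⁻¹)) (Filter.cocompact ℂ) (𝓝 (S (γ' 0))) := by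
    rw [← Metric.cobounded_eq_cocompact]
    exact (h2.continuous.tendsto 0).comp Filter.tendsto_inv₀_cobounded
  refine h3.congr' ?_
  rw [← Metric.cobounded_eq_cocompact]
  filter_upwards [Bornology.eventually_ne_cobounded (0 : ℂ)] with t ht
  rw [h t ht]

/-! ### Plücker coordinates -/

section Plucker

variable {V : Type u} [AddCommGroup V] [Module ℂ V]

/-- The linear form on `⋀^m V` which maps `v₀ ∧ ⋯ ∧ v_{m-1}` to `det (l i (v j))`. -/
noncomputable def detForm {m : ℕ} (l : Fin m → Dual ℂ V) : Dual ℂ (⋀[ℂ]^m V) :=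
  exteriorPower.alternatingMapLinearEquiv
    ((Matrix.detRowAlternating (n := Fin m) (R := ℂ)).compLinearMap (LinearMap.pi l))

theorem detForm_ιMulti {m : ℕ} (l : Fin m → Dual ℂ V) (e : Fin m → V) :
    detForm l (exteriorPower.ιMulti ℂ m e) = (Matrix.of fun j i => l i (e j)).det := by
  rw [detForm, exteriorPower.alternatingMapLinearEquiv_apply_ιMulti]
  rfl

/-- Alternating maps agree once they agree on injective reindexings of a basis. For a finite index
type these are permutations, which contribute the same sign on both sides. -/
theorem AlternatingMap.eq_basis_det_smul {R M N : Type*} [CommRing R] [AddCommGroup M]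
    [Module R M] [AddCommGroup N] [Module R N] {ι : Type*} [Fintype ι] [DecidableEq ι]
    (f : M [⋀^ι]→ₗ[R] N) (b : Basis ι R M) (v : ι → M) : f v = b.det v • f b := by
  have : f = (LinearMap.toSpanSingleton R N (f b)).compAlternatingMap b.det := by
    refine Basis.ext_alternating b fun σ hσ => ?_
    obtain ⟨τ, rfl⟩ : ∃ τ : Equiv.Perm ι, ⇑τ = σ :=
      ⟨Equiv.ofBijective σ (Finite.injective_iff_bijective.1 hσ), rfl⟩
    have h1 := f.map_perm (⇑b) τ
    have h2 := b.det.map_perm (⇑b) τ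
    rw [b.det_self] at h2
    simp only [Function.comp_def] at h1 h2
    rw [h1, LinearMap.compAlternatingMap_apply, h2]
    simp
  exact congrArg (fun g => g v) this

variable {C : Submodule ℂ V → Prop} {m : ℕ}

/-- A family of vectors of `W` dual to the linear forms `l i`. -/
def IsDualFrame (l : Fin m → Dual ℂ V) (W : Submodule ℂ V) (w : Fin m → V) : Prop :=
  (∀ i, w i ∈ W) ∧ ∀ i j, l i (w j) = (1 : Matrix (Fin m) (Fin m) ℂ) i j

theorem detForm_dualFrame {l : Fin m → Dual ℂ V} {W : Submodule ℂ V} {w : Fin m → V}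
    (h : IsDualFrame l W w) : detForm l (exteriorPower.ιMulti ℂ m w) = 1 := by
  rw [detForm_ιMulti]
  convert Matrix.det_one (n := Fin m) (R := ℂ) using 2
  ext i j
  simp [h.2 j i, Matrix.one_apply, eq_comm]

/-- Cramer's rule for the identity matrix: exchanging the form `l i` for `f` replaces one column by
the values of `f`. Thus the coordinates of a dual frame are Plücker coordinates. -/
theorem detForm_update_dualFrame {l : Fin m → Dual ℂ V} {W : Submodule ℂ V} {w : Fin m → V}
    (h : IsDualFrame l W w) (i : Fin m) (f : Dual ℂ V) :
    detForm (Function.update l i f) (exteriorPower.ιMulti ℂ m w) = f (w i) := by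
  rw [detForm_ιMulti]
  have := Matrix.cramer_apply (1 : Matrix (Fin m) (Fin m) ℂ) (fun j => f (w j)) i
  rw [Matrix.cramer_one] at this
  simp only [Module.End.one_apply] at this
  rw [this]
  congr 1
  ext j k
  rw [Matrix.updateCol_apply, Matrix.of_apply, Function.update_apply]
  split_ifs with hk
  · rfl
  · rw [h.2 k j, Matrix.one_apply, Matrix.one_apply]; simp [eq_comm]

theorem exists_dual_eq_one {ι : Type*} [Fintype ι] [DecidableEq ι] {e : ι → V}
    (he : LinearIndependent ℂ e) :
    ∃ l : ι → Dual ℂ V, ∀ i j, l i (e j) = (1 : Matrix ι ι ℂ) i j := by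
  obtain ⟨g, hg⟩ := LinearMap.exists_leftInverse_of_injective
    (Fintype.linearCombination ℂ e) 
    (LinearMap.ker_eq_bot.2 (linearIndependent_iff_injective_fintypeLinearCombination.1 he))
  refine ⟨fun i => LinearMap.proj i ∘ₗ g, fun i j => ?_⟩
  have := LinearMap.congr_fun hg (Pi.single j 1)
  rw [LinearMap.comp_apply, Fintype.linearCombination_apply_single, one_smul] at this
  simp [this, Matrix.one_apply, Pi.single_apply]

variable [FiniteDimensional ℂ V]

/-- Two bases of `W` have wedge products that differ by the determinant of the base change. This
frees the later arguments from the particular basis chosen in `Grass.plucker`. -/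
theorem Grass.plucker_eq_smul (W : Grass C m) (e : Fin m → V)
    (he : Submodule.span ℂ (Set.range e) = W.space) :
    ∃ r : ℂ, r ≠ 0 ∧ W.plucker = r • exteriorPower.ιMulti ℂ m e := by
  have hmem : ∀ i, e i ∈ W.space := fun i => he ▸ Submodule.subset_span ⟨i, rfl⟩
  let e' : Fin m → W.space := fun i => ⟨e i, hmem i⟩
  have hspan : ⊤ ≤ Submodule.span ℂ (Set.range e') := by
    rintro ⟨x, hx⟩ -
    rw [← he] at hx
    have : Submodule.span ℂ (Set.range e) =
        (Submodule.span ℂ (Set.range e')).map W.space.subtype := by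
      rw [Submodule.map_span, ← Set.range_comp]; rfl
    rw [this] at hx
    obtain ⟨y, hy, hyx⟩ := hx
    rwa [show (⟨x, _⟩ : W.space) = y from Subtype.ext hyx.symm]
  let b := basisOfTopLeSpanOfCardEqFinrank e' hspan (by simp [W.finrank_eq])
  let b₀ := finBasisOfFinrankEq ℂ W.space W.finrank_eq
  refine ⟨b.det b₀, (b.isUnit_det b₀).ne_zero, ?_⟩
  have := AlternatingMap.eq_basis_det_smul
    ((exteriorPower.ιMulti ℂ m).compLinearMap W.space.subtype) b b₀
  rw [AlternatingMap.compLinearMap_apply, AlternatingMap.compLinearMap_apply] at this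
  rw [show (fun i => W.space.subtype (b i)) = e by funext i; simp [b, e']] at this
  exact this

theorem Grass.exists_frame (W : Grass C m) : ∃ e : Fin m → V,
    Submodule.span ℂ (Set.range e) = W.space ∧ W.plucker = exteriorPower.ιMulti ℂ m e := by
  refine ⟨_, ?_, rfl⟩
  have := congrArg (Submodule.map W.space.subtype)
    (finBasisOfFinrankEq ℂ W.space W.finrank_eq).span_eq
  rw [Submodule.map_span, ← Set.range_comp, Submodule.map_subtype_top] at this
  exact this

theorem IsDualFrame.span_eq {l : Fin m → Dual ℂ V} {W : Submodule ℂ V} (hW : finrank ℂ W = m)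
    {w : Fin m → V} (h : IsDualFrame l W w) : Submodule.span ℂ (Set.range w) = W := by
  have hli : LinearIndependent ℂ w := by
    refine LinearIndependent.of_comp (LinearMap.pi l) ?_
    rw [show LinearMap.pi l ∘ w = fun j => Pi.single j 1 by
      ext j i; simp [h.2 i j, Matrix.one_apply, Pi.single_apply]]
    exact Pi.linearIndependent_single_one (Fin m) ℂ
  refine Submodule.eq_of_le_of_finrank_eq (Submodule.span_le.2 ?_) ?_
  · rintro _ ⟨i, rfl⟩; exact h.1 i
  · rw [finrank_span_eq_card hli, hW, Fintype.card_fin]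

theorem Grass.detForm_ne_zero {W : Grass C m} {l : Fin m → Dual ℂ V} {w : Fin m → V}
    (h : IsDualFrame l W.space w) : detForm l W.plucker ≠ 0 := by
  obtain ⟨r, hr, hp⟩ := W.plucker_eq_smul w (h.span_eq W.finrank_eq)
  rw [hp, map_smul, detForm_dualFrame h]
  simpa using hr

/-- On the wedge of a basis, `detForm l` is the determinant of the matrix of values of the `l i`;
the inverse matrix turns the basis into a dual one. -/
theorem Grass.exists_dualFrame {W : Grass C m} {l : Fin m → Dual ℂ V}
    (h : detForm l W.plucker ≠ 0) : ∃ w, IsDualFrame l W.space w := by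
  obtain ⟨e, he, hp⟩ := W.exists_frame
  rw [hp, detForm_ιMulti] at h
  set A : Matrix (Fin m) (Fin m) ℂ := Matrix.of fun j i => l i (e j) with hA
  have hu : IsUnit A.det := isUnit_iff_ne_zero.2 h
  refine ⟨fun j => ∑ k, A⁻¹ j k • e k, fun j => ?_, fun i j => ?_⟩
  · exact Submodule.sum_mem _ fun k _ => Submodule.smul_mem _ _
      (he ▸ Submodule.subset_span ⟨k, rfl⟩)
  · have := congrFun (congrFun (Matrix.nonsing_inv_mul A hu) j) i
    rw [Matrix.mul_apply] at this
    rw [map_sum]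
    simp only [map_smul, smul_eq_mul]
    rw [Matrix.one_apply] at this ⊢
    simpa only [eq_comm, hA, Matrix.of_apply] using this

open Classical in
/-- The basis of `W` dual to the linear forms `l i`, if it exists. -/
noncomputable def dualFrame (l : Fin m → Dual ℂ V) (W : Submodule ℂ V) : Fin m → V :=
  if h : ∃ w, IsDualFrame l W w then h.choose else 0

theorem Grass.dualFrame_spec {W : Grass C m} {l : Fin m → Dual ℂ V}
    (h : detForm l W.plucker ≠ 0) : IsDualFrame l W.space (dualFrame l W.space) := by
  have h' := W.exists_dualFrame h
  rw [dualFrame, dif_pos h']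
  exact h'.choose_spec

theorem Grass.plucker_ne_zero (W : Grass C m) : W.plucker ≠ 0 := by
  obtain ⟨e, he, hp⟩ := W.exists_frame
  have hli : LinearIndependent ℂ e := by
    rw [linearIndependent_iff_card_eq_finrank_span, Set.finrank, he, W.finrank_eq,
      Fintype.card_fin]
  obtain ⟨l, hl⟩ := exists_dual_eq_one hli
  intro h0
  refine W.detForm_ne_zero (l := l) (w := e)
    ⟨fun i => he ▸ Submodule.subset_span ⟨i, rfl⟩, hl⟩ ?_
  rw [h0, map_zero]

/-- Injectivity of the Plücker map. If some `v ∈ W'` is not in `W`, choose forms dual to a basis of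
`W` that vanish at `v`. Their determinant is nonzero on `W`, hence on `W'` by proportionality, so
they are coordinates on `W'`. But all of them vanish at `v`, although `v ≠ 0`. -/
theorem Grass.eq_of_plucker_eq_smul {W W' : Grass C m} {r : ℂ} (h : W.plucker = r • W'.plucker) :
    W = W' := by
  by_contra hne
  have hle : ¬ W'.space ≤ W.space := fun hle => hne (Grass.ext
    (Submodule.eq_of_le_of_finrank_eq hle (by rw [W.finrank_eq, W'.finrank_eq])).symm)
  obtain ⟨v, hv', hv⟩ := Set.not_subset.1 hle
  obtain ⟨e, he, hp⟩ := W.exists_frame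
  have hli : LinearIndependent ℂ e := by
    rw [linearIndependent_iff_card_eq_finrank_span, Set.finrank, he, W.finrank_eq,
      Fintype.card_fin]
  have hli' : LinearIndependent ℂ (fun o : Option (Fin m) => o.casesOn' v e) :=
    linearIndependent_option'.2 ⟨hli, he ▸ hv⟩
  obtain ⟨l, hl⟩ := exists_dual_eq_one hli'
  have h1 : detForm (fun i => l (some i)) W.plucker ≠ 0 :=
    W.detForm_ne_zero (w := e) ⟨fun i => he ▸ Submodule.subset_span ⟨i, rfl⟩, fun i j => by
      simpa [Matrix.one_apply] using hl (some i) (some j)⟩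
  have h2 : detForm (fun i => l (some i)) W'.plucker ≠ 0 := by
    rw [h, map_smul] at h1
    exact right_ne_zero_of_mul h1
  obtain ⟨w, hw⟩ := W'.exists_dualFrame h2
  have hv0 : v = 0 := by
    rw [← hw.span_eq W'.finrank_eq] at hv'
    obtain ⟨a, rfl⟩ := (Submodule.mem_span_range_iff_exists_fun ℂ).1 hv'
    refine Finset.sum_eq_zero fun i _ => ?_
    have h3 : l (some i) (∑ j, a j • w j) = 0 := by
      simpa [Matrix.one_apply] using hl (some i) none
    rw [map_sum] at h3
    simp only [map_smul, hw.2, Matrix.one_apply, smul_eq_mul, mul_ite, mul_one, mul_zero,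
      Finset.sum_ite_eq, Finset.mem_univ, if_true] at h3
    rw [h3, zero_smul]
  exact hv (hv0 ▸ W.space.zero_mem)

instance : LocallyRinged (grassVariety C m) :=
  inferInstanceAs (LocallyRinged (ofCoordinates _ _))

instance {k : ℕ} (m : Fin k → ℕ) : LocallyRinged (flagVariety C m) :=
  inferInstanceAs (LocallyRinged (ofCoordinates _ _))

instance : LocallyRinged pointVariety :=
  inferInstanceAs (LocallyRinged (ofCoordinates _ _))

theorem eventually_plucker_ne_zero (l : Dual ℂ (⋀[ℂ]^m V)) {W : Grass C m}
    (h : l W.plucker ≠ 0) :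
    ∀ᶠ W' : grassVariety C m in 𝓝 (W : grassVariety C m), l (Grass.plucker (C := C) W') ≠ 0 :=
  eventually_ne_zero_ofCoordinates (c := fun (W : Grass C m) (_ : Unit) => W.plucker)
    (E := fun _ => ⋀[ℂ]^m V) (P := fun e => l (e ()))
    (IsMultihomogeneous.linear (E := fun _ => ⋀[ℂ]^m V) () l) h

theorem regularAt_plucker_ratio (l l' : Dual ℂ (⋀[ℂ]^m V)) {W : Grass C m}
    (h : l' W.plucker ≠ 0) :
    (grassVariety C m).RegularAt (fun W' : Grass C m => l W'.plucker / l' W'.plucker) W :=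
  regularAt_ratio (c := fun (W : Grass C m) (_ : Unit) => W.plucker) () l l' W h

/-- The scalar between `W'.plucker` and the wedge of the dual frame cancels in a ratio of Plücker
coordinates, and what remains is the vector entry given by `detForm_update_dualFrame`. -/
theorem regularAt_dualFrame {l : Fin m → Dual ℂ V} {W : Grass C m}
    (h : detForm l W.plucker ≠ 0) (i : Fin m) (f : Dual ℂ V) :
    (grassVariety C m).RegularAt (fun W' : Grass C m => f (dualFrame l W'.space i)) W := by
  refine LocallyRinged.congr
    (regularAt_plucker_ratio (detForm (Function.update l i f)) (detForm l) h) ?_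
  filter_upwards [eventually_plucker_ne_zero (detForm l) h] with W' hW'
  have hd := Grass.dualFrame_spec (C := C) hW'
  obtain ⟨r, hr, hp⟩ := Grass.plucker_eq_smul (C := C) W' _ (hd.span_eq W'.finrank_eq)
  rw [hp, map_smul, map_smul, detForm_dualFrame hd, detForm_update_dualFrame hd]
  simp [hr]

/-- The Plücker coordinates of regular vectors are regular. -/
theorem regularAt_ιMulti {S : FunctionSpace.{w}} [LocallyRinged S] {x : S} {e : S → Fin m → V}
    (he : ∀ i (f : Dual ℂ V), S.RegularAt (fun y => f (e y i)) x) (l : Dual ℂ (⋀[ℂ]^m V)) :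
    S.RegularAt (fun y => l (exteriorPower.ιMulti ℂ m (e y))) x := by
  let b := finBasis ℂ V
  have key : ∀ y, l (exteriorPower.ιMulti ℂ m (e y)) =
      ∑ r : Fin m → Fin (finrank ℂ V), (∏ i, b.coord (r i) (e y i)) *
        l (exteriorPower.ιMulti ℂ m (fun i => b (r i))) := by
    intro y
    have h1 : e y = fun i => ∑ k, b.coord k (e y i) • b k := by
      funext i
      exact (b.sum_repr (e y i)).symm
    conv_lhs => rw [h1]
    have h2 := (exteriorPower.ιMulti ℂ m (M := V)).toMultilinearMap.map_sum
      (fun (i : Fin m) k => b.coord k (e y i) • b k)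
    rw [AlternatingMap.coe_multilinearMap] at h2
    rw [h2, map_sum]
    refine Finset.sum_congr rfl fun r _ => ?_
    have h3 := (exteriorPower.ιMulti ℂ m (M := V)).toMultilinearMap.map_smul_univ
      (fun i => b.coord (r i) (e y i)) (fun i => b (r i))
    rw [AlternatingMap.coe_multilinearMap] at h3
    rw [h3, map_smul, smul_eq_mul]
  simp only [key]
  exact LocallyRinged.sum _ fun r _ =>
    LocallyRinged.mul (LocallyRinged.prod _ fun i _ => he i _) (LocallyRinged.const _ _)

end Plucker

/-! ### Isotropic subspaces -/

section Isotropic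

variable {V : Type u} [AddCommGroup V] [Module ℂ V] {B : LinearMap.BilinForm ℂ V}

theorem mem_sup_span_singleton {W : Submodule ℂ V} {v y : V} :
    y ∈ W ⊔ Submodule.span ℂ {v} ↔ ∃ x ∈ W, ∃ a : ℂ, x + a • v = y := by
  simp [Submodule.mem_sup, Submodule.mem_span_singleton]

theorem IsIsotropic.mono {W W' : Submodule ℂ V} (h : IsIsotropic B W') (hW : W ≤ W') :
    IsIsotropic B W := fun x hx y hy => h x (hW hx) y (hW hy)

theorem IsIsotropic.bot : IsIsotropic B (⊥ : Submodule ℂ V) := by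
  rintro x hx y -
  rw [(Submodule.mem_bot ℂ).1 hx, map_zero, LinearMap.zero_apply]

theorem IsIsotropic.le_orthogonal {W : Submodule ℂ V} (h : IsIsotropic B W) :
    W ≤ B.orthogonal W := fun x hx y hy => h y hy x hx

theorem IsIsotropic.sup_span {W : Submodule ℂ V} (h : IsIsotropic B W) (hB : B.IsRefl) {v : V}
    (hv : ∀ x ∈ W, B x v = 0) (hvv : B v v = 0) : IsIsotropic B (W ⊔ Submodule.span ℂ {v}) := by
  intro x hx y hy
  obtain ⟨x, hxW, a, rfl⟩ := mem_sup_span_singleton.1 hx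
  obtain ⟨y, hyW, b, rfl⟩ := mem_sup_span_singleton.1 hy
  simp [h x hxW y hyW, hv x hxW, hB _ _ (hv y hyW), hvv]

theorem finrank_sup_span_of_notMem [FiniteDimensional ℂ V] {W : Submodule ℂ V} {v : V}
    (hv : v ∉ W) : finrank ℂ ↥(W ⊔ Submodule.span ℂ {v}) = finrank ℂ W + 1 := by
  have hv0 : v ≠ 0 := fun h => hv (h ▸ W.zero_mem)
  have h := Submodule.finrank_sup_add_finrank_inf_eq W (Submodule.span ℂ {v})
  rw [finrank_span_singleton hv0, (Submodule.disjoint_span_singleton' hv0).2 hv |>.eq_bot,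
    finrank_bot] at h
  exact h

theorem IsIsotropic.map_isometry {W : Submodule ℂ V} (h : IsIsotropic B W) {g : V ≃ₗ[ℂ] V}
    (hg : ∀ x y, B (g x) (g y) = B x y) : IsIsotropic B (W.map (g : V →ₗ[ℂ] V)) := by
  rintro _ ⟨x, hx, rfl⟩ _ ⟨y, hy, rfl⟩
  exact (hg x y).trans (h x hx y hy)

theorem IsOrthogonalMember.of_two_mul_ne {W₀ : MaxIsotropic B} {W : Submodule ℂ V}
    (h : IsIsotropic B W) (hd : 2 * finrank ℂ W ≠ finrank ℂ V) : IsOrthogonalMember B W₀ W :=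
  ⟨h, fun h' => absurd h' hd⟩

variable [FiniteDimensional ℂ V]

theorem IsIsotropic.two_mul_finrank_le (hB : B.Nondegenerate) {W : Submodule ℂ V}
    (h : IsIsotropic B W) : 2 * finrank ℂ W ≤ finrank ℂ V := by
  have h1 := Submodule.finrank_mono h.le_orthogonal
  rw [LinearMap.BilinForm.finrank_orthogonal hB] at h1
  have := W.finrank_le
  omega

theorem IsIsotropic.orthogonal_eq (hB : B.Nondegenerate) {W : Submodule ℂ V}
    (h : IsIsotropic B W) (hW : 2 * finrank ℂ W = finrank ℂ V) : B.orthogonal W = W := by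
  refine (Submodule.eq_of_le_of_finrank_eq h.le_orthogonal ?_).symm
  rw [LinearMap.BilinForm.finrank_orthogonal hB]
  omega

theorem exists_mem_notMem_of_finrank_lt {U W : Submodule ℂ V}
    (h : finrank ℂ U < finrank ℂ W) : ∃ x ∈ W, x ∉ U := by
  by_contra! h'
  exact absurd (Submodule.finrank_mono (show W ≤ U from h')) (by omega)

/-- Isotropic subspaces extend one step in the case of a symmetric form. -/
theorem IsIsotropic.exists_isotropic_vector (hB : B.Nondegenerate) (hS : B.IsSymm)
    {W : Submodule ℂ V} (hW : 2 * (finrank ℂ W + 1) ≤ finrank ℂ V) :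
    ∃ v, v ∉ W ∧ (∀ x ∈ W, B x v = 0) ∧ B v v = 0 := by
  have h1 := LinearMap.BilinForm.finrank_orthogonal hB W
  obtain ⟨x, hx, hxW⟩ := exists_mem_notMem_of_finrank_lt
    (show finrank ℂ W < finrank ℂ (B.orthogonal W) by omega)
  have h2 := finrank_sup_span_of_notMem hxW
  obtain ⟨y, hy, hyW⟩ := exists_mem_notMem_of_finrank_lt
    (show finrank ℂ ↥(W ⊔ Submodule.span ℂ {x}) < finrank ℂ (B.orthogonal W) by omega)
  by_cases hxx : B x x = 0
  · exact ⟨x, hxW, hx, hxx⟩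
  -- The orthogonal of `W` contains two vectors `x`, `y` independent modulo `W`. The vector `y + a •
  -- x` is isotropic iff `a` solves a quadratic equation with leading coefficient `B x x ≠ 0`, which
  -- is soluble over ℂ.
  obtain ⟨s, hs⟩ := IsAlgClosed.exists_eq_mul_self (discrim (B x x) (2 * B x y) (B y y))
  obtain ⟨a, ha⟩ := exists_quadratic_eq_zero hxx ⟨s, hs⟩
  refine ⟨y + a • x, fun h => hyW ?_, fun z hz => ?_, ?_⟩
  · rw [mem_sup_span_singleton]
    exact ⟨y + a • x, h, -a, by simp⟩
  · rw [map_add, map_smul, show B z y = 0 from hy z hz, show B z x = 0 from hx z hz]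
    simp
  · have hyx : B y x = B x y := hS.eq y x
    simp only [map_add, map_smul, LinearMap.add_apply, LinearMap.smul_apply, smul_eq_mul, hyx]
    linear_combination ha

theorem exists_isotropic_extension (hR : B.IsRefl)
    (hstep : ∀ W : Submodule ℂ V, 2 * (finrank ℂ W + 1) ≤ finrank ℂ V →
      ∃ v, v ∉ W ∧ (∀ x ∈ W, B x v = 0) ∧ B v v = 0) {M : ℕ} (hM : 2 * M ≤ finrank ℂ V)
    {W : Submodule ℂ V} (h : IsIsotropic B W) (hW : finrank ℂ W ≤ M) :
    ∃ T : Submodule ℂ V, W ≤ T ∧ IsIsotropic B T ∧ finrank ℂ T = M := by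
  obtain ⟨d, hd⟩ := Nat.exists_eq_add_of_le hW
  induction d generalizing W with
  | zero => exact ⟨W, le_rfl, h, hd.symm⟩
  | succ d ih =>
    obtain ⟨v, hv, hvW, hvv⟩ := hstep W (by omega)
    have h1 := finrank_sup_span_of_notMem hv
    obtain ⟨T, hT, hT'⟩ := ih (h.sup_span hR hvW hvv) (by omega) (by omega)
    exact ⟨T, le_sup_left.trans hT, hT'⟩

theorem exists_alternating_vector (hB : B.Nondegenerate) (hA : B.IsAlt) (W : Submodule ℂ V)
    (hW : 2 * (finrank ℂ W + 1) ≤ finrank ℂ V) :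
    ∃ v, v ∉ W ∧ (∀ x ∈ W, B x v = 0) ∧ B v v = 0 := by
  have h1 := LinearMap.BilinForm.finrank_orthogonal hB W
  obtain ⟨x, hx, hxW⟩ := exists_mem_notMem_of_finrank_lt
    (show finrank ℂ W < finrank ℂ (B.orthogonal W) by omega)
  exact ⟨x, hxW, hx, hA x⟩

/-- A family of isotropic vectors dual to a basis of an isotropic subspace. -/
theorem exists_opposite (hB : B.Nondegenerate) {ε : ℂ} (hε : ε * ε = 1)
    (hBε : ∀ x y, B x y = ε * B y x) {M : ℕ} {e : Fin M → V} (he : LinearIndependent ℂ e)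
    (hI : ∀ i j, B (e i) (e j) = 0) :
    ∃ e' : Fin M → V, (∀ i j, B (e' i) (e j) = (1 : Matrix (Fin M) (Fin M) ℂ) i j) ∧
      ∀ i j, B (e' i) (e' j) = 0 := by
  obtain ⟨l, hl⟩ := exists_dual_eq_one he
  let y : Fin M → V := fun i => (B.toDual hB).symm (l i)
  have hy : ∀ i x, B (y i) x = l i x := fun i x => by
    rw [← LinearMap.BilinForm.toDual_def hB, LinearEquiv.apply_symm_apply]
  have hye : ∀ i j, B (y i) (e j) = (1 : Matrix (Fin M) (Fin M) ℂ) i j := fun i j => by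
    rw [hy, hl]
  -- The representatives `y i` of the dual forms pair correctly with `e`. Subtracting half of their
  -- Gram matrix along the isotropic span of `e` keeps these pairings, and the two cross terms each
  -- cancel half of `B (y i) (y j)`. The sign `ε` covers symmetric and alternating forms together.
  refine ⟨fun i => y i - (ε / 2) • ∑ k, B (y i) (y k) • e k, fun i j => ?_, fun i j => ?_⟩
  · simp [hye, hI]
  · have h1 : ∀ k, B (e k) (y j) = ε * (1 : Matrix (Fin M) (Fin M) ℂ) j k := fun k => by
      rw [hBε, hye]
    simp only [map_sub, map_smul, map_sum, LinearMap.sub_apply, LinearMap.smul_apply,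
      LinearMap.sum_apply, smul_eq_mul, hye, hI, h1, Matrix.one_apply, mul_ite, mul_one, mul_zero,
      Finset.sum_ite_eq, Finset.mem_univ, if_true, Finset.sum_const_zero, sub_zero]
    rw [hBε (y j) (y i)]
    linear_combination (-B (y i) (y j)) * hε

end Isotropic

/-! ### The two families of maximal isotropic subspaces -/

section Components

variable {V : Type u} [AddCommGroup V] [Module ℂ V] [FiniteDimensional ℂ V]
  {B : LinearMap.BilinForm ℂ V}

/-- A reflection is the transvection along `-z` of a form with value 2 at `z`, so its determinant is
1 - 2. Reflections are what links the two components of Lagrangian subspaces. -/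
theorem exists_reflection (hS : B.IsSymm) {z : V} (hz : B z z ≠ 0) :
    ∃ r : V ≃ₗ[ℂ] V, (∀ x, r x = x - (2 * B z x / B z z) • z) ∧
      (∀ x y, B (r x) (r y) = B x y) ∧ LinearMap.det (r : V →ₗ[ℂ] V) = -1 := by
  have hf : ((2 / B z z) • B z) z = 2 := by
    rw [LinearMap.smul_apply, smul_eq_mul]; field_simp
  have hr : ∀ x, Module.reflection hf x = x - (2 * B z x / B z z) • z := fun x => by
    rw [Module.reflection_apply, LinearMap.smul_apply, smul_eq_mul, div_mul_eq_mul_div]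
  refine ⟨Module.reflection hf, hr, fun x y => ?_, ?_⟩
  · have hxz : B x z = B z x := hS.eq x z
    simp only [hr, map_sub, map_smul, LinearMap.sub_apply, LinearMap.smul_apply, smul_eq_mul, hxz]
    field_simp
    ring
  · have : ((Module.reflection hf : V ≃ₗ[ℂ] V) : V →ₗ[ℂ] V) =
        LinearMap.transvection ((2 / B z z) • B z) (-z) := by
      ext x
      simp [Module.reflection_apply, LinearMap.transvection.apply, sub_eq_add_neg]
    rw [this, LinearMap.transvection.det, map_neg, hf]
    norm_num

/-- Two Lagrangian subspaces of a symmetric form differ by an isometry whose determinant is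
given by the parity of the codimension of their intersection. -/
theorem exists_isometry_map_eq (hB : B.Nondegenerate) (hS : B.IsSymm) {T T' : Submodule ℂ V}
    (hT : IsIsotropic B T) (hT' : IsIsotropic B T') (hd : 2 * finrank ℂ T = finrank ℂ V)
    (hd' : finrank ℂ T' = finrank ℂ T) :
    ∃ g : V ≃ₗ[ℂ] V, (∀ x y, B (g x) (g y) = B x y) ∧
      LinearMap.det (g : V →ₗ[ℂ] V) = (-1) ^ (finrank ℂ T - finrank ℂ ↥(T ⊓ T')) ∧
      T' = T.map (g : V →ₗ[ℂ] V) := by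
  obtain ⟨d, hdd⟩ : ∃ d, finrank ℂ T - finrank ℂ ↥(T ⊓ T') = d := ⟨_, rfl⟩
  have hle : finrank ℂ ↥(T ⊓ T') ≤ finrank ℂ T := Submodule.finrank_mono inf_le_left
  rw [hdd]
  induction d generalizing T with
  | zero =>
    refine ⟨LinearEquiv.refl ℂ V, fun _ _ => rfl, by simp, ?_⟩
    have h1 : T ⊓ T' = T := Submodule.eq_of_le_of_finrank_eq inf_le_left (by omega)
    have h2 : T = T' := Submodule.eq_of_le_of_finrank_eq (inf_eq_left.1 h1) hd'.symm
    simp [h2]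
  | succ d ih =>
    have hne : ¬ T' ≤ T := fun h => by
      rw [inf_eq_right.2 h] at hdd; omega
    -- Since `T` is its own orthogonal, some `b ∈ T` pairs nontrivially with `a ∈ T' \ T`. The
    -- reflection in `b - a` sends `b` to `a` and fixes `T ⊓ T'` pointwise. So it enlarges the
    -- intersection with `T'` by exactly one dimension, at the cost of one factor -1 in the
    -- determinant.
    obtain ⟨a, haT', haT⟩ := Set.not_subset.1 hne
    obtain ⟨b, hbT, hab⟩ : ∃ b ∈ T, B b a ≠ 0 := by
      by_contra! h
      exact haT (hT.orthogonal_eq hB hd ▸ h)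
    have hba : B a b = B b a := hS.eq a b
    have haa : B a a = 0 := hT' a haT' a haT'
    have hbb : B b b = 0 := hT b hbT b hbT
    have hzz : B (b - a) (b - a) = -(2 * B b a) := by
      simp only [map_sub, LinearMap.sub_apply, haa, hbb, hba]; ring
    obtain ⟨r, hr, hri, hrd⟩ := exists_reflection hS (z := b - a)
      (by rw [hzz]; simpa using hab)
    have hrT : ∀ x ∈ T, r x = x - (B x a / B b a) • (b - a) := fun x hx => by
      have h1 : B (b - a) x = - B x a := by
        rw [map_sub, LinearMap.sub_apply, hT b hbT x hx, hS.eq x a |>.symm]; simp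
      rw [hr, hzz, h1]
      congr 2
      field_simp
    have hrb : r b = a := by rw [hrT b hbT, div_self hab]; simp
    set T₁ := T.map (r : V →ₗ[ℂ] V) with hT₁
    have hf₁ : finrank ℂ T₁ = finrank ℂ T := LinearEquiv.finrank_map_eq r T
    have hinf : T₁ ⊓ T' = (T ⊓ T') ⊔ Submodule.span ℂ {a} := by
      apply le_antisymm
      · rintro _ ⟨⟨x, hx, rfl⟩, hx'⟩
        rw [mem_sup_span_singleton]
        have h1 : r x = x - (B x a / B b a) • (b - a) := hrT x hx
        refine ⟨x - (B x a / B b a) • b, ⟨T.sub_mem hx (T.smul_mem _ hbT), ?_⟩,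
          B x a / B b a, ?_⟩
        · have h2 : x - (B x a / B b a) • b = r x - (B x a / B b a) • a := by
            rw [h1, smul_sub]; abel
          rw [h2]
          exact T'.sub_mem hx' (T'.smul_mem _ haT')
        · rw [LinearEquiv.coe_coe, h1, smul_sub]; abel
      · refine sup_le (fun x hx => ⟨⟨x, hx.1, ?_⟩, hx.2⟩) ?_
        · have h1 := hrT x hx.1
          rw [hT' x hx.2 a haT'] at h1
          simpa using h1
        · rw [Submodule.span_singleton_le_iff_mem]
          exact ⟨⟨b, hbT, hrb⟩, haT'⟩
    have hf₂ : finrank ℂ ↥(T₁ ⊓ T') = finrank ℂ ↥(T ⊓ T') + 1 := by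
      rw [hinf]
      exact finrank_sup_span_of_notMem fun h => haT h.1
    obtain ⟨g, hg, hgd, hgT⟩ := ih (T := T₁) (hT.map_isometry hri) (by omega) (by omega)
      (by omega) (by omega)
    refine ⟨r.trans g, fun x y => (hg _ _).trans (hri _ _), ?_, ?_⟩
    · rw [LinearEquiv.coe_trans, LinearMap.det_comp, hgd, hrd, pow_succ]
    · rw [hgT, hT₁, LinearEquiv.coe_trans, Submodule.map_comp]

/-- An isometry which preserves a Lagrangian subspace has determinant one. -/
theorem det_eq_one_of_map_eq (hB : B.Nondegenerate) {T : Submodule ℂ V}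
    (hT : IsIsotropic B T) (hd : 2 * finrank ℂ T = finrank ℂ V) {g : V ≃ₗ[ℂ] V}
    (hg : ∀ x y, B (g x) (g y) = B x y) (hgT : T.map (g : V →ₗ[ℂ] V) = T) :
    LinearMap.det (g : V →ₗ[ℂ] V) = 1 := by
  have hgT' : T ≤ T.comap (g : V →ₗ[ℂ] V) := Submodule.map_le_iff_le_comap.1 hgT.le
  have hperp := hT.orthogonal_eq hB hd
  -- Through `B`, the quotient by the Lagrangian `T` is the dual of `T`. Invariance of `B` says that
  -- the map `q` induced by `g` on the quotient is inverse to the transpose of the restriction `f`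
  -- of `g` to `T`, so `det g = det f * det q = 1`.
  let Φ : V →ₗ[ℂ] Dual ℂ T := (Dual.transpose (R := ℂ) T.subtype) ∘ₗ B.flip
  have hΦ : ∀ x (y : T), Φ x y = B y x := fun x y => rfl
  have hker : LinearMap.ker Φ = T := by
    ext x
    rw [LinearMap.mem_ker]
    refine ⟨fun h => ?_, fun h => LinearMap.ext fun y => hT y y.2 x h⟩
    rw [← hperp]
    exact fun y hy => LinearMap.congr_fun h ⟨y, hy⟩
  let Ψ : (V ⧸ T) →ₗ[ℂ] Dual ℂ T := T.liftQ Φ hker.ge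
  have hΨ : Function.Bijective Ψ := by
    have hinj : Function.Injective Ψ := by
      rw [← LinearMap.ker_eq_bot]
      exact Submodule.ker_liftQ_eq_bot _ _ _ hker.le
    refine ⟨hinj, (LinearMap.injective_iff_surjective_of_finrank_eq_finrank ?_).1 hinj⟩
    have h1 := T.finrank_quotient_add_finrank
    rw [Subspace.dual_finrank_eq]
    omega
  let e := LinearEquiv.ofBijective Ψ hΨ
  set q := T.mapQ T (g : V →ₗ[ℂ] V) hgT' with hq
  set f := (g : V →ₗ[ℂ] V).restrict hgT' with hf
  have hcomm : f.dualMap ∘ₗ (Ψ ∘ₗ q) = Ψ := by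
    refine Submodule.linearMap_qext _ (LinearMap.ext fun x => LinearMap.ext fun y => ?_)
    exact hg y x
  have h2 : LinearMap.det f * LinearMap.det q = 1 := by
    have h3 : f.dualMap ∘ₗ ((e : (V ⧸ T) →ₗ[ℂ] Dual ℂ T) ∘ₗ q ∘ₗ
        (e.symm : Dual ℂ T →ₗ[ℂ] (V ⧸ T))) = LinearMap.id := by
      ext1 x
      have := LinearMap.congr_fun hcomm (e.symm x)
      simp only [LinearMap.comp_apply] at this ⊢
      refine Eq.trans this ?_
      exact e.apply_symm_apply x
    have h4 := congrArg LinearMap.det h3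
    rwa [LinearMap.det_comp, LinearMap.det_dualMap, LinearMap.det_conj, LinearMap.det_id] at h4
  rw [LinearMap.det_eq_det_mul_det T _ hgT']
  exact h2

variable {W₀ : MaxIsotropic B}

/-- Two Lagrangian subspaces belong to the same component iff their intersection has even
codimension in them. -/
theorem IsOrthogonalMember.iff_even (hB : B.Nondegenerate) (hS : B.IsSymm) {T T' : Submodule ℂ V}
    (hT : IsOrthogonalMember B W₀ T) (hT' : IsIsotropic B T')
    (hd : 2 * finrank ℂ T = finrank ℂ V) (hd' : finrank ℂ T' = finrank ℂ T) :
    IsOrthogonalMember B W₀ T' ↔ Even (finrank ℂ T - finrank ℂ ↥(T ⊓ T')) := by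
  obtain ⟨h, hh, hhd, hhT⟩ := exists_isometry_map_eq hB hS hT.1 hT' hd hd'
  obtain ⟨g, hg, hgd, hgT⟩ := hT.2 hd
  constructor
  · intro hM
    obtain ⟨g', hg', hgd', hgT'⟩ := hM.2 (by omega)
    have hW₀ : 2 * finrank ℂ W₀.space = finrank ℂ V := by
      have := W₀.finrank_eq; omega
    -- This composite carries `W₀` to `T`, then to `T'`, then back to `W₀`. It stabilizes a
    -- Lagrangian subspace, so its determinant is one, and therefore so is that of `h`, which is the
    -- parity sign.
    let s : V ≃ₗ[ℂ] V := (g.trans h).trans g'.symm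
    have hs : LinearMap.det (s : V →ₗ[ℂ] V) = 1 := by
      refine det_eq_one_of_map_eq hB W₀.isotropic hW₀ (fun x y => ?_) ?_
      · have h1 := hg' (g'.symm (h (g x))) (g'.symm (h (g y)))
        rw [g'.apply_symm_apply, g'.apply_symm_apply, hh, hg] at h1
        exact h1.symm
      · rw [LinearEquiv.coe_trans, LinearEquiv.coe_trans, Submodule.map_comp, Submodule.map_comp,
          ← hgT, ← hhT, hgT', ← Submodule.map_comp, LinearEquiv.symm_comp, Submodule.map_id]
    have h2 : LinearMap.det (g'.symm : V →ₗ[ℂ] V) = 1 := by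
      have := LinearEquiv.det_mul_det_symm g'
      rwa [hgd', one_mul] at this
    rw [LinearEquiv.coe_trans, LinearEquiv.coe_trans, LinearMap.det_comp, LinearMap.det_comp, h2,
      hhd, hgd, one_mul, mul_one] at hs
    by_contra hodd
    rw [Nat.not_even_iff_odd] at hodd
    rw [hodd.neg_one_pow] at hs
    norm_num at hs
  · intro he
    refine ⟨hT', fun _ => ⟨g.trans h, fun x y => (hh _ _).trans (hg _ _), ?_, ?_⟩⟩
    · rw [LinearEquiv.coe_trans, LinearMap.det_comp, hhd, hgd, he.neg_one_pow, one_mul]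
    · rw [LinearEquiv.coe_trans, Submodule.map_comp, ← hgT, hhT]

/-- In the middle dimension `W` must equal `T` by maximality; below it the condition on the
component is vacuous. -/
theorem IsOrthogonalMember.mono {W T : Submodule ℂ V} (hB : B.Nondegenerate)
    (h : IsOrthogonalMember B W₀ T) (hW : W ≤ T) : IsOrthogonalMember B W₀ W := by
  by_cases hd : 2 * finrank ℂ W = finrank ℂ V
  · have h1 := h.1.two_mul_finrank_le hB
    have h2 := Submodule.finrank_mono hW
    rwa [Submodule.eq_of_le_of_finrank_eq hW (by omega)]
  · exact .of_two_mul_ne (h.1.mono hW) hd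

/-- The intersection contains `U`, so its codimension in `T` is at most one; it is also even, hence
zero. This is the uniqueness in the definition of `θ`. -/
theorem IsOrthogonalMember.eq_of_hyperplane (hB : B.Nondegenerate) (hS : B.IsSymm)
    {T T' U : Submodule ℂ V} (hT : IsOrthogonalMember B W₀ T) (hT' : IsOrthogonalMember B W₀ T')
    (hd : 2 * finrank ℂ T = finrank ℂ V) (hd' : 2 * finrank ℂ T' = finrank ℂ V) (hU : U ≤ T)
    (hU' : U ≤ T') (hUd : 2 * (finrank ℂ U + 1) = finrank ℂ V) : T = T' := by
  have h1 := (hT.iff_even hB hS hT'.1 hd (by omega)).1 hT'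
  have h2 := Submodule.finrank_mono (le_inf hU hU')
  have h3 : finrank ℂ ↥(T ⊓ T') ≤ finrank ℂ T := Submodule.finrank_mono inf_le_left
  have h4 : T ⊓ T' = T := Submodule.eq_of_le_of_finrank_eq inf_le_left (by
    rcases h1 with ⟨r, hr⟩; omega)
  exact Submodule.eq_of_le_of_finrank_eq (inf_eq_left.1 h4) (by omega)

/-- If an isotropic extension lands in the wrong component, a reflection in a non-isotropic vector
of the orthogonal of `W` fixes `W` and exchanges the components. Such a vector exists, because an
isotropic orthogonal of `W` would force `W` to have at least the middle dimension. -/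
theorem exists_orthogonalMember_extension (hB : B.Nondegenerate) (hS : B.IsSymm) {M : ℕ}
    (hM : 2 * M ≤ finrank ℂ V) {W : Submodule ℂ V} (h : IsOrthogonalMember B W₀ W)
    (hW : finrank ℂ W ≤ M) :
    ∃ T : Submodule ℂ V, W ≤ T ∧ IsOrthogonalMember B W₀ T ∧ finrank ℂ T = M := by
  rcases hW.eq_or_lt with hWM | hWM
  · exact ⟨W, le_rfl, h, hWM⟩
  obtain ⟨T, hWT, hT, hTM⟩ := exists_isotropic_extension hS.isRefl
    (fun W hW => IsIsotropic.exists_isotropic_vector hB hS hW) hM h.1 hW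
  by_cases hd : 2 * M = finrank ℂ V
  swap
  · exact ⟨T, hWT, .of_two_mul_ne hT (by omega), hTM⟩
  have hW₀ : 2 * finrank ℂ W₀.space = finrank ℂ V := by
    have := W₀.finrank_eq; omega
  obtain ⟨g, hg, hgd, hgT⟩ := exists_isometry_map_eq hB hS W₀.isotropic hT hW₀ (by omega)
  rcases neg_one_pow_eq_or ℂ (finrank ℂ W₀.space - finrank ℂ ↥(W₀.space ⊓ T)) with h1 | h1
  · exact ⟨T, hWT, ⟨hT, fun _ => ⟨g, hg, hgd.trans h1, hgT⟩⟩, hTM⟩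
  obtain ⟨z, hzW, hz⟩ : ∃ z ∈ B.orthogonal W, B z z ≠ 0 := by
    by_contra! h0
    have h2 : IsIsotropic B (B.orthogonal W) := by
      intro x hx y hy
      have h3 := h0 _ (Submodule.add_mem _ hx hy)
      have h4 : B y x = B x y := hS.eq y x
      simp only [map_add, LinearMap.add_apply, h0 x hx, h0 y hy, h4] at h3
      simpa using h3
    have h3 := h2.two_mul_finrank_le hB
    rw [LinearMap.BilinForm.finrank_orthogonal hB] at h3
    omega
  obtain ⟨r, hr, hri, hrd⟩ := exists_reflection hS hz
  refine ⟨T.map (r : V →ₗ[ℂ] V), fun x hx => ⟨x, hWT hx, ?_⟩, ⟨hT.map_isometry hri, fun _ =>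
    ⟨g.trans r, fun x y => (hri _ _).trans (hg _ _), ?_, ?_⟩⟩, ?_⟩
  · have h2 : B z x = 0 := hS.isRefl _ _ (hzW x hx)
    rw [LinearEquiv.coe_coe, hr, h2]
    simp
  · rw [LinearEquiv.coe_trans, LinearMap.det_comp, hrd, hgd, h1]
    norm_num
  · rw [LinearEquiv.coe_trans, Submodule.map_comp, ← hgT]
  · rw [← hTM]; exact LinearEquiv.finrank_map_eq r T

/-- The defining property of `θ`. -/
theorem theta_eq (hB : B.Nondegenerate) (hS : B.IsSymm) {U : Submodule ℂ V}
    (hUd : 2 * (finrank ℂ U + 1) = finrank ℂ V)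
    {T : Grass (IsOrthogonalMember B W₀) (finrank ℂ V / 2)} (hU : U ≤ T.space) :
    theta B W₀ U = T := by
  have h1 : U ≤ (theta B W₀ U).space := Classical.epsilon_spec (p := fun
    W : Grass (IsOrthogonalMember B W₀) (finrank ℂ V / 2) => U ≤ W.space) ⟨T, hU⟩
  have h2 := T.finrank_eq
  have h3 := (theta B W₀ U).finrank_eq
  exact Grass.ext ((theta B W₀ U).cond.eq_of_hyperplane hB hS T.cond (by omega) (by omega) h1 hU
    hUd)

end Components

/-! ### Frames and rational curves of frames -/

section Frames

variable {V : Type u} [AddCommGroup V] [Module ℂ V] {M : ℕ}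

/-- The span of the first `n` vectors of `e`. -/
def head (e : Fin M → V) (n : ℕ) : Submodule ℂ V := Submodule.span ℂ (e '' {i | i.val < n})

theorem head_le_iff {e : Fin M → V} {n : ℕ} {S : Submodule ℂ V} :
    head e n ≤ S ↔ ∀ i : Fin M, i.val < n → e i ∈ S := by
  simp [head, Submodule.span_le, Set.subset_def]

theorem mem_head {e : Fin M → V} {n : ℕ} {i : Fin M} (h : i.val < n) : e i ∈ head e n :=
  Submodule.subset_span ⟨i, h, rfl⟩

theorem head_mono (e : Fin M → V) {n n' : ℕ} (h : n ≤ n') : head e n ≤ head e n' :=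
  head_le_iff.2 fun _ hi => mem_head (hi.trans_le h)

theorem head_eq_span {e : Fin M → V} : head e M = Submodule.span ℂ (Set.range e) := by
  rw [head]
  congr 1
  ext x
  simp

theorem head_eq_head_top (e : Fin M → V) {n : ℕ} (h : M ≤ n) : head e n = head e M :=
  le_antisymm (head_le_iff.2 fun i _ => mem_head i.2) (head_mono e h)

theorem head_zero (e : Fin M → V) : head e 0 = ⊥ := by simp [head]

theorem head_succ (e : Fin M → V) (i : Fin M) :
    head e (i.val + 1) = head e i.val ⊔ Submodule.span ℂ {e i} := by
  apply le_antisymm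
  · refine head_le_iff.2 fun j hj => ?_
    rcases (Nat.lt_succ_iff.1 hj).lt_or_eq with h | h
    · exact Submodule.mem_sup_left (mem_head h)
    · rw [Fin.ext h]
      exact Submodule.mem_sup_right (Submodule.mem_span_singleton_self _)
  · refine sup_le (head_mono e (Nat.le_succ _)) ?_
    rw [Submodule.span_singleton_le_iff_mem]
    exact mem_head (Nat.lt_succ_self _)

theorem head_eq_of_smul {e e' : Fin M → V} {n : ℕ}
    (h : ∀ i : Fin M, i.val < n → ∃ r : ℂ, r ≠ 0 ∧ e i = r • e' i) : head e n = head e' n := by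
  apply le_antisymm <;> refine head_le_iff.2 fun i hi => ?_ <;> obtain ⟨r, hr, he⟩ := h i hi
  · rw [he]
    exact Submodule.smul_mem _ _ (mem_head hi)
  · rw [show e' i = r⁻¹ • e i by rw [he, inv_smul_smul₀ hr]]
    exact Submodule.smul_mem _ _ (mem_head hi)

theorem head_congr {e e' : Fin M → V} {n : ℕ} (h : ∀ i : Fin M, i.val < n → e i = e' i) :
    head e n = head e' n :=
  head_eq_of_smul fun i hi => ⟨1, one_ne_zero, by rw [h i hi, one_smul]⟩

theorem head_eq_span_castLE (e : Fin M → V) {n : ℕ} (h : n ≤ M) :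
    head e n = Submodule.span ℂ (Set.range fun i : Fin n => e (Fin.castLE h i)) := by
  apply le_antisymm
  · exact head_le_iff.2 fun i hi => Submodule.subset_span ⟨⟨i, hi⟩, rfl⟩
  · rw [Submodule.span_le]
    rintro _ ⟨i, rfl⟩
    exact mem_head i.2

theorem linearIndependent_of_finrank_head {e : Fin M → V} (h : finrank ℂ (head e M) = M) :
    LinearIndependent ℂ e := by
  rw [linearIndependent_iff_card_eq_finrank_span, Set.finrank, ← head_eq_span, h, Fintype.card_fin]

theorem finrank_head {e : Fin M → V} (h : finrank ℂ (head e M) = M) {n : ℕ} (hn : n ≤ M) :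
    finrank ℂ (head e n) = n := by
  rw [head_eq_span_castLE e hn]
  have := finrank_span_eq_card
    ((linearIndependent_of_finrank_head h).comp (Fin.castLE hn) (Fin.castLE_injective hn))
  rw [Fintype.card_fin] at this
  exact this

/-- A basis of a subspace satisfying `C`. -/
def IsFrame (C : Submodule ℂ V → Prop) (e : Fin M → V) : Prop :=
  finrank ℂ (head e M) = M ∧ C (head e M)

/-- A curve whose coordinates are entire functions. -/
def IsEntireCurve (f : ℂ → V) : Prop := ∀ l : Dual ℂ V, Differentiable ℂ fun t => l (f t)

/-- Two charts `E`, `E'` of a family of frames over the projective line, with glueing `t ↦ t⁻¹`, for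
which the span of the first `w` vectors is fixed. -/
structure IsRationalCurve (C : Submodule ℂ V → Prop) (w : ℕ) (E E' : ℂ → Fin M → V) : Prop where
  frame : ∀ t, IsFrame C (E t)
  frame' : ∀ t, IsFrame C (E' t)
  entire : ∀ i, IsEntireCurve fun t => E t i
  entire' : ∀ i, IsEntireCurve fun t => E' t i
  glue : ∀ t : ℂ, t ≠ 0 → ∀ n, head (E t) n = head (E' t⁻¹) n
  fixed : ∀ t, head (E t) w = head (E 0) w
  fixed' : ∀ t, head (E' t) w = head (E 0) w

/-- The invariants of frames which are constant along rational curves and depend only on the flag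
given by the frame. -/
structure IsCurveInvariant (C : Submodule ℂ V → Prop) (w : ℕ) {Z : Type*}
    (R : (Fin M → V) → Z) : Prop where
  curve : ∀ E E', IsRationalCurve C w E E' → R (E 0) = R (E' 0)
  flag : ∀ e e', IsFrame C e → IsFrame C e' → (∀ n, head e n = head e' n) → R e = R e'

theorem head_eq_of_add {e f : Fin M → V} {i j : Fin M} (hij : i < j) {t : ℂ}
    (hi : f i = e i + t • e j) (hf : ∀ k, k ≠ i → f k = e k) {n : ℕ}
    (hn : n ≤ i.val ∨ j.val < n) : head f n = head e n := by
  have hij' : i.val < j.val := hij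
  apply le_antisymm <;> refine head_le_iff.2 fun k hk => ?_ <;> by_cases hki : k = i
  · rw [hki] at hk ⊢
    rw [hi]
    exact Submodule.add_mem _ (mem_head hk) (Submodule.smul_mem _ _ (mem_head (by omega)))
  · rw [hf k hki]
    exact mem_head hk
  · rw [hki] at hk ⊢
    have : e i = f i - t • f j := by rw [hi, hf j hij.ne']; abel
    rw [this]
    exact Submodule.sub_mem _ (mem_head hk) (Submodule.smul_mem _ _ (mem_head (by omega)))
  · rw [← hf k hki]
    exact mem_head hk

theorem head_eq_of_swap {e f : Fin M → V} {i j : Fin M} (hij : i < j) {s : ℂ}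
    (hi : f i = s • e i + e j) (hj : f j = e i) (hf : ∀ k, k ≠ i → k ≠ j → f k = e k) {n : ℕ}
    (hn : n ≤ i.val ∨ j.val < n) : head f n = head e n := by
  have hij' : i.val < j.val := hij
  apply le_antisymm <;> refine head_le_iff.2 fun k hk => ?_ <;> by_cases hki : k = i
  · rw [hki] at hk ⊢
    rw [hi]
    exact Submodule.add_mem _ (Submodule.smul_mem _ _ (mem_head hk)) (mem_head (by omega))
  · by_cases hkj : k = j
    · rw [hkj] at hk ⊢
      rw [hj]
      exact mem_head (by omega)
    · rw [hf k hki hkj]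
      exact mem_head hk
  · rw [hki] at hk ⊢
    rw [← hj]
    exact mem_head (by omega)
  · by_cases hkj : k = j
    · rw [hkj] at hk ⊢
      have : e j = f i - s • f j := by rw [hi, hj]; abel
      rw [this]
      exact Submodule.sub_mem _ (mem_head (by omega)) (Submodule.smul_mem _ _ (mem_head hk))
    · rw [← hf k hki hkj]
      exact mem_head hk

/-- The pencil `e i + t • e j` is proportional to `t⁻¹ • e i + e j`, and its limit at infinity has
`e j` in place `i` and `e i` in place `j`. Only heads containing place `i` but not place `j` move,
so the head of length `w` is fixed as long as `w` does not separate the two places. -/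
theorem isRationalCurve_of_swap {C : Submodule ℂ V → Prop} {w : ℕ} {e : Fin M → V}
    (he : IsFrame C e) {i j : Fin M} (hij : i < j) (hw : j.val < w ∨ w ≤ i.val)
    {E E' : ℂ → Fin M → V} (hEi : ∀ t, E t i = e i + t • e j) (hEk : ∀ t k, k ≠ i → E t k = e k)
    (hE'i : ∀ s, E' s i = s • e i + e j) (hE'j : ∀ s, E' s j = e i)
    (hE'k : ∀ s k, k ≠ i → k ≠ j → E' s k = e k) : IsRationalCurve C w E E' := by
  have hij' : i.val < j.val := hij
  have h1 : ∀ (t : ℂ) {n : ℕ}, (n ≤ i.val ∨ j.val < n) → head (E t) n = head e n := fun t n hn =>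
    head_eq_of_add hij (hEi t) (hEk t) hn
  have h2 : ∀ (t : ℂ) {n : ℕ}, (n ≤ i.val ∨ j.val < n) → head (E' t) n = head e n := fun t n hn =>
    head_eq_of_swap hij (hE'i t) (hE'j t) (hE'k t) hn
  refine ⟨fun t => ?_, fun s => ?_, fun k l => ?_, fun k l => ?_, fun t ht n => ?_, fun t => ?_,
    fun s => ?_⟩
  · rw [IsFrame, h1 t (Or.inr j.2)]; exact he
  · rw [IsFrame, h2 s (Or.inr j.2)]; exact he
  · by_cases hki : k = i
    · simp only [hki, hEi, map_add, map_smul, smul_eq_mul]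
      fun_prop
    · simp only [hEk _ k hki]
      fun_prop
  · by_cases hki : k = i
    · simp only [hki, hE'i, map_add, map_smul, smul_eq_mul]
      fun_prop
    · by_cases hkj : k = j
      · simp only [hkj, hE'j]
        fun_prop
      · simp only [hE'k _ k hki hkj]
        fun_prop
  · by_cases hn : n ≤ i.val ∨ j.val < n
    · rw [h1 t hn, h2 t⁻¹ hn]
    · refine head_eq_of_smul fun k hk => ?_
      by_cases hki : k = i
      · refine ⟨t, ht, ?_⟩
        rw [hki, hEi, hE'i, smul_add, smul_inv_smul₀ ht]
      · have hkj : k ≠ j := by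
          rintro rfl
          omega
        exact ⟨1, one_ne_zero, by rw [hEk t k hki, hE'k _ k hki hkj, one_smul]⟩
  · rw [h1 t (by omega), h1 0 (by omega)]
  · rw [h2 s (by omega), h1 0 (by omega)]

theorem exists_isRationalCurve_swap {C : Submodule ℂ V → Prop} {w : ℕ} {e : Fin M → V}
    (he : IsFrame C e) {i j : Fin M} (hij : i < j) (hw : j.val < w ∨ w ≤ i.val) :
    ∃ E E', IsRationalCurve C w E E' ∧ E 0 = e ∧
      E' 0 = Function.update (Function.update e i (e j)) j (e i) := by
  refine ⟨fun t => Function.update e i (e i + t • e j),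
    fun s => Function.update (Function.update e i (s • e i + e j)) j (e i),
    isRationalCurve_of_swap he hij hw (fun t => ?_) (fun t k hk => ?_) (fun s => ?_) (fun s => ?_)
      (fun s k hk hk' => ?_), ?_, ?_⟩
  · rw [Function.update_self]
  · rw [Function.update_of_ne hk]
  · rw [Function.update_of_ne hij.ne, Function.update_self]
  · rw [Function.update_self]
  · rw [Function.update_of_ne hk', Function.update_of_ne hk]
  · simp only [zero_smul, add_zero, Function.update_eq_self]
  · simp only [zero_smul, zero_add]

/-- Here `y` is a vector of the preceding head plus a nonzero multiple of `e j`, so the change of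
basis is triangular. -/
theorem head_update_eq {e : Fin M → V} {j : Fin M} {y : V} (hy : y ∈ head e (j.val + 1))
    (hy' : y ∉ head e j.val) (n : ℕ) : head (Function.update e j y) n = head e n := by
  obtain ⟨u, hu, a, rfl⟩ := mem_sup_span_singleton.1 (head_succ e j ▸ hy)
  have ha : a ≠ 0 := by
    rintro rfl
    rw [zero_smul, add_zero] at hy'
    exact hy' hu
  set f := Function.update e j (u + a • e j) with hf
  have hfj : f j = u + a • e j := Function.update_self ..
  have hfk : ∀ k, k ≠ j → f k = e k := fun k hk => Function.update_of_ne hk _ _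
  have h1 : ∀ n ≤ j.val, head f n = head e n := fun n hn =>
    head_congr fun i hi => hfk i (by rintro rfl; omega)
  rcases le_or_gt n j.val with hn | hn
  · exact h1 n hn
  apply le_antisymm <;> refine head_le_iff.2 fun k hk => ?_ <;> by_cases hkj : k = j
  · rw [hkj, hfj]
    exact Submodule.add_mem _ (head_mono e hn.le hu) (Submodule.smul_mem _ _ (mem_head hn))
  · rw [hfk k hkj]
    exact mem_head hk
  · have h2 : e j = a⁻¹ • (f j - u) := by
      rw [hfj, add_sub_cancel_left, inv_smul_smul₀ ha]
    rw [hkj, h2]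
    refine Submodule.smul_mem _ _ (Submodule.sub_mem _ (mem_head hn) ?_)
    rw [← h1 j.val le_rfl] at hu
    exact head_mono _ hn.le hu
  · rw [← hfk k hkj]
    exact mem_head hk

/-- Curve invariants do not distinguish frames of the same subspace. -/
theorem IsCurveInvariant.eq_of_head_eq {C : Submodule ℂ V → Prop} {w : ℕ} {Z : Type*}
    {R : (Fin M → V) → Z} (hR : IsCurveInvariant C w R) {e e' : Fin M → V} (he : IsFrame C e)
    (hM : head e M = head e' M) (hw : head e w = head e' w) :
    R e = R e' := by
  have he' : IsFrame C e' := by rw [IsFrame, ← hM]; exact he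
  -- The basis is sorted place by place: `n` is the length up to which its heads already agree with
  -- those of `e'`.
  suffices H : ∀ d n, n + d = M → ∀ e : Fin M → V, head e M = head e' M → head e w = head e' w →
      (∀ k ≤ n, head e k = head e' k) → R e = R e' from
    H M 0 (by omega) e hM hw fun k hk => by
      rw [Nat.le_zero.1 hk, head_zero, head_zero]
  intro d
  induction d with
  | zero =>
    intro n hn e hM _ hk
    have he : IsFrame C e := by rw [IsFrame, hM]; exact he'
    refine hR.flag _ _ he he' fun k => ?_
    rcases le_or_gt k M with h | h
    · exact hk k (by omega)
    · rw [head_eq_head_top e h.le, head_eq_head_top e' h.le, hM]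
  | succ d ih =>
    intro n hn e hM hw hk
    have he : IsFrame C e := by rw [IsFrame, hM]; exact he'
    have hnM : n < M := by omega
    have fin_succ : ∀ f : Fin M → V, head f M = head e' M → (∀ k ≤ n, head f k = head e' k) →
        e' ⟨n, hnM⟩ ∈ head f (n + 1) → ∀ k ≤ n + 1, head f k = head e' k := by
      intro f hf hfk hy k hk'
      rcases Nat.le_succ_iff.1 hk' with h | rfl
      · exact hfk k h
      have hfr : finrank ℂ (head f M) = M := by rw [hf]; exact he'.1
      have : Module.Finite ℂ (head f (n + 1)) := Module.Finite.span_of_finite ℂ (Set.toFinite _)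
      refine (Submodule.eq_of_le_of_finrank_eq ?_ ?_).symm
      · rw [head_succ e' ⟨n, hnM⟩]
        refine sup_le ?_ ?_
        · rw [← hfk n le_rfl]; exact head_mono f (Nat.le_succ n)
        · rwa [Submodule.span_singleton_le_iff_mem]
      · rw [finrank_head he'.1 hnM, finrank_head hfr hnM]
    set y := e' ⟨n, hnM⟩ with hydef
    have hyn : y ∉ head e n := by
      rw [hk n le_rfl]
      intro hy
      have h1 := head_succ e' ⟨n, hnM⟩
      rw [sup_eq_left.2 ((Submodule.span_singleton_le_iff_mem _ _).2 hy)] at h1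
      have h2 := finrank_head he'.1 hnM
      rw [h1, finrank_head he'.1 hnM.le] at h2
      omega
    have hyM : y ∈ head e M := hM ▸ mem_head hnM
    classical
    -- Let `j + 1` be the smallest length of a head containing the next vector `y` of `e'`. Then `y`
    -- may replace `e j` without changing any head, and a swap brings it from place `j` to place
    -- `n`.
    have hex : ∃ J, y ∈ head e J := ⟨M, hyM⟩
    have hJ := Nat.find_spec hex
    have hJM : Nat.find hex ≤ M := Nat.find_min' hex hyM
    have hJn : n < Nat.find hex := by
      by_contra! h
      exact hyn (head_mono e h hJ)
    obtain ⟨j, hj⟩ : ∃ j, Nat.find hex = j + 1 := ⟨Nat.find hex - 1, by omega⟩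
    have hj' : y ∉ head e j := Nat.find_min hex (by omega)
    rw [hj] at hJ
    rcases (show n ≤ j by omega).eq_or_lt with rfl | hnj
    · exact ih (n + 1) (by omega) e hM hw (fin_succ e hM hk hJ)
    have hupd := head_update_eq (j := ⟨j, by omega⟩) hJ hj'
    set e₁ := Function.update e ⟨j, by omega⟩ y with he₁
    have he₁' : IsFrame C e₁ := by rw [IsFrame, hupd]; exact he
    rw [hR.flag e e₁ he he₁' fun k => (hupd k).symm]
    -- The swap is admissible: if `w` separated `n` from `j`, then `y` would lie in the common head
    -- of length `w`, against the minimality of `j`.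
    have hwj : j < w ∨ w ≤ n := by
      by_contra! h
      have h1 : y ∈ head e w := hw ▸ mem_head h.2
      exact hj' (head_mono e h.1 h1)
    obtain ⟨E, E', hE, hE0, he₂⟩ := exists_isRationalCurve_swap he₁' (i := ⟨n, hnM⟩)
      (j := ⟨j, by omega⟩) hnj hwj
    have h1 := hR.curve _ _ hE
    have hfix := hE.fixed' 0
    have hfr := (hE.frame' 0).1
    rw [hE0] at h1 hfix
    rw [h1]
    set e₂ := E' 0
    have hle : head e₂ M ≤ head e₁ M := by
      refine head_le_iff.2 fun k _ => ?_
      rw [he₂, Function.update_apply, Function.update_apply]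
      split_ifs <;> exact mem_head (Fin.is_lt _)
    have hM₂ : head e₂ M = head e' M := by
      rw [← hM, ← hupd M]
      have : Module.Finite ℂ (head e₁ M) := Module.Finite.span_of_finite ℂ (Set.toFinite _)
      exact Submodule.eq_of_le_of_finrank_eq hle (by rw [hfr, he₁'.1])
    have hk₂ : ∀ k ≤ n, head e₂ k = head e' k := fun k hkn => by
      rw [← hk k hkn, ← hupd k]
      refine head_congr fun i hi => ?_
      rw [he₂, Function.update_of_ne (Fin.ne_of_val_ne (by simp only; omega)),
        Function.update_of_ne (Fin.ne_of_val_ne (by simp only; omega))]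
    refine ih (n + 1) (by omega) e₂ hM₂ (by rw [hfix, hupd, hw]) (fin_succ e₂ hM₂ hk₂ ?_)
    have h2 : e₂ ⟨n, hnM⟩ = y := by
      rw [he₂, Function.update_of_ne (Fin.ne_of_val_ne (by simp only; omega)),
        Function.update_self, he₁, Function.update_self]
    rw [← h2]
    exact mem_head (Nat.lt_succ_self n)

/-- Extension of a frame of `U` to a larger subspace. -/
theorem exists_frame_extension [FiniteDimensional ℂ V] {n n' : ℕ} (hn' : n' ≤ M)
    {U U' : Submodule ℂ V} (hUU' : U ≤ U') (hU : finrank ℂ U = n) (hU' : finrank ℂ U' = n')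
    {e : Fin M → V} (he : head e n = U) :
    ∃ e' : Fin M → V, (∀ i : Fin M, i.val < n → e' i = e i) ∧ head e' n' = U' := by
  have hle := Submodule.finrank_mono hUU'
  rw [hU, hU'] at hle
  obtain ⟨d, rfl⟩ := Nat.exists_eq_add_of_le hle
  induction d generalizing n U e with
  | zero =>
    refine ⟨e, fun _ _ => rfl, ?_⟩
    rw [add_zero, he]
    exact Submodule.eq_of_le_of_finrank_eq hUU' (by omega)
  | succ d ih =>
    obtain ⟨v, hv, hvU⟩ := exists_mem_notMem_of_finrank_lt
      (show finrank ℂ U < finrank ℂ U' by omega)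
    have h1 : head (Function.update e ⟨n, by omega⟩ v) n = U := by
      rw [← he]
      exact head_congr fun i hi =>
        Function.update_of_ne (Fin.ne_of_val_ne (by simp only; omega)) _ _
    have h2 : head (Function.update e ⟨n, by omega⟩ v) (n + 1) = U ⊔ Submodule.span ℂ {v} := by
      have := head_succ (Function.update e ⟨n, by omega⟩ v) ⟨n, by omega⟩
      rwa [Function.update_self, h1] at this
    obtain ⟨e', he', hh⟩ := ih (sup_le hUU' ((Submodule.span_singleton_le_iff_mem _ _).2 hv))
      (by rw [finrank_sup_span_of_notMem hvU, hU]) h2 (by omega) (by omega) (by omega)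
    refine ⟨e', fun i hi => ?_, by rw [← hh]; congr 1; omega⟩
    rw [he' i (by omega), Function.update_of_ne (Fin.ne_of_val_ne (by simp only; omega))]

/-- The frame `e` with the vectors of index at least `h` replaced by those of `x`. -/
def splice (h : ℕ) (e x : Fin M → V) : Fin M → V := fun i => if i.val < h then e i else x i

theorem head_splice {h n : ℕ} (hn : n ≤ h) (e x : Fin M → V) :
    head (splice h e x) n = head e n :=
  head_congr fun _ hi => if_pos (hi.trans_le hn)

/-- The first `h` vectors are constant, so heads of length at most `h` are fixed. The glueing
transfers the frame condition from the second chart to every `t ≠ 0` of the first, which leaves only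
`t = 0` to check there. -/
theorem isRationalCurve_splice {C : Submodule ℂ V → Prop} {w h : ℕ} (hw : w ≤ h) {e : Fin M → V}
    {X X' : ℂ → Fin M → V} (h0 : IsFrame C (splice h e (X 0)))
    (hX' : ∀ s, IsFrame C (splice h e (X' s))) (hX : ∀ i, IsEntireCurve fun t => X t i)
    (hX'' : ∀ i, IsEntireCurve fun t => X' t i)
    (hglue : ∀ t : ℂ, t ≠ 0 → ∀ i, ∃ r : ℂ, r ≠ 0 ∧ X t i = r • X' t⁻¹ i) :
    IsRationalCurve C w (fun t => splice h e (X t)) (fun s => splice h e (X' s)) := by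
  have hg : ∀ t : ℂ, t ≠ 0 → ∀ n, head (splice h e (X t)) n = head (splice h e (X' t⁻¹)) n := by
    refine fun t ht n => head_eq_of_smul fun i _ => ?_
    by_cases hi : i.val < h
    · exact ⟨1, one_ne_zero, by rw [splice, splice, if_pos hi, if_pos hi, one_smul]⟩
    · rw [splice, splice, if_neg hi, if_neg hi]
      exact hglue t ht i
  refine ⟨fun t => ?_, hX', fun i => ?_, fun i => ?_, hg, fun t => ?_, fun t => ?_⟩
  · by_cases ht : t = 0
    · rw [ht]; exact h0
    · rw [IsFrame, hg t ht]; exact hX' t⁻¹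
  · by_cases hi : i.val < h
    · simp only [splice, if_pos hi]
      exact fun l => differentiable_const _
    · simp only [splice, if_neg hi]
      exact hX i
  · by_cases hi : i.val < h
    · simp only [splice, if_pos hi]
      exact fun l => differentiable_const _
    · simp only [splice, if_neg hi]
      exact hX'' i
  · rw [head_splice hw, head_splice hw]
  · rw [head_splice hw, head_splice hw]

end Frames

/-! ### Rational connectedness -/

section Connectedness

variable {V : Type u} [AddCommGroup V] [Module ℂ V] [FiniteDimensional ℂ V] {M : ℕ}

/-- Curve invariants do not distinguish frames whose first `w` vectors have the same span, if any
subspace `T` can be moved closer to any other subspace `T'` along rational curves. -/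
theorem IsCurveInvariant.eq_of_exists_curve {C : Submodule ℂ V → Prop} {w : ℕ} {Z : Type*}
    {R : (Fin M → V) → Z} (hR : IsCurveInvariant C w R) (hwM : w ≤ M)
    (hC : ∀ T T' : Submodule ℂ V, C T → C T' → finrank ℂ T = M → finrank ℂ T' = M → T ≠ T' →
      ∀ W ≤ T ⊓ T', finrank ℂ W = w → ∃ E E' : ℂ → Fin M → V, IsRationalCurve C w E E' ∧
        head (E 0) w = W ∧ head (E 0) M = T ∧
        finrank ℂ ↥(T ⊓ T') < finrank ℂ ↥(head (E' 0) M ⊓ T'))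
    {e e' : Fin M → V} (he : IsFrame C e) (he' : IsFrame C e') (hw : head e w = head e' w) :
    R e = R e' := by
  obtain ⟨d, hd⟩ : ∃ d, M - finrank ℂ ↥(head e M ⊓ head e' M) = d := ⟨_, rfl⟩
  induction d using Nat.strong_induction_on generalizing e with
  | _ d ih =>
    by_cases hT : head e M = head e' M
    · exact hR.eq_of_head_eq he hT hw
    obtain ⟨E, E', hE, hEw, hEM, hlt⟩ := hC _ _ he.2 he'.2 he.1 he'.1 hT (head e w)
      (le_inf (head_mono e hwM) (hw ▸ head_mono e' hwM)) (finrank_head he.1 hwM)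
    -- Inside the same subspace `T` the invariant does not see the choice of the basis, so `e` may
    -- be exchanged for the initial frame of the curve.
    rw [hR.eq_of_head_eq he hEM.symm hEw.symm, hR.curve _ _ hE]
    have h1 : finrank ℂ ↥(head (E' 0) M ⊓ head e' M) ≤ M :=
      (Submodule.finrank_mono inf_le_right).trans_eq he'.1
    exact ih _ (by omega) (hE.frame' 0) (by rw [hE.fixed', hEw, hw]) rfl

theorem exists_adapted_frame {W H T : Submodule ℂ V} (hWH : W ≤ H) (hHT : H ≤ T) {w h : ℕ}
    (hW : finrank ℂ W = w) (hH : finrank ℂ H = h) (hT : finrank ℂ T = M) :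
    ∃ e : Fin M → V, head e w = W ∧ head e h = H ∧ head e M = T := by
  have h1 := Submodule.finrank_mono hWH
  have h2 := Submodule.finrank_mono hHT
  obtain ⟨e₁, -, he₁⟩ := exists_frame_extension (M := M) (n' := w) (by omega) (bot_le (a := W))
    (finrank_bot ℂ V) hW (head_zero (0 : Fin M → V))
  obtain ⟨e₂, he₂', he₂⟩ := exists_frame_extension (n' := h) (by omega) hWH hW hH he₁
  obtain ⟨e₃, he₃', he₃⟩ := exists_frame_extension (n' := M) le_rfl hHT hH hT he₂
  refine ⟨e₃, ?_, ?_, he₃⟩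
  · rw [← he₁, ← head_congr he₂']
    exact head_congr fun i hi => he₃' i (by omega)
  · rw [← he₂, head_congr he₃']

theorem exists_between_finrank {R K : Submodule ℂ V} (hRK : R ≤ K) {h : ℕ}
    (hR : finrank ℂ R ≤ h) (hK : h ≤ finrank ℂ K) :
    ∃ H, R ≤ H ∧ H ≤ K ∧ finrank ℂ H = h := by
  obtain ⟨e, he, -, heK⟩ := exists_adapted_frame (M := finrank ℂ K) hRK le_rfl rfl rfl rfl
  refine ⟨head e h, he ▸ head_mono e hR, ?_, ?_⟩
  · calc head e h ≤ head e (finrank ℂ K) := head_mono e hK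
      _ = K := heK
  · exact finrank_head (by rw [heK]) hK

variable {C : Submodule ℂ V → Prop}

/-- Rational curves of subspaces containing the fixed hyperplane `H` of `T`. -/
theorem exists_curve_of_hyperplane {w h : ℕ} {W H T : Submodule ℂ V} (hWH : W ≤ H) (hHT : H ≤ T)
    (hW : finrank ℂ W = w) (hH : finrank ℂ H = h) (hT : finrank ℂ T = h + 1) (hCT : C T)
    {x x' : ℂ → V} (hx : IsEntireCurve x) (hx' : IsEntireCurve x') (hx0 : x 0 ∈ T)
    (hx0' : x 0 ∉ H) (hglue : ∀ t : ℂ, t ≠ 0 → ∃ r : ℂ, r ≠ 0 ∧ x t = r • x' t⁻¹)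
    (hC : ∀ s, x' s ∉ H ∧ C (H ⊔ Submodule.span ℂ {x' s})) :
    ∃ E E' : ℂ → Fin (h + 1) → V, IsRationalCurve C w E E' ∧ head (E 0) w = W ∧
      head (E 0) (h + 1) = T ∧ head (E' 0) (h + 1) = H ⊔ Submodule.span ℂ {x' 0} := by
  obtain ⟨e, heW, heH, -⟩ := exists_adapted_frame hWH hHT hW hH hT
  have hwh : w ≤ h := by rw [← hW, ← hH]; exact Submodule.finrank_mono hWH
  have key : ∀ v : V, head (splice h e fun _ => v) (h + 1) = H ⊔ Submodule.span ℂ {v} := by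
    intro v
    have := head_succ (splice h e fun _ => v) ⟨h, Nat.lt_succ_self h⟩
    rw [head_splice le_rfl, heH] at this
    simpa [splice] using this
  have hT0 : H ⊔ Submodule.span ℂ {x 0} = T := by
    refine Submodule.eq_of_le_of_finrank_eq
      (sup_le hHT ((Submodule.span_singleton_le_iff_mem _ _).2 hx0)) ?_
    rw [finrank_sup_span_of_notMem hx0', hH, hT]
  refine ⟨fun t => splice h e fun _ => x t, fun s => splice h e fun _ => x' s,
    isRationalCurve_splice hwh ?_ (fun s => ?_) (fun _ => hx) (fun _ => hx')
      (fun t ht _ => hglue t ht), ?_, ?_, key _⟩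
  · rw [IsFrame, key, hT0]
    exact ⟨hT, hCT⟩
  · rw [IsFrame, key, finrank_sup_span_of_notMem (hC s).1, hH]
    exact ⟨rfl, (hC s).2⟩
  · rw [head_splice hwh, heW]
  · rw [key, hT0]

/-- Rational curves of subspaces containing the fixed subspace `H` of codimension two of `T`. -/
theorem exists_curve_of_codim_two {w h : ℕ} {W H T : Submodule ℂ V} (hWH : W ≤ H) (hHT : H ≤ T)
    (hW : finrank ℂ W = w) (hH : finrank ℂ H = h) (hT : finrank ℂ T = h + 2) (hCT : C T)
    {x x' y y' : ℂ → V} (hx : IsEntireCurve x) (hx' : IsEntireCurve x') (hy : IsEntireCurve y)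
    (hy' : IsEntireCurve y')
    (h0 : H ⊔ Submodule.span ℂ {x 0} ⊔ Submodule.span ℂ {y 0} = T)
    (hglue : ∀ t : ℂ, t ≠ 0 → ∃ r : ℂ, r ≠ 0 ∧ x t = r • x' t⁻¹ ∧ y t = r • y' t⁻¹)
    (hC : ∀ s, finrank ℂ ↥(H ⊔ Submodule.span ℂ {x' s} ⊔ Submodule.span ℂ {y' s}) = h + 2 ∧
      C (H ⊔ Submodule.span ℂ {x' s} ⊔ Submodule.span ℂ {y' s})) :
    ∃ E E' : ℂ → Fin (h + 2) → V, IsRationalCurve C w E E' ∧ head (E 0) w = W ∧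
      head (E 0) (h + 2) = T ∧
      head (E' 0) (h + 2) = H ⊔ Submodule.span ℂ {x' 0} ⊔ Submodule.span ℂ {y' 0} := by
  obtain ⟨e, heW, heH, -⟩ := exists_adapted_frame hWH hHT hW hH hT
  have hwh : w ≤ h := by rw [← hW, ← hH]; exact Submodule.finrank_mono hWH
  have key : ∀ a b : V, head (splice h e fun i => if i.val = h then a else b) (h + 2) =
      H ⊔ Submodule.span ℂ {a} ⊔ Submodule.span ℂ {b} := by
    intro a b
    have h1 := head_succ (splice h e fun i => if i.val = h then a else b)
      ⟨h, by omega⟩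
    have h2 := head_succ (splice h e fun i => if i.val = h then a else b)
      ⟨h + 1, by omega⟩
    rw [head_splice le_rfl, heH] at h1
    simp only [splice, lt_irrefl, if_true, if_false] at h1
    rw [show (⟨h + 1, by omega⟩ : Fin (h + 2)).val = h + 1 from rfl] at h2
    simp only [splice, show ¬ (h + 1 < h) by omega, show ¬ (h + 1 = h) by omega, if_false] at h2
    rw [← h1]
    exact h2
  refine ⟨fun t => splice h e fun i => if i.val = h then x t else y t,
    fun s => splice h e fun i => if i.val = h then x' s else y' s,
    isRationalCurve_splice hwh ?_ (fun s => ?_) (fun i => ?_) (fun i => ?_)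
      (fun t ht i => ?_), ?_, ?_, key _ _⟩
  · rw [IsFrame, key, h0]
    exact ⟨hT, hCT⟩
  · rw [IsFrame, key]
    exact hC s
  · by_cases hi : i.val = h
    · simpa only [if_pos hi] using hx
    · simpa only [if_neg hi] using hy
  · by_cases hi : i.val = h
    · simpa only [if_pos hi] using hx'
    · simpa only [if_neg hi] using hy'
  · obtain ⟨r, hr, h1, h2⟩ := hglue t ht
    refine ⟨r, hr, ?_⟩
    split_ifs
    · exact h1
    · exact h2
  · rw [head_splice hwh, heW]
  · rw [key, h0]

theorem finrank_inf_lt {T T' U : Submodule ℂ V} {a : V} (hT : T ⊓ T' ≤ U) (haU : a ∈ U)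
    (haT' : a ∈ T') (haT : a ∉ T) : finrank ℂ ↥(T ⊓ T') < finrank ℂ ↥(U ⊓ T') :=
  Submodule.finrank_lt_finrank_of_lt (lt_of_le_not_ge (le_inf hT inf_le_right)
    fun h => haT (h ⟨haU, haT'⟩).1)

theorem exists_mem_notMem_of_ne {T T' : Submodule ℂ V} (h : finrank ℂ T = finrank ℂ T')
    (hne : T ≠ T') : ∃ a ∈ T', a ∉ T := by
  by_contra! h'
  exact hne (Submodule.eq_of_le_of_finrank_eq (show T' ≤ T from h') h.symm).symm

/-- Moving `T` closer to `T'` along a line. -/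
theorem exists_curve_of_line {w : ℕ} {T T' H W : Submodule ℂ V} (hCT : C T) (hT : finrank ℂ T = M)
    (hRH : T ⊓ T' ≤ H) (hHT : H ≤ T) (hH : finrank ℂ H + 1 = M) (hWR : W ≤ T ⊓ T')
    (hW : finrank ℂ W = w) {a : V} (haT' : a ∈ T') (haT : a ∉ T)
    (hC : ∀ b ∈ T, ∀ s : ℂ, finrank ℂ ↥(H ⊔ Submodule.span ℂ {s • b + a}) = M →
      C (H ⊔ Submodule.span ℂ {s • b + a})) :
    ∃ E E' : ℂ → Fin M → V, IsRationalCurve C w E E' ∧ head (E 0) w = W ∧ head (E 0) M = T ∧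
      finrank ℂ ↥(T ⊓ T') < finrank ℂ ↥(head (E' 0) M ⊓ T') := by
  obtain ⟨h, rfl⟩ : ∃ h, M = h + 1 := ⟨_, hH.symm⟩
  -- The pencil of subspaces `H + ⟨b + t a⟩` starts at `T` and ends at `H + ⟨a⟩`, which contains `T
  -- ⊓ T'` and the new vector `a` of `T'`.
  obtain ⟨b, hb, hbH⟩ := exists_mem_notMem_of_finrank_lt
    (show finrank ℂ H < finrank ℂ T by omega)
  have hs : ∀ s : ℂ, s • b + a ∉ H := fun s hs => haT (by
    have := T.sub_mem (hHT hs) (T.smul_mem s hb)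
    rwa [add_sub_cancel_left] at this)
  obtain ⟨E, E', hE, hW, hT, hT₁⟩ := exists_curve_of_hyperplane (C := C) (x := fun t => b + t • a)
    (x' := fun s => s • b + a) (hWR.trans hRH) hHT hW (by omega) hT hCT
    (fun l => by simp only [map_add, map_smul, smul_eq_mul]; fun_prop)
    (fun l => by simp only [map_add, map_smul, smul_eq_mul]; fun_prop) (by simpa using hb)
    (by simpa using hbH)
    (fun t ht => ⟨t, ht, by rw [smul_add, smul_inv_smul₀ ht]⟩)
    (fun s => ⟨hs s, hC b hb s (by rw [finrank_sup_span_of_notMem (hs s), hH])⟩)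
  refine ⟨E, E', hE, hW, hT, finrank_inf_lt ?_ ?_ haT' haT⟩
  · rw [hT₁]
    exact hRH.trans le_sup_left
  · rw [hT₁]
    exact Submodule.mem_sup_right (by simp)

/-- Without a condition on the subspaces, any hyperplane of `T` that contains `T ⊓ T'` supports a
suitable line. -/
theorem IsCurveInvariant.eq_ordinary {w : ℕ} {Z : Type*} {R : (Fin M → V) → Z}
    (hR : IsCurveInvariant (fun _ => True) w R) (hwM : w ≤ M) {e e' : Fin M → V}
    (he : IsFrame (fun _ => True) e) (he' : IsFrame (fun _ => True) e')
    (hw : head e w = head e' w) : R e = R e' := by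
  refine hR.eq_of_exists_curve hwM (fun T T' _ _ hT hT' hne W hWR hW => ?_) he he' hw
  obtain ⟨a, haT', haT⟩ := exists_mem_notMem_of_ne (hT.trans hT'.symm) hne
  have hlt := finrank_inf_lt (U := T') inf_le_right haT' haT' haT
  rw [inf_idem, hT'] at hlt
  obtain ⟨H, hRH, hHT, hH⟩ := exists_between_finrank (h := M - 1) (K := T)
    (inf_le_left : T ⊓ T' ≤ T) (by omega) (by omega)
  exact exists_curve_of_line trivial hT hRH hHT (by omega) hWR hW haT' haT
    fun _ _ _ _ => trivial

variable {B : LinearMap.BilinForm ℂ V}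

theorem finrank_ker_inf (T : Submodule ℂ V) (l : Dual ℂ V) :
    finrank ℂ T ≤ finrank ℂ ↥(T ⊓ LinearMap.ker l) + 1 := by
  have h1 := Submodule.finrank_sup_add_finrank_inf_eq T (LinearMap.ker l)
  have h2 := (T ⊔ LinearMap.ker l).finrank_le
  have h3 := l.finrank_range_add_finrank_ker
  have h4 := (LinearMap.range l).finrank_le
  rw [finrank_self] at h4
  omega

/-- The hyperplane `H` of the line must be orthogonal to `a`. This is possible: `T ⊓ T'` is
orthogonal to `a ∈ T'`, and the orthogonal of `a` cuts `T` in codimension at most one. The moving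
vector is isotropic automatically, since the form is alternating. -/
theorem IsCurveInvariant.eq_symplectic (hA : B.IsAlt) {w : ℕ} {Z : Type*} {R : (Fin M → V) → Z}
    (hR : IsCurveInvariant (IsIsotropic B) w R) (hwM : w ≤ M) {e e' : Fin M → V}
    (he : IsFrame (IsIsotropic B) e) (he' : IsFrame (IsIsotropic B) e')
    (hw : head e w = head e' w) : R e = R e' := by
  refine hR.eq_of_exists_curve hwM (fun T T' hCT hCT' hT hT' hne W hWR hW => ?_) he he' hw
  obtain ⟨a, haT', haT⟩ := exists_mem_notMem_of_ne (hT.trans hT'.symm) hne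
  have hlt := finrank_inf_lt (U := T') inf_le_right haT' haT' haT
  rw [inf_idem, hT'] at hlt
  have hK := finrank_ker_inf T (B a)
  obtain ⟨H, hRH, hHK, hH⟩ := exists_between_finrank (h := M - 1) (R := T ⊓ T')
    (K := T ⊓ LinearMap.ker (B a))
    (le_inf inf_le_left fun x hx => hCT' a haT' x hx.2) (by omega) (by omega)
  refine exists_curve_of_line hCT hT hRH (hHK.trans inf_le_left) (by omega) hWR hW haT' haT
    fun b hb s _ => ?_
  refine (hCT.mono (hHK.trans inf_le_left)).sup_span hA.isRefl (fun x hx => ?_) (hA _)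
  rw [map_add, map_smul, hCT x (hHK hx).1 b hb, hA.isRefl _ _ (hHK hx).2, smul_zero, add_zero]

end Connectedness

/-! ### Rational connectedness for symmetric forms: lines, conics and Lagrangian pencils -/

section OrthogonalConnectedness

variable {V : Type u} [AddCommGroup V] [Module ℂ V] [FiniteDimensional ℂ V] {M : ℕ}
  {B : LinearMap.BilinForm ℂ V} {W₀ : MaxIsotropic B}

/-- Moving `T` closer to `T'` along a conic. -/
theorem exists_curve_of_conic (hS : B.IsSymm) {w : ℕ} {T T' W : Submodule ℂ V}
    (hCT : IsOrthogonalMember B W₀ T) (hT : finrank ℂ T = M) (hM : 2 * M ≠ finrank ℂ V)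
    (hCT' : IsIsotropic B T') (hWR : W ≤ T ⊓ T') (hW : finrank ℂ W = w) {a b d : V}
    (haT' : a ∈ T') (haT : a ∉ T) (hb : b ∈ T) (hab : B a b = 1) (hdT : ∀ x ∈ T, B x d = 0)
    (had : B a d = 0) (hdd : B d d ≠ 0) :
    ∃ E E' : ℂ → Fin M → V, IsRationalCurve (IsOrthogonalMember B W₀) w E E' ∧
      head (E 0) w = W ∧ head (E 0) M = T ∧
      finrank ℂ ↥(T ⊓ T') < finrank ℂ ↥(head (E' 0) M ⊓ T') := by
  have hba : B b a = 1 := (hS.eq a b).symm.trans hab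
  have hda : B d a = 0 := (hS.eq a d).symm.trans had
  have hdb : B d b = 0 := (hS.eq b d).symm.trans (hdT b hb)
  have haa : B a a = 0 := hCT' a haT' a haT'
  have hbb : B b b = 0 := hCT.1 b hb b hb
  set H := T ⊓ LinearMap.ker (B a) with hHdef
  have hbH : b ∉ H := fun h => one_ne_zero (hab.symm.trans h.2)
  have hRH : T ⊓ T' ≤ H := le_inf inf_le_left fun x hx => hCT' a haT' x hx.2
  have hsup : H ⊔ Submodule.span ℂ {b} = T := by
    apply le_antisymm (sup_le inf_le_left ((Submodule.span_singleton_le_iff_mem _ _).2 hb))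
    intro x hx
    rw [mem_sup_span_singleton]
    exact ⟨x - B a x • b, ⟨T.sub_mem hx (T.smul_mem _ hb), by simp [hab]⟩, B a x, by abel⟩
  have hH : finrank ℂ H + 1 = M := by
    rw [← hT, ← finrank_sup_span_of_notMem hbH, hsup]
  obtain ⟨h, rfl⟩ : ∃ h, M = h + 1 := ⟨_, hH.symm⟩
  -- The line through `b` and `a` is not isotropic because `B a b = 1`. With the auxiliary direction
  -- `d`, the vector `b + t d - c a` has square `t² q - 2c`, which vanishes for `c = t² q / 2`. The
  -- resulting conic passes through `b` and, at infinity, through a nonzero multiple of `a`.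
  set q := B d d with hq
  have hx'H : ∀ s : ℂ, s ^ 2 • b + s • d - (q / 2) • a ∉ H := by
    intro s hs
    by_cases hs0 : s = 0
    · subst hs0
      have h1 := hs.1
      simp only [ne_eq, OfNat.ofNat_ne_zero, not_false_eq_true, zero_pow, zero_smul, add_zero,
        zero_sub] at h1
      exact haT ((Submodule.smul_mem_iff _ (div_ne_zero hdd two_ne_zero)).1
        ((Submodule.neg_mem_iff _).1 h1))
    · have h1 : B a (s ^ 2 • b + s • d - (q / 2) • a) = 0 := hs.2
      simp only [map_sub, map_add, map_smul, hab, had, haa, smul_eq_mul] at h1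
      apply hs0
      simpa using h1
  have hCs : ∀ s : ℂ, IsOrthogonalMember B W₀
      (H ⊔ Submodule.span ℂ {s ^ 2 • b + s • d - (q / 2) • a}) := by
    refine fun s => .of_two_mul_ne ((hCT.1.mono inf_le_left).sup_span hS.isRefl
      (fun x hx => ?_) ?_) ?_
    · have hxa : B x a = 0 := (hS.eq a x).symm.trans hx.2
      simp [hCT.1 x hx.1 b hb, hdT x hx.1, hxa]
    · simp only [map_sub, map_add, map_smul, LinearMap.sub_apply, LinearMap.add_apply,
        LinearMap.smul_apply, smul_eq_mul, hab, hba, had, hda, hdb, hdT b hb, haa, hbb, ← hq]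
      ring
    · rw [finrank_sup_span_of_notMem (hx'H s), hH]
      exact hM
  obtain ⟨E, E', hE, hW, hT', hT₁⟩ := exists_curve_of_hyperplane
    (C := IsOrthogonalMember B W₀) (x := fun t => b + t • d - (t ^ 2 * (q / 2)) • a)
    (x' := fun s => s ^ 2 • b + s • d - (q / 2) • a) (hWR.trans hRH) inf_le_left hW
    (by omega) hT hCT
    (fun l => by simp only [map_sub, map_add, map_smul, smul_eq_mul]; fun_prop)
    (fun l => by simp only [map_sub, map_add, map_smul, smul_eq_mul]; fun_prop)
    (by simpa using hb) (by simpa using hbH)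
    (fun t ht => ⟨t ^ 2, pow_ne_zero 2 ht, by
      simp only [smul_sub, smul_add, smul_smul]
      congr 3
      · rw [← mul_pow, mul_inv_cancel₀ ht, one_pow, one_smul]
      · field_simp⟩)
    (fun s => ⟨hx'H s, hCs s⟩)
  refine ⟨E, E', hE, hW, hT', finrank_inf_lt ?_ ?_ haT' haT⟩
  · rw [hT₁]
    exact hRH.trans le_sup_left
  · rw [hT₁]
    refine Submodule.mem_sup_right ?_
    rw [Submodule.mem_span_singleton]
    refine ⟨-(q / 2)⁻¹, ?_⟩
    simp [smul_smul, div_self hdd]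

/-- Moving the Lagrangian subspace `T` closer to `T'` in the same component. -/
theorem exists_curve_of_lagrangian (hB : B.Nondegenerate) (hS : B.IsSymm) {w : ℕ}
    {T T' W : Submodule ℂ V}
    (hCT : IsOrthogonalMember B W₀ T) (hT : finrank ℂ T = M) (hM : 2 * M = finrank ℂ V)
    (hCT' : IsOrthogonalMember B W₀ T') (hT' : finrank ℂ T' = M) (hne : T ≠ T')
    (hWR : W ≤ T ⊓ T') (hW : finrank ℂ W = w) :
    ∃ E E' : ℂ → Fin M → V, IsRationalCurve (IsOrthogonalMember B W₀) w E E' ∧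
      head (E 0) w = W ∧ head (E 0) M = T ∧
      finrank ℂ ↥(T ⊓ T') < finrank ℂ ↥(head (E' 0) M ⊓ T') := by
  obtain ⟨a₁, ha₁T', ha₁T⟩ := exists_mem_notMem_of_ne (hT.trans hT'.symm) hne
  have hlt := finrank_inf_lt (U := T') inf_le_right ha₁T' ha₁T' ha₁T
  rw [inf_idem, hT'] at hlt
  have hev := (hCT.iff_even hB hS hCT'.1 (by omega) (by omega)).1 hCT'
  rw [hT] at hev
  have hpair : ∀ a, a ∉ T → ∃ b ∈ T, B a b = 1 := by
    intro a ha
    obtain ⟨b, hb, hab⟩ : ∃ b ∈ T, B a b ≠ 0 := by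
      by_contra! h0
      refine ha (hCT.1.orthogonal_eq hB (by omega) ▸ fun x hx => ?_)
      exact hS.isRefl _ _ (h0 x hx)
    exact ⟨(B a b)⁻¹ • b, T.smul_mem _ hb, by simp [hab]⟩
  have ha₁R : a₁ ∉ T ⊓ T' := fun h => ha₁T h.1
  obtain ⟨b₁, hb₁, hab₁₁⟩ := hpair a₁ ha₁T
  -- The codimension of `T ⊓ T'` is even and positive, hence at least two, so `T'` has a second
  -- vector independent of `a₁` modulo `T ⊓ T'`. It is then adjusted so that the vectors `a₁, a₂` of
  -- `T'` and `b₁, b₂` of `T` form dual pairs.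
  obtain ⟨a, haT', haR⟩ := exists_mem_notMem_of_finrank_lt
    (show finrank ℂ ↥(T ⊓ T' ⊔ Submodule.span ℂ {a₁}) < finrank ℂ T' by
      rw [finrank_sup_span_of_notMem ha₁R]
      rcases hev with ⟨r, hr⟩
      omega)
  obtain ⟨a₂, ha₂T', ha₂R, hab₂₁⟩ : ∃ a₂ ∈ T', a₂ ∉ T ⊓ T' ⊔ Submodule.span ℂ {a₁} ∧
      B a₂ b₁ = 0 := by
    refine ⟨a - B a b₁ • a₁, T'.sub_mem haT' (T'.smul_mem _ ha₁T'), fun h => haR ?_, by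
      simp [hab₁₁]⟩
    rw [← sub_add_cancel a (B a b₁ • a₁)]
    exact Submodule.add_mem _ h (Submodule.mem_sup_right
      (Submodule.smul_mem _ _ (Submodule.mem_span_singleton_self _)))
  have hind : ∀ x y : ℂ, x • a₁ + y • a₂ ∈ T → x = 0 ∧ y = 0 := by
    intro x y hxy
    have h1 : x • a₁ + y • a₂ ∈ T ⊓ T' :=
      ⟨hxy, T'.add_mem (T'.smul_mem _ ha₁T') (T'.smul_mem _ ha₂T')⟩
    have hy : y = 0 := by
      by_contra hy
      refine ha₂R (mem_sup_span_singleton.2 ⟨y⁻¹ • (x • a₁ + y • a₂),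
        Submodule.smul_mem _ _ h1, -(y⁻¹ * x), ?_⟩)
      rw [smul_add, inv_smul_smul₀ hy, smul_smul, neg_smul]
      abel
    subst hy
    rw [zero_smul, add_zero] at hxy
    refine ⟨by_contra fun hx => ha₁T ((Submodule.smul_mem_iff _ hx).1 hxy), rfl⟩
  have ha₂T : a₂ ∉ T := fun h => one_ne_zero (hind 0 1 (by simpa using h)).2
  obtain ⟨b₂, hb₂, hab₂₂, hab₁₂⟩ : ∃ b₂ ∈ T, B a₂ b₂ = 1 ∧ B a₁ b₂ = 0 := by
    obtain ⟨b, hb, hab⟩ := hpair a₂ ha₂T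
    exact ⟨b - B a₁ b • b₁, T.sub_mem hb (T.smul_mem _ hb₁), by simp [hab, hab₂₁],
      by simp [hab₁₁]⟩
  have haa : ∀ x ∈ T', ∀ y ∈ T', B x y = 0 := hCT'.1
  have hbb : ∀ x ∈ T, ∀ y ∈ T, B x y = 0 := hCT.1
  have hba : ∀ x y, B x y = B y x := fun x y => hS.eq x y
  set H := T ⊓ LinearMap.ker (B a₁) ⊓ LinearMap.ker (B a₂) with hHdef
  have hHT : H ≤ T := inf_le_left.trans inf_le_left
  have hH₁ : ∀ x ∈ H, B a₁ x = 0 := fun x hx => hx.1.2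
  have hH₂ : ∀ x ∈ H, B a₂ x = 0 := fun x hx => hx.2
  have hRH : T ⊓ T' ≤ H := fun x hx =>
    ⟨⟨hx.1, haa a₁ ha₁T' x hx.2⟩, haa a₂ ha₂T' x hx.2⟩
  have hsup : H ⊔ Submodule.span ℂ {b₁} ⊔ Submodule.span ℂ {b₂} = T := by
    apply le_antisymm (sup_le (sup_le hHT ((Submodule.span_singleton_le_iff_mem _ _).2 hb₁))
      ((Submodule.span_singleton_le_iff_mem _ _).2 hb₂))
    intro x hx
    rw [mem_sup_span_singleton]
    refine ⟨x - B a₂ x • b₂, mem_sup_span_singleton.2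
      ⟨x - B a₂ x • b₂ - B a₁ x • b₁, ⟨⟨?_, ?_⟩, ?_⟩, B a₁ x, by abel⟩, B a₂ x, by abel⟩
    · exact T.sub_mem (T.sub_mem hx (T.smul_mem _ hb₂)) (T.smul_mem _ hb₁)
    · simp [hab₁₁, hab₁₂]
    · simp [hab₂₁, hab₂₂]
  have hfin : ∀ x y : V, x ∉ H → y ∉ H ⊔ Submodule.span ℂ {x} →
      finrank ℂ ↥(H ⊔ Submodule.span ℂ {x} ⊔ Submodule.span ℂ {y}) = finrank ℂ H + 2 :=
    fun x y hx hy => by rw [finrank_sup_span_of_notMem hy, finrank_sup_span_of_notMem hx]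
  have hHM : finrank ℂ H + 2 = M := by
    rw [← hT, ← hsup]
    refine (hfin _ _ (fun h => one_ne_zero (hab₁₁.symm.trans (hH₁ _ h))) fun h => ?_).symm
    obtain ⟨x, hx, c, hxc⟩ := mem_sup_span_singleton.1 h
    have h1 := congrArg (B a₂) hxc
    rw [map_add, map_smul, hH₂ x hx, hab₂₁, hab₂₂, smul_zero, add_zero] at h1
    exact zero_ne_one h1
  obtain ⟨h, rfl⟩ : ∃ h, M = h + 2 := ⟨_, hHM.symm⟩
  have hx'H : ∀ s : ℂ, s • b₁ + a₂ ∉ H := fun s hs => ha₂T (by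
    have := T.sub_mem (hHT hs) (T.smul_mem s hb₁)
    rwa [add_sub_cancel_left] at this)
  have hy'H : ∀ s : ℂ, s • b₂ - a₁ ∉ H ⊔ Submodule.span ℂ {s • b₁ + a₂} := by
    intro s hs
    obtain ⟨x, hx, c, hxc⟩ := mem_sup_span_singleton.1 hs
    have h1 : (1 : ℂ) • a₁ + c • a₂ = s • b₂ - x - (c * s) • b₁ := by
      rw [show s • b₂ = x + c • (s • b₁ + a₂) + a₁ by rw [hxc]; abel]
      module
    have h2 := hind 1 c (h1 ▸ T.sub_mem (T.sub_mem (T.smul_mem _ hb₂) (hHT hx))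
      (T.smul_mem _ hb₁))
    exact one_ne_zero h2.1
  have hK : ∀ s : ℂ, IsIsotropic B (H ⊔ Submodule.span ℂ {s • b₁ + a₂} ⊔
      Submodule.span ℂ {s • b₂ - a₁}) := by
    intro s
    refine ((hCT.1.mono hHT).sup_span hS.isRefl (fun x hx => ?_) ?_).sup_span hS.isRefl
      (fun x hx => ?_) ?_
    · simp [hbb x (hHT hx) b₁ hb₁, hba x a₂, hH₂ x hx]
    · simp [hbb b₁ hb₁ b₁ hb₁, hba b₁ a₂, hab₂₁, haa a₂ ha₂T' a₂ ha₂T']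
    · obtain ⟨z, hz, c, rfl⟩ := mem_sup_span_singleton.1 hx
      simp [hbb z (hHT hz) b₂ hb₂, hba z a₁, hH₁ z hz, hbb b₁ hb₁ b₂ hb₂, hba b₁ a₁, hab₁₁, hab₂₂,
        haa a₂ ha₂T' a₁ ha₁T']
    · simp [hbb b₂ hb₂ b₂ hb₂, hba b₂ a₁, hab₁₂, haa a₁ ha₁T' a₁ ha₁T']
  -- Each subspace of the second chart meets `T` exactly in `H`, of codimension two, so by parity it
  -- stays in the component of `T`.
  have hKT : ∀ s : ℂ, T ⊓ (H ⊔ Submodule.span ℂ {s • b₁ + a₂} ⊔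
      Submodule.span ℂ {s • b₂ - a₁}) = H := by
    intro s
    refine le_antisymm ?_ (le_inf hHT (le_sup_left.trans le_sup_left))
    rintro u ⟨hyT, hu⟩
    obtain ⟨z, hz, c, rfl⟩ := mem_sup_span_singleton.1 hu
    obtain ⟨y, hy, c', rfl⟩ := mem_sup_span_singleton.1 hz
    have h1 : (-c) • a₁ + c' • a₂ =
        (y + c' • (s • b₁ + a₂) + c • (s • b₂ - a₁)) - y - (c' * s) • b₁ - (c * s) • b₂ := by
      rw [smul_add, smul_sub, mul_smul, mul_smul, neg_smul]
      abel
    have h2 := hind (-c) c' (h1 ▸ T.sub_mem (T.sub_mem (T.sub_mem hyT (hHT hy))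
      (T.smul_mem _ hb₁)) (T.smul_mem _ hb₂))
    rw [neg_eq_zero] at h2
    rw [h2.1, h2.2]
    simpa using hy
  -- The opposite signs make the moving plane isotropic: the product of `b₁ + t a₂` and `b₂ - t a₁`
  -- is `-t + t = 0`.
  obtain ⟨E, E', hE, hW, hT₀, hT₁⟩ := exists_curve_of_codim_two
    (C := IsOrthogonalMember B W₀) (x := fun t => b₁ + t • a₂) (x' := fun s => s • b₁ + a₂)
    (y := fun t => b₂ - t • a₁) (y' := fun s => s • b₂ - a₁) (hWR.trans hRH) hHT hW
    (by omega) hT hCT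
    (fun l => by simp only [map_add, map_smul, smul_eq_mul]; fun_prop)
    (fun l => by simp only [map_add, map_smul, smul_eq_mul]; fun_prop)
    (fun l => by simp only [map_sub, map_smul, smul_eq_mul]; fun_prop)
    (fun l => by simp only [map_sub, map_smul, smul_eq_mul]; fun_prop)
    (by simpa using hsup)
    (fun t ht => ⟨t, ht, by rw [smul_add, smul_inv_smul₀ ht],
      by rw [smul_sub, smul_inv_smul₀ ht]⟩)
    (fun s => by
      have hf := hfin _ _ (hx'H s) (hy'H s)
      refine ⟨by omega, (hCT.iff_even hB hS (hK s) (by omega) (by omega)).2 ?_⟩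
      rw [hKT, hT, show h + 2 - finrank ℂ H = 2 by omega]
      exact even_two)
  refine ⟨E, E', hE, hW, hT₀, finrank_inf_lt ?_ ?_ ha₁T' ha₁T⟩
  · rw [hT₁]
    exact hRH.trans (le_sup_left.trans le_sup_left)
  · rw [hT₁]
    refine Submodule.mem_sup_right ?_
    rw [Submodule.mem_span_singleton]
    exact ⟨-1, by simp⟩

/-- Below the middle dimension the condition on the component is vacuous. If some vector of `T' \ T`
is orthogonal to `T`, a line works with any hyperplane of `T` containing `T ⊓ T'`; otherwise a conic
is used, for which a non-isotropic vector orthogonal to `T` and `a` is needed. -/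
theorem IsCurveInvariant.eq_orthogonal (hB : B.Nondegenerate) (hS : B.IsSymm) {w : ℕ} {Z : Type*}
    {R : (Fin M → V) → Z} (hR : IsCurveInvariant (IsOrthogonalMember B W₀) w R) (hwM : w ≤ M)
    {e e' : Fin M → V} (he : IsFrame (IsOrthogonalMember B W₀) e)
    (he' : IsFrame (IsOrthogonalMember B W₀) e') (hw : head e w = head e' w) : R e = R e' := by
  refine hR.eq_of_exists_curve hwM (fun T T' hCT hCT' hT hT' hne W hWR hW => ?_) he he' hw
  by_cases hM : 2 * M = finrank ℂ V
  · exact exists_curve_of_lagrangian hB hS hCT hT hM hCT' hT' hne hWR hW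
  obtain ⟨a, haT', haT⟩ := exists_mem_notMem_of_ne (hT.trans hT'.symm) hne
  have hlt := finrank_inf_lt (U := T') inf_le_right haT' haT' haT
  rw [inf_idem, hT'] at hlt
  by_cases hperp : ∃ a ∈ T', a ∉ T ∧ ∀ x ∈ T, B x a = 0
  · obtain ⟨a, haT', haT, hperp⟩ := hperp
    obtain ⟨H, hRH, hHT, hH⟩ := exists_between_finrank (h := M - 1) (K := T)
      (inf_le_left : T ⊓ T' ≤ T) (by omega) (by omega)
    refine exists_curve_of_line hCT hT hRH hHT (by omega) hWR hW haT' haT fun b hb s hs =>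
      .of_two_mul_ne ((hCT.1.mono hHT).sup_span hS.isRefl (fun x hx => ?_) ?_) (by rwa [hs])
    · simp [hCT.1 x (hHT hx) b hb, hperp x (hHT hx)]
    · simp [hCT.1 b hb b hb, hperp b hb, hS.isRefl _ _ (hperp b hb), hCT'.1 a haT' a haT']
  push Not at hperp
  obtain ⟨b, hb, hba⟩ := hperp a haT' haT
  have hab : B a b ≠ 0 := fun h => hba (hS.isRefl _ _ h)
  -- Otherwise the orthogonal `Q` of `T + ⟨a⟩` is isotropic by polarization, and then so is `T + Q`.
  -- As `b ∈ T` is not orthogonal to `a`, `T ⊓ Q` is smaller than `T`, and so `T + Q` has dimension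
  -- at least `dim V - M`. This exceeds `dim V / 2` because `2 * M < dim V`.
  obtain ⟨d, hd, hdd⟩ : ∃ d ∈ B.orthogonal (T ⊔ Submodule.span ℂ {a}), B d d ≠ 0 := by
    by_contra! h0
    set Q := B.orthogonal (T ⊔ Submodule.span ℂ {a}) with hQ
    have hQT : ∀ x ∈ T, ∀ y ∈ Q, B x y = 0 := fun x hx y hy => hy x (Submodule.mem_sup_left hx)
    have hQa : ∀ y ∈ Q, B a y = 0 := fun y hy =>
      hy a (Submodule.mem_sup_right (Submodule.mem_span_singleton_self a))
    have hQI : IsIsotropic B (T ⊔ Q) := by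
      intro x hx y hy
      obtain ⟨x₁, hx₁, x₂, hx₂, rfl⟩ := Submodule.mem_sup.1 hx
      obtain ⟨y₁, hy₁, y₂, hy₂, rfl⟩ := Submodule.mem_sup.1 hy
      have h3 := h0 _ (Submodule.add_mem _ hx₂ hy₂)
      have h4 : B y₂ x₂ = B x₂ y₂ := hS.eq _ _
      simp only [map_add, LinearMap.add_apply, h0 x₂ hx₂, h0 y₂ hy₂, h4] at h3
      have h5 : B x₂ y₂ = 0 := by simpa using h3
      simp [hCT.1 x₁ hx₁ y₁ hy₁, hQT x₁ hx₁ y₂ hy₂, hS.isRefl _ _ (hQT y₁ hy₁ x₂ hx₂), h5]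
    have h1 := hQI.two_mul_finrank_le hB
    have h2 := Submodule.finrank_sup_add_finrank_inf_eq T Q
    have h3 : finrank ℂ Q = finrank ℂ V - (M + 1) := by
      rw [hQ, LinearMap.BilinForm.finrank_orthogonal hB, finrank_sup_span_of_notMem haT, hT]
    have h4 : finrank ℂ ↥(T ⊓ Q) < finrank ℂ T := by
      refine Submodule.finrank_lt_finrank_of_lt (lt_of_le_not_ge inf_le_left fun h => ?_)
      exact hab (hQa b (h hb).2)
    have h5 := hCT.1.two_mul_finrank_le hB
    omega
  refine exists_curve_of_conic hS hCT hT hM hCT'.1 hWR hW haT' haT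
    (T.smul_mem (B a b)⁻¹ hb) (by simp [hab])
    (fun x hx => hd x (Submodule.mem_sup_left hx))
    (hd a (Submodule.mem_sup_right (Submodule.mem_span_singleton_self a))) hdd

end OrthogonalConnectedness

/-! ### Local sections -/

section Sections

variable {V : Type u} [AddCommGroup V] [Module ℂ V]

theorem isIsotropic_head {B : LinearMap.BilinForm ℂ V} {M : ℕ} {e : Fin M → V}
    (h : ∀ i j, B (e i) (e j) = 0) : IsIsotropic B (head e M) := by
  intro x hx y hy
  rw [head_eq_span] at hx hy
  induction hx, hy using Submodule.span_induction₂ with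
  | mem_mem x y hx hy => obtain ⟨i, rfl⟩ := hx; obtain ⟨j, rfl⟩ := hy; exact h i j
  | zero_left => simp
  | zero_right => simp
  | add_left x y z _ _ _ h1 h2 => simp [h1, h2]
  | add_right x y z _ _ _ h1 h2 => simp [h1, h2]
  | smul_left r x y _ _ h1 => simp [h1]
  | smul_right r x y _ _ h1 => simp [h1]

variable {m M : ℕ} (hmM : m ≤ M)

/-- The vectors which complete the basis of `W` dual to the first `m` of the linear forms `l i`:
`e i - ∑ k, B (e i) (w k) • e' k`. -/
noncomputable def sectionFrame (B : LinearMap.BilinForm ℂ V) (l : Fin M → Dual ℂ V)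
    (e e' : Fin M → V) (W : Submodule ℂ V) : Fin M → V := fun i =>
  if h : i.val < m then dualFrame (fun k => l (Fin.castLE hmM k)) W ⟨i.val, h⟩
  else e i - ∑ k : Fin m, B (e i) (dualFrame (fun k => l (Fin.castLE hmM k)) W k) •
    e' (Fin.castLE hmM k)

variable {B : LinearMap.BilinForm ℂ V} {l : Fin M → Dual ℂ V} {e e' : Fin M → V}

theorem sectionFrame_of_lt {W : Submodule ℂ V} (k : Fin m) :
    sectionFrame hmM B l e e' W (Fin.castLE hmM k) =
      dualFrame (fun k => l (Fin.castLE hmM k)) W k := dif_pos k.2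

theorem sectionFrame_of_le {W : Submodule ℂ V} {i : Fin M} (h : m ≤ i.val) :
    sectionFrame hmM B l e e' W i = e i - ∑ k : Fin m,
      B (e i) (dualFrame (fun k => l (Fin.castLE hmM k)) W k) • e' (Fin.castLE hmM k) :=
  dif_neg h.not_gt

theorem exists_castLE_eq {i : Fin M} (hi : i.val < m) : ∃ k : Fin m, Fin.castLE hmM k = i :=
  ⟨⟨i.val, hi⟩, rfl⟩

theorem apply_sectionFrame'
    (hle : ∀ i j, l i (e j) = (1 : Matrix (Fin M) (Fin M) ℂ) i j) (hle' : ∀ i j, l i (e' j) = 0)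
    {W : Submodule ℂ V} (i : Fin M) {j : Fin M} (hj : m ≤ j.val) :
    l i (sectionFrame hmM B l e e' W j) = (1 : Matrix (Fin M) (Fin M) ℂ) i j := by
  rw [sectionFrame_of_le hmM hj, map_sub, hle, map_sum]
  simp [hle']

/-- The forms `l i` with `i < m` read off the first `m` coordinates and vanish on `Q`, so the
intersection is spanned by the remaining `f i`. Its dimension thus depends only on `m` and `M`,
which allows two different `f` to be compared. -/
theorem finrank_inf_head {f : Fin M → V} (hf : LinearIndependent ℂ f)
    {Q : Submodule ℂ V} (hlf : ∀ i : Fin M, i.val < m → ∀ j,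
      l i (f j) = (1 : Matrix (Fin M) (Fin M) ℂ) i j)
    (hlQ : ∀ i : Fin M, i.val < m → ∀ x ∈ Q, l i x = 0)
    (hfQ : ∀ i : Fin M, m ≤ i.val → f i ∈ Q) :
    finrank ℂ ↥(Q ⊓ head f M) = Fintype.card {i : Fin M // m ≤ i.val} := by
  rw [← finrank_span_eq_card (hf.comp (fun i : {i : Fin M // m ≤ i.val} => i.1)
    Subtype.val_injective)]
  suffices Q ⊓ head f M = Submodule.span ℂ
      (Set.range (f ∘ fun i : {i : Fin M // m ≤ i.val} => i.1)) by rw [this]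
  apply le_antisymm
  · rintro x ⟨hxQ, hx⟩
    rw [head_eq_span] at hx
    obtain ⟨g, rfl⟩ := (Submodule.mem_span_range_iff_exists_fun ℂ).1 hx
    refine Submodule.sum_mem _ fun i _ => ?_
    by_cases hi : i.val < m
    · have h1 := hlQ i hi _ hxQ
      rw [map_sum] at h1
      simp only [map_smul, hlf i hi, smul_eq_mul, Matrix.one_apply, mul_ite, mul_one, mul_zero,
        Finset.sum_ite_eq, Finset.mem_univ, if_true] at h1
      rw [h1, zero_smul]
      exact Submodule.zero_mem _
    · exact Submodule.smul_mem _ _ (Submodule.subset_span ⟨⟨i, not_lt.1 hi⟩, rfl⟩)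
  · rw [Submodule.span_le]
    rintro _ ⟨i, rfl⟩
    exact ⟨hfQ i.1 i.2, mem_head i.1.2⟩

variable [FiniteDimensional ℂ V]

/-- Locally on the variety of `m`-dimensional subspaces satisfying `C`, every subspace `W` has a
basis that depends regularly on `W` and extends to a regular basis of an `M`-dimensional subspace
satisfying `C`. -/
def HasSections (C : Submodule ℂ V → Prop) (m M : ℕ) : Prop :=
  ∀ W₀ : Grass C m, ∃ e : Grass C m → Fin M → V,
    (∀ᶠ W : grassVariety C m in 𝓝 (W₀ : grassVariety C m),
      IsFrame C (e W) ∧ head (e W) m = Grass.space (C := C) W) ∧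
    ∀ i (l : Dual ℂ V), (grassVariety C m).RegularAt (fun W : Grass C m => l (e W i)) W₀

variable {C : Submodule ℂ V → Prop}

theorem regularAt_sectionFrame {W : Grass C m}
    (h : detForm (fun k => l (Fin.castLE hmM k)) W.plucker ≠ 0) (i : Fin M) (f : Dual ℂ V) :
    (grassVariety C m).RegularAt
      (fun W' : Grass C m => f (sectionFrame hmM B l e e' W'.space i)) W := by
  by_cases hi : i.val < m
  · exact LocallyRinged.congr (regularAt_dualFrame h ⟨i.val, hi⟩ f)
      (Filter.Eventually.of_forall fun W' => by
        change _ = f (sectionFrame hmM B l e e' (Grass.space (C := C) W') i)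
        rw [sectionFrame, dif_pos hi])
  · refine LocallyRinged.congr (f := fun W' : Grass C m => f (e i) + ∑ k : Fin m,
      B (e i) (dualFrame (fun k => l (Fin.castLE hmM k)) W'.space k) *
        (-f (e' (Fin.castLE hmM k)))) ?_
      (Filter.Eventually.of_forall fun W' => ?_)
    · exact LocallyRinged.add (LocallyRinged.const _ _) (LocallyRinged.sum _ fun k _ =>
        LocallyRinged.mul (regularAt_dualFrame h k (B (e i))) (LocallyRinged.const _ _))
    · change _ = f (sectionFrame hmM B l e e' (Grass.space (C := C) W') i)
      rw [sectionFrame_of_le hmM (not_lt.1 hi), map_sub, map_sum, sub_eq_add_neg,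
        ← Finset.sum_neg_distrib]
      congr 1
      refine Finset.sum_congr rfl fun k _ => ?_
      rw [map_smul, smul_eq_mul, mul_neg]

theorem apply_sectionFrame
    (hle : ∀ i j, l i (e j) = (1 : Matrix (Fin M) (Fin M) ℂ) i j) (hle' : ∀ i j, l i (e' j) = 0)
    {W : Grass C m}
    (h : detForm (fun k => l (Fin.castLE hmM k)) W.plucker ≠ 0) {i : Fin M} (hi : i.val < m)
    (j : Fin M) : l i (sectionFrame hmM B l e e' W.space j) =
      (1 : Matrix (Fin M) (Fin M) ℂ) i j := by
  by_cases hj : j.val < m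
  · obtain ⟨i, rfl⟩ := exists_castLE_eq hmM hi
    obtain ⟨j, rfl⟩ := exists_castLE_eq hmM hj
    rw [sectionFrame_of_lt, (Grass.dualFrame_spec h).2 i j]
    simp [Matrix.one_apply, Fin.ext_iff]
  · rw [sectionFrame_of_le hmM (not_lt.1 hj), map_sub, hle, map_sum]
    simp [hle']

theorem linearIndependent_sectionFrame
    (hle : ∀ i j, l i (e j) = (1 : Matrix (Fin M) (Fin M) ℂ) i j) (hle' : ∀ i j, l i (e' j) = 0)
    {W : Grass C m}
    (h : detForm (fun k => l (Fin.castLE hmM k)) W.plucker ≠ 0) :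
    LinearIndependent ℂ (sectionFrame hmM B l e e' W.space) := by
  rw [Fintype.linearIndependent_iff]
  intro g hg
  have h1 : ∀ i : Fin M, i.val < m → g i = 0 := by
    intro i hi
    have := congrArg (l i) hg
    rw [map_sum] at this
    simpa [apply_sectionFrame hmM hle hle' h hi, Matrix.one_apply] using this
  intro i
  by_cases hi : i.val < m
  · exact h1 i hi
  have := congrArg (l i) hg
  rw [map_sum, Finset.sum_eq_single i] at this
  · simpa [apply_sectionFrame' hmM hle hle' i (not_lt.1 hi)] using this
  · intro j _ hji
    by_cases hj : j.val < m
    · rw [h1 j hj, zero_smul, map_zero]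
    · rw [map_smul, apply_sectionFrame' hmM hle hle' i (not_lt.1 hj), Matrix.one_apply_ne hji.symm,
        smul_zero]
  · simp

theorem finrank_head_sectionFrame
    (hle : ∀ i j, l i (e j) = (1 : Matrix (Fin M) (Fin M) ℂ) i j) (hle' : ∀ i j, l i (e' j) = 0)
    {W : Grass C m}
    (h : detForm (fun k => l (Fin.castLE hmM k)) W.plucker ≠ 0) :
    finrank ℂ (head (sectionFrame hmM B l e e' W.space) M) = M := by
  rw [head_eq_span, finrank_span_eq_card (linearIndependent_sectionFrame hmM hle hle' h),
    Fintype.card_fin]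

theorem head_sectionFrame {W : Grass C m}
    (h : detForm (fun k => l (Fin.castLE hmM k)) W.plucker ≠ 0) :
    head (sectionFrame hmM B l e e' W.space) m = W.space := by
  rw [head_eq_span_castLE _ hmM]
  simp only [sectionFrame_of_lt]
  exact (Grass.dualFrame_spec h).span_eq W.finrank_eq

/-- The forms `l i`, being dual to `e`, have nonzero determinant on `W₀`, hence on a neighbourhood.
There `sectionFrame` is regular and independent, so only the condition `C` on its span is left to
each case. -/
theorem hasSections_aux
    (hle : ∀ i j, l i (e j) = (1 : Matrix (Fin M) (Fin M) ℂ) i j) (hle' : ∀ i j, l i (e' j) = 0)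
    {W₀ : Grass C m} (he : head e m = W₀.space)
    (hC : ∀ W : Grass C m, detForm (fun k => l (Fin.castLE hmM k)) W.plucker ≠ 0 →
      C (head (sectionFrame hmM B l e e' W.space) M)) :
    ∃ s : Grass C m → Fin M → V,
    (∀ᶠ W : grassVariety C m in 𝓝 (W₀ : grassVariety C m),
      IsFrame C (s W) ∧ head (s W) m = Grass.space (C := C) W) ∧
    ∀ i (f : Dual ℂ V), (grassVariety C m).RegularAt (fun W : Grass C m => f (s W i)) W₀ := by
  have h0 : detForm (fun k => l (Fin.castLE hmM k)) W₀.plucker ≠ 0 := by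
    refine Grass.detForm_ne_zero (w := fun k => e (Fin.castLE hmM k)) ⟨fun i => ?_, fun i j => ?_⟩
    · rw [← he]
      exact mem_head i.2
    · rw [hle]
      simp [Matrix.one_apply, Fin.ext_iff]
  refine ⟨fun W => sectionFrame hmM B l e e' W.space, ?_,
    fun i f => regularAt_sectionFrame hmM h0 i f⟩
  filter_upwards [eventually_plucker_ne_zero _ h0] with W hW
  exact ⟨⟨finrank_head_sectionFrame hmM hle hle' hW, hC W hW⟩, head_sectionFrame hmM hW⟩

theorem hasSections_ordinary (hmM : m ≤ M) (hM : M ≤ finrank ℂ V) :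
    HasSections (V := V) (fun _ => True) m M := by
  intro W₀
  obtain ⟨T, hT, -, hTM⟩ := exists_between_finrank (R := W₀.space) le_top
    (h := M) (by rwa [W₀.finrank_eq]) (by rwa [finrank_top])
  obtain ⟨e, he, -, heT⟩ := exists_adapted_frame le_rfl hT W₀.finrank_eq W₀.finrank_eq hTM
  obtain ⟨l, hl⟩ := exists_dual_eq_one (linearIndependent_of_finrank_head (by rw [heT, hTM]))
  -- For `B = 0` the correction terms vanish and the completing vectors are the constants `e i`.
  exact hasSections_aux (B := 0) hmM (e' := 0) hl (fun _ _ => map_zero _) he fun _ _ => trivial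

/-- The `e' k` pair with the dual frame of `W` as the identity matrix, so the correction makes the
completing vectors orthogonal to `W`. They are orthogonal to each other because the families `e` and
`e'` are isotropic and `e' k` is orthogonal to `e i` for `k < m ≤ i`. -/
theorem isIsotropic_sectionFrame (hR : B.IsRefl) (hl : ∀ i x, l i x = B (e' i) x)
    (hle : ∀ i j, l i (e j) = (1 : Matrix (Fin M) (Fin M) ℂ) i j) (hle' : ∀ i j, l i (e' j) = 0)
    (hee : ∀ i j, B (e i) (e j) = 0) {W : Grass C m} (hW : IsIsotropic B W.space)
    (h : detForm (fun k => l (Fin.castLE hmM k)) W.plucker ≠ 0) :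
    IsIsotropic B (head (sectionFrame hmM B l e e' W.space) M) := by
  have hd := Grass.dualFrame_spec h
  have h1 : ∀ i (j : Fin m), m ≤ i.val → B (sectionFrame hmM B l e e' W.space i)
      (dualFrame (fun k => l (Fin.castLE hmM k)) W.space j) = 0 := by
    intro i j hi
    rw [sectionFrame_of_le hmM hi, map_sub, map_sum, LinearMap.sub_apply, LinearMap.sum_apply,
      Finset.sum_eq_single j]
    · rw [map_smul, LinearMap.smul_apply, ← hl, hd.2, Matrix.one_apply_eq, smul_eq_mul, mul_one,
        sub_self]
    · intro k _ hkj
      rw [map_smul, LinearMap.smul_apply, ← hl, hd.2, Matrix.one_apply_ne hkj, smul_zero]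
    · simp
  refine isIsotropic_head fun i j => ?_
  by_cases hi : i.val < m <;> by_cases hj : j.val < m
  · obtain ⟨i, rfl⟩ := exists_castLE_eq hmM hi
    obtain ⟨j, rfl⟩ := exists_castLE_eq hmM hj
    rw [sectionFrame_of_lt, sectionFrame_of_lt]
    exact hW _ (hd.1 i) _ (hd.1 j)
  · obtain ⟨i, rfl⟩ := exists_castLE_eq hmM hi
    rw [sectionFrame_of_lt]
    exact hR _ _ (h1 j i (not_lt.1 hj))
  · obtain ⟨j, rfl⟩ := exists_castLE_eq hmM hj
    rw [sectionFrame_of_lt]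
    exact h1 i j (not_lt.1 hi)
  · have h2 : ∀ (k : Fin m) (i : Fin M), m ≤ i.val → B (e' (Fin.castLE hmM k)) (e i) = 0 := by
      intro k i hi
      rw [← hl, hle, Matrix.one_apply_ne]
      rintro rfl
      exact absurd k.2 (not_lt.2 hi)
    have h3 : ∀ (k : Fin m) (i : Fin M), m ≤ i.val → B (e i) (e' (Fin.castLE hmM k)) = 0 :=
      fun k i hi => hR _ _ (h2 k i hi)
    have h4 : ∀ i j, B (e' i) (e' j) = 0 := fun i j => by rw [← hl, hle']
    rw [sectionFrame_of_le hmM (not_lt.1 hi), sectionFrame_of_le hmM (not_lt.1 hj)]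
    simp [hee, h2 _ _ (not_lt.1 hj), h3 _ _ (not_lt.1 hi), h4]

/-- Frames of isotropic subspaces with an opposite family of vectors. -/
theorem exists_opposite_frame (hB : B.Nondegenerate) {ε : ℂ} (hε : ε * ε = 1)
    (hBε : ∀ x y, B x y = ε * B y x) {W T : Submodule ℂ V} (hWT : W ≤ T) (hT : IsIsotropic B T)
    (hW : finrank ℂ W = m) (hTM : finrank ℂ T = M) :
    ∃ (e e' : Fin M → V) (l : Fin M → Dual ℂ V), (∀ i x, l i x = B (e' i) x) ∧
      (∀ i j, l i (e j) = (1 : Matrix (Fin M) (Fin M) ℂ) i j) ∧ (∀ i j, l i (e' j) = 0) ∧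
      (∀ i j, B (e i) (e j) = 0) ∧ head e m = W ∧ head e M = T := by
  obtain ⟨e, he, -, heT⟩ := exists_adapted_frame le_rfl hWT hW hW hTM
  have hI : ∀ i j, B (e i) (e j) = 0 := fun i j =>
    hT _ (heT ▸ mem_head i.2) _ (heT ▸ mem_head j.2)
  obtain ⟨e', h1, h2⟩ := exists_opposite hB hε hBε
    (linearIndependent_of_finrank_head (by rw [heT, hTM])) hI
  exact ⟨e, e', fun i => B (e' i), fun _ _ => rfl, h1, h2, hI, he, heT⟩

theorem hasSections_symplectic (hmM : m ≤ M) (hB : B.Nondegenerate) (hA : B.IsAlt)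
    (hM : 2 * M ≤ finrank ℂ V) : HasSections (IsIsotropic B) m M := by
  intro W₀
  obtain ⟨T, hT, hTI, hTM⟩ := exists_isotropic_extension hA.isRefl
    (fun W hW => exists_alternating_vector hB hA W hW) hM W₀.cond (by rwa [W₀.finrank_eq])
  obtain ⟨e, e', l, hl, hle, hle', hee, he, -⟩ := exists_opposite_frame (ε := -1) hB (by norm_num)
    (fun x y => by rw [neg_one_mul, ← hA.neg_eq]) hT hTI W₀.finrank_eq hTM
  exact hasSections_aux hmM hle hle' he fun W hW =>
    isIsotropic_sectionFrame hmM hA.isRefl hl hle hle' hee W.cond hW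

/-- Comparison through a third Lagrangian `Q` of either component: the isometries from `Q` to `T`
and from `Q` to `T'` have the same parity sign as determinant. Hence the resulting isometry from `T`
to `T'` has determinant one. -/
theorem IsOrthogonalMember.of_finrank_inf_eq {W₀ : MaxIsotropic B} (hB : B.Nondegenerate)
    (hS : B.IsSymm) {T T' Q : Submodule ℂ V}
    (hT : IsOrthogonalMember B W₀ T) (hT' : IsIsotropic B T') (hQ : IsIsotropic B Q)
    (hd : 2 * finrank ℂ T = finrank ℂ V) (hd' : finrank ℂ T' = finrank ℂ T)
    (hQd : finrank ℂ Q = finrank ℂ T) (h : finrank ℂ ↥(Q ⊓ T) = finrank ℂ ↥(Q ⊓ T')) :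
    IsOrthogonalMember B W₀ T' := by
  obtain ⟨g, hg, hgd, hgT⟩ := hT.2 hd
  obtain ⟨h₁, hi₁, hd₁, hT₁⟩ := exists_isometry_map_eq hB hS hQ hT.1 (by omega) hQd.symm
  obtain ⟨h₂, hi₂, hd₂, hT₂⟩ := exists_isometry_map_eq hB hS hQ hT' (by omega) (by omega)
  refine ⟨hT', fun _ => ⟨(g.trans h₁.symm).trans h₂, fun x y => ?_, ?_, ?_⟩⟩
  · have h1 := hi₁ (h₁.symm (g x)) (h₁.symm (g y))
    rw [h₁.apply_symm_apply, h₁.apply_symm_apply, hg] at h1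
    exact (hi₂ _ _).trans h1.symm
  · have h1 := LinearEquiv.det_mul_det_symm h₁
    rw [LinearEquiv.coe_trans, LinearEquiv.coe_trans, LinearMap.det_comp, LinearMap.det_comp, hgd,
      mul_one, hd₂, ← h, ← hd₁, h1]
  · rw [LinearEquiv.coe_trans, LinearEquiv.coe_trans, Submodule.map_comp, Submodule.map_comp, ← hgT,
      hT₂]
    congr 1
    conv_rhs => rw [hT₁]
    rw [← Submodule.map_comp, LinearEquiv.symm_comp, Submodule.map_id]

/-- Beyond isotropy, in the middle dimension the completed subspace has to stay in the component of
`T`. This is tested against an auxiliary Lagrangian which meets both in dimension `M - m`. -/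
theorem hasSections_orthogonal {W₀ : MaxIsotropic B} (hmM : m ≤ M) (hB : B.Nondegenerate)
    (hS : B.IsSymm) (hM : 2 * M ≤ finrank ℂ V) : HasSections (IsOrthogonalMember B W₀) m M := by
  intro U₀
  obtain ⟨T, hT, hTC, hTM⟩ := exists_orthogonalMember_extension hB hS hM U₀.cond
    (by rwa [U₀.finrank_eq])
  obtain ⟨e, e', l, hl, hle, hle', hee, he, heT⟩ := exists_opposite_frame (ε := 1) hB (by norm_num)
    (fun x y => by rw [one_mul]; exact (hS.eq x y)) hT hTC.1 U₀.finrank_eq hTM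
  refine hasSections_aux (B := B) hmM hle hle' he fun W hW => ?_
  have hI := isIsotropic_sectionFrame hmM hS.isRefl hl hle hle' hee W.cond.1 hW
  have hf := finrank_head_sectionFrame (B := B) hmM hle hle' hW
  by_cases hd : 2 * M = finrank ℂ V
  swap
  · exact .of_two_mul_ne hI (by omega)
  -- The span of `q` contains the `e i` with `i ≥ m` and also the completing vectors `e i - ∑ B (e
  -- i) (w k) • e' k`. On it the forms `l i` with `i < m` vanish, so its intersections with `T` and
  -- with the completed subspace are spanned by exactly these vectors.
  set q : Fin M → V := fun i => if i.val < m then e' i else e i with hq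
  have h4 : ∀ i j, B (e' i) (e' j) = 0 := fun i j => by rw [← hl, hle']
  have hlq : ∀ i : Fin M, i.val < m → ∀ j, l i (q j) = 0 := by
    intro i hi j
    simp only [hq]
    split_ifs with hj
    · exact hle' i j
    · rw [hle, Matrix.one_apply_ne]
      rintro rfl
      exact hj hi
  have hqli : LinearIndependent ℂ q := by
    rw [Fintype.linearIndependent_iff]
    intro g hg
    have h1 : ∀ i : Fin M, m ≤ i.val → g i = 0 := by
      intro i hi
      have := congrArg (l i) hg
      rw [map_sum, map_zero, Finset.sum_eq_single i] at this
      · simpa [hq, not_lt.2 hi, hle] using this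
      · intro j _ hji
        rw [map_smul]
        simp only [hq]
        split_ifs
        · rw [hle', smul_zero]
        · rw [hle, Matrix.one_apply_ne hji.symm, smul_zero]
      · simp
    intro i
    by_cases hi : i.val < m
    swap
    · exact h1 i (not_lt.1 hi)
    have := congrArg (fun x => B x (e i)) hg
    simp only [map_sum, LinearMap.sum_apply, map_zero, LinearMap.zero_apply, map_smul,
      LinearMap.smul_apply] at this
    rw [Finset.sum_eq_single i] at this
    · simpa [hq, hi, ← hl, hle] using this
    · intro j _ hji
      simp only [hq]
      split_ifs with hj
      · rw [← hl, hle, Matrix.one_apply_ne hji, smul_zero]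
      · rw [h1 j (not_lt.1 hj), zero_smul]
    · simp
  have hqI : IsIsotropic B (head q M) := by
    refine isIsotropic_head fun i j => ?_
    simp only [hq]
    split_ifs with hi hj hj
    · exact h4 i j
    · rw [← hl, hle, Matrix.one_apply_ne]
      rintro rfl
      exact hj hi
    · refine hS.isRefl _ _ ?_
      rw [← hl, hle, Matrix.one_apply_ne]
      rintro rfl
      exact hi hj
    · exact hee i j
  have hqf : finrank ℂ (head q M) = M := by
    rw [head_eq_span, finrank_span_eq_card hqli, Fintype.card_fin]
  have hlQ : ∀ i : Fin M, i.val < m → ∀ x ∈ head q M, l i x = 0 := fun i hi x hx =>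
    (head_le_iff (S := LinearMap.ker (l i))).2 (fun j _ => hlq i hi j) hx
  have hqe : ∀ i : Fin M, m ≤ i.val → e i ∈ head q M := fun i hi => by
    have := mem_head (e := q) i.2
    simpa only [hq, if_neg (not_lt.2 hi)] using this
  have hqe' : ∀ i : Fin M, i.val < m → e' i ∈ head q M := fun i hi => by
    have := mem_head (e := q) i.2
    simpa only [hq, if_pos hi] using this
  refine hTC.of_finrank_inf_eq hB hS hI hqI (by omega) (by omega) (by omega) ?_
  rw [← heT, finrank_inf_head (linearIndependent_of_finrank_head (by rw [heT, hTM]))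
    (fun i _ => hle i) hlQ hqe, finrank_inf_head (linearIndependent_sectionFrame hmM hle hle' hW)
    (fun i hi => apply_sectionFrame hmM hle hle' hW hi) hlQ fun i hi => ?_]
  rw [sectionFrame_of_le hmM hi]
  exact Submodule.sub_mem _ (hqe i hi) (Submodule.sum_mem _ fun k _ =>
    Submodule.smul_mem _ _ (hqe' _ k.2))

end Sections

/-! ### Line bundles which are trivial on a part of the source -/

section Bundles

variable {V' : Type v} [AddCommGroup V'] [Module ℂ V'] [FiniteDimensional ℂ V']
  {C : Submodule ℂ V' → Prop} {n : ℕ}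

theorem Grass.exists_form_ne_zero (W : Grass C n) : ∃ l : Dual ℂ (⋀[ℂ]^n V'), l W.plucker ≠ 0 := by
  by_contra! h
  exact W.plucker_ne_zero ((Module.forall_dual_apply_eq_zero_iff ℂ _).1 h)

/-- The frames of a power of the line bundle `N` on a Grassmannian are compared with those of
`𝒪(1)`. -/
def PowerIso (e : ℕ) (N : GluingData.{v, v} (grassVariety C n)) : Prop :=
  ∃ h : N.ι → Dual ℂ (⋀[ℂ]^n V') → grassVariety C n → ℂ,
    (∀ i l (W : Grass C n), W ∈ N.U i → l W.plucker ≠ 0 →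
      (grassVariety C n).RegularAt (h i l) W ∧ h i l W ≠ 0) ∧
    ∀ i j l l' (W : Grass C n), W ∈ N.U i → W ∈ N.U j → l W.plucker ≠ 0 → l' W.plucker ≠ 0 →
      h i l W * (l W.plucker / l' W.plucker) = N.g i j W ^ e * h j l' W

theorem powerIso_one {N : GluingData.{v, v} (grassVariety C n)}
    (h : N.Iso (pluckerBundle C n)) : PowerIso 1 N := by
  obtain ⟨h, h1, h2⟩ := h
  refine ⟨h, fun i l W hi hl => h1 i l W ⟨hi, hl⟩, fun i j l l' W hi hj hl hl' => ?_⟩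
  rw [pow_one]
  exact h2 i j l l' W ⟨⟨hi, hj⟩, hl, hl'⟩

theorem powerIso_two {N : GluingData.{v, v} (grassVariety C n)}
    (h : (N.tensor N).Iso (pluckerBundle C n)) : PowerIso 2 N := by
  obtain ⟨h, h1, h2⟩ := h
  refine ⟨fun i => h (i, i), fun i l W hi hl => h1 (i, i) l W ⟨⟨hi, hi⟩, hl⟩,
    fun i j l l' W hi hj hl hl' => ?_⟩
  rw [pow_two]
  exact h2 (i, i) (j, j) l l' W ⟨⟨⟨hi, hi⟩, ⟨hj, hj⟩⟩, hl, hl'⟩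

/-- The homogeneous coordinates of the map `f` can be normalized to be regular on `D`. -/
def HasRegularCoordinates {X : FunctionSpace.{u}} (f : X → Grass C n) (D : Set X) : Prop :=
  ∃ ρ : X → ℂ, ∀ y ∈ D, ρ y ≠ 0 ∧
    ∀ l : Dual ℂ (⋀[ℂ]^n V'), X.RegularAt (fun z => ρ z * l (f z).plucker) y

/-- If the pullback of a root of `𝒪(1)` along `f` is trivial on `D`, then `f` is given by regular
functions on `D`. -/
theorem hasRegularCoordinates_of_trivial {X : FunctionSpace.{u}} [LocallyRinged X]
    {f : X → Grass C n} (hf : ∀ x, MorphAt (Y := grassVariety C n) f x)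
    {N : GluingData.{v, v} (grassVariety C n)} (hN : N.IsLineBundle) {e : ℕ} (hNe : PowerIso e N)
    {D : Set X} (hD : IsOpen D) (h : N.ι → X → ℂ)
    (hreg : ∀ i, ∀ y ∈ D, f y ∈ N.U i → X.RegularAt (h i) y ∧ h i y ≠ 0)
    (hglue : ∀ i j, ∀ y ∈ D, f y ∈ N.U i → f y ∈ N.U j → h i y = N.g i j (f y) * h j y) :
    HasRegularCoordinates f D := by
  obtain ⟨h', h1, h2⟩ := hNe
  choose i hi using fun y => hN.cover (f y)
  choose l hl using fun y => (f y).exists_form_ne_zero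
  -- If `s i` is the frame of `N`, then `h i` is its pullback in the trivialization, and `h' i l`
  -- compares `s i ^ e` with the section `l` of 𝒪(1). The normalizing factor `h ^ e / (h' * l)`
  -- therefore does not depend on `i` and `l`, so these may be held fixed near a point when
  -- regularity is checked.
  have key : ∀ y ∈ D, ∀ a b, f y ∈ N.U a → b (f y).plucker ≠ 0 →
      h (i y) y ^ e / (h' (i y) (l y) (f y) * l y (f y).plucker) =
        h a y ^ e / (h' a b (f y) * b (f y).plucker) := by
    intro y hy a b ha hb
    have h3 := h2 a (i y) b (l y) (f y) ha (hi y) hb (hl y)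
    have h4 := hglue a (i y) y hy ha (hi y)
    have h5 := (h1 a b (f y) ha hb).2
    have h6 := (h1 (i y) (l y) (f y) (hi y) (hl y)).2
    have h7 := hN.ne_zero a (i y) (f y) ⟨ha, hi y⟩
    have h8 := (hreg (i y) y hy (hi y)).2
    have h9 := hl y
    rw [h4, mul_pow, div_eq_div_iff (mul_ne_zero h6 h9) (mul_ne_zero h5 hb)]
    rw [mul_div_assoc', div_eq_iff h9] at h3
    rw [h3]
    ring
  refine ⟨fun y => h (i y) y ^ e / (h' (i y) (l y) (f y) * l y (f y).plucker),
    fun y hy => ⟨?_, fun b => ?_⟩⟩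
  · exact div_ne_zero (pow_ne_zero _ (hreg _ y hy (hi y)).2)
      (mul_ne_zero (h1 _ _ _ (hi y) (hl y)).2 (hl y))
  · have hU : ∀ᶠ z in 𝓝 y, f z ∈ N.U (i y) :=
      (hf y).continuousAt.eventually ((hN.isOpen (i y)).mem_nhds (hi y))
    have hV : ∀ᶠ z in 𝓝 y, l y (f z).plucker ≠ 0 :=
      (hf y).continuousAt.eventually (eventually_plucker_ne_zero (l y) (hl y))
    have hr : X.RegularAt (fun z => h (i y) z ^ e / h' (i y) (l y) (f z) *
        (b (f z).plucker / l y (f z).plucker)) y :=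
      LocallyRinged.mul (LocallyRinged.div (LocallyRinged.pow (hreg _ y hy (hi y)).1 e)
        ((hf y).regular _ (h1 _ _ _ (hi y) (hl y)).1) (h1 _ _ _ (hi y) (hl y)).2)
        ((hf y).regular _ (regularAt_plucker_ratio b (l y) (hl y)))
    refine LocallyRinged.congr hr ?_
    filter_upwards [hU, hV, hD.mem_nhds hy] with z hz hz' hzD
    rw [key z hzD (i y) (l y) hz hz', div_mul_div_comm, div_mul_eq_mul_div]

end Bundles

/-! ### Flags given by frames -/

section Flags

variable {V : Type u} [AddCommGroup V] [Module ℂ V]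
  {C : Submodule ℂ V → Prop} {k : ℕ} {m : Fin k → ℕ} {M : ℕ}

/-- `e` is a basis of a subspace satisfying `C`, adapted to the flag `F`. -/
def IsFlagFrame (F : PartialFlag C m) (e : Fin M → V) : Prop :=
  IsFrame C e ∧ ∀ a, head e (m a) = F.space a

theorem IsFlagFrame.eq {F F' : PartialFlag C m} {e e' : Fin M → V} (h : IsFlagFrame F e)
    (h' : IsFlagFrame F' e') (he : ∀ n, head e n = head e' n) : F = F' :=
  PartialFlag.ext (funext fun a => by rw [← h.2, ← h'.2, he])

theorem exists_isFlagFrame (hC : ∀ U T : Submodule ℂ V, U ≤ T → C T → C U) (hm : Monotone m)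
    (hM : ∀ a, m a ≤ M) {e : Fin M → V} (he : IsFrame C e) :
    ∃ F : PartialFlag C m, IsFlagFrame F e :=
  ⟨⟨fun a => head e (m a), fun a => finrank_head he.1 (hM a),
    fun a => hC _ _ (head_mono e (hM a)) he.2, fun _ _ h => head_mono e (hm h)⟩, he, fun _ => rfl⟩

variable [FiniteDimensional ℂ V]

/-- A flag of subspaces of `T` has an adapted basis of `T`. -/
theorem PartialFlag.exists_isFlagFrame (F : PartialFlag C m)
    {T : Submodule ℂ V} (hT : C T) (hTM : finrank ℂ T = M) (hF : ∀ a, F.space a ≤ T) :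
    ∃ e : Fin M → V, IsFlagFrame F e := by
  -- Here `d` is the length already used by the first `n` members. The last clause keeps the
  -- constructed head inside all later members, so that it extends to the next one.
  suffices H : ∀ n ≤ k, ∃ e : Fin M → V, ∃ d ≤ M, head e d ≤ T ∧ finrank ℂ (head e d) = d ∧
      (∀ a : Fin k, a.val < n → m a ≤ d ∧ head e (m a) = F.space a) ∧
      ∀ a : Fin k, n ≤ a.val → head e d ≤ F.space a by
    obtain ⟨e, d, -, heT, hed, he, -⟩ := H k le_rfl
    obtain ⟨e', he', h'⟩ := exists_frame_extension (M := M) le_rfl heT hed hTM rfl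
    refine ⟨e', ⟨by rw [h', hTM], by rwa [h']⟩, fun a => ?_⟩
    rw [← (he a a.2).2]
    exact head_congr fun i hi => he' i (hi.trans_le (he a a.2).1)
  intro n
  induction n with
  | zero =>
    exact fun _ => ⟨0, 0, Nat.zero_le _, by simp [head_zero], by simp [head_zero],
      fun a ha => absurd ha (Nat.not_lt_zero _), fun a _ => by simp [head_zero]⟩
  | succ n ih =>
    intro hn
    obtain ⟨e, d, hdM, heT, hed, he, hea⟩ := ih (by omega)
    have hle : m ⟨n, hn⟩ ≤ M := by
      rw [← F.finrank_eq, ← hTM]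
      exact Submodule.finrank_mono (hF _)
    have hd : d ≤ m ⟨n, hn⟩ := by
      rw [← F.finrank_eq, ← hed]
      exact Submodule.finrank_mono (hea ⟨n, hn⟩ le_rfl)
    obtain ⟨e', he', h'⟩ := exists_frame_extension (M := M) hle (hea ⟨n, hn⟩ le_rfl) hed
      (F.finrank_eq _) rfl
    refine ⟨e', m ⟨n, hn⟩, hle, h' ▸ hF _, by rw [h', F.finrank_eq], fun a ha => ?_,
      fun a ha => ?_⟩
    · rcases (Nat.lt_succ_iff.1 ha).lt_or_eq with h | h
      · refine ⟨(he a h).1.trans hd, ?_⟩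
        rw [← (he a h).2]
        exact head_congr fun i hi => he' i (hi.trans_le (he a h).1)
      · obtain rfl : a = ⟨n, hn⟩ := Fin.ext h
        exact ⟨le_rfl, h'⟩
    · rw [h']
      exact F.mono (show (⟨n, hn⟩ : Fin k).val ≤ a.val by simp only; omega)

/-- A map to a flag variety given near `x` by regular bases is a morphism near `x`. -/
theorem morphAt_of_frames {S : FunctionSpace.{w}} [LocallyRinged S] {x : S}
    (hM : ∀ a, m a ≤ M) (s : S → PartialFlag C m) (e : S → Fin M → V)
    (hs : ∀ᶠ y in 𝓝 x, IsFlagFrame (s y) (e y))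
    (he : ∀ i (l : Dual ℂ V), S.RegularAt (fun y => l (e y i)) x) :
    MorphAt (Y := flagVariety C m) s x := by
  refine morphAt_of_coordinates (c := fun (F : PartialFlag C m) i => (F.get i).plucker) s
    (fun y a => exteriorPower.ιMulti ℂ (m a) fun i => e y (Fin.castLE (hM a) i)) ?_
    fun a l => regularAt_ιMulti (fun i f => he _ f) l
  filter_upwards [hs] with y hy a
  refine Grass.plucker_eq_smul ((s y).get a) _ ?_
  rw [← head_eq_span_castLE]
  exact hy.2 a

/-- A map to a Grassmannian given near `x` by regular bases is a morphism near `x`. -/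
theorem morphAt_grass_of_frames {S : FunctionSpace.{w}} [LocallyRinged S] {x : S} {d : ℕ}
    (s : S → Grass C d) (e : S → Fin d → V)
    (hs : ∀ᶠ y in 𝓝 x, head (e y) d = (s y).space)
    (he : ∀ i (l : Dual ℂ V), S.RegularAt (fun y => l (e y i)) x) :
    MorphAt (Y := grassVariety C d) s x := by
  refine morphAt_of_coordinates (c := fun (W : Grass C d) (_ : Unit) => W.plucker) s
    (fun y _ => exteriorPower.ιMulti ℂ d (e y)) ?_
    fun _ l => regularAt_ιMulti (fun i f => he _ f) l
  filter_upwards [hs] with y hy _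
  refine Grass.plucker_eq_smul (s y) _ ?_
  rw [← head_eq_span]
  exact hy

/-- Dividing by a linear form that does not vanish at `s x` turns the Plücker coordinates into
ratios, which are regular. -/
theorem exists_normalized_coordinates {S : FunctionSpace.{w}} {x : S} {d : ℕ} {s : S → Grass C d}
    (hs : MorphAt (Y := grassVariety C d) s x) :
    ∃ c : S → ⋀[ℂ]^d V, (∀ᶠ y in 𝓝 x, ∃ r : ℂ, r ≠ 0 ∧ (s y).plucker = r • c y) ∧
      ∀ l : Dual ℂ (⋀[ℂ]^d V), S.RegularAt (fun y => l (c y)) x := by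
  obtain ⟨l₀, hl₀⟩ := (s x).exists_form_ne_zero
  refine ⟨fun y => (l₀ (s y).plucker)⁻¹ • (s y).plucker, ?_, fun l => ?_⟩
  · filter_upwards [hs.continuousAt.eventually (eventually_plucker_ne_zero l₀ hl₀)] with y hy
    exact ⟨l₀ (s y).plucker, hy, by rw [smul_inv_smul₀ hy]⟩
  · simp only [map_smul, smul_eq_mul, inv_mul_eq_div]
    exact hs.regular _ (regularAt_plucker_ratio l l₀ hl₀)

/-- The product carries the Zariski topology of multihomogeneous polynomials, so continuity of the
components alone is not enough; normalized coordinates of all components are used at once. -/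
theorem morphAt_prodGrass {S : FunctionSpace.{w}} [LocallyRinged S] {x : S} {J : Type} [Finite J]
    {d : J → ℕ} (s : S → ∀ j, Grass C (d j))
    (hs : ∀ j, MorphAt (Y := grassVariety C (d j)) (fun y => s y j) x) :
    MorphAt (Y := prodGrassVariety C d) s x := by
  choose c hc hc' using fun j => exists_normalized_coordinates (hs j)
  exact morphAt_of_coordinates (c := fun (W : ∀ j, Grass C (d j)) j => (W j).plucker) s
    (fun y j => c j y) (Filter.eventually_all.2 hc) hc'

theorem morphAt_get (a : Fin k) (F : PartialFlag C m) :
    MorphAt (X := flagVariety C m) (Y := grassVariety C (m a))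
      (fun F => PartialFlag.get F a) F := by
  obtain ⟨l₀, hl₀⟩ := (F.get a).exists_form_ne_zero
  have hl : ∀ l : Dual ℂ (⋀[ℂ]^(m a) V), (flagVariety C m).RegularAt
      (fun F : PartialFlag C m => l (F.get a).plucker / l₀ (F.get a).plucker) F := fun l =>
    regularAt_ratio (c := fun (F : PartialFlag C m) i => (F.get i).plucker) a l l₀ F hl₀
  refine morphAt_of_coordinates (c := fun (W : Grass C (m a)) (_ : Unit) => W.plucker)
    (fun F : flagVariety C m => PartialFlag.get (C := C) F a)
    (fun F _ => (l₀ (PartialFlag.get (C := C) F a).plucker)⁻¹ •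
      (PartialFlag.get (C := C) F a).plucker) ?_ fun _ l => ?_
  · have := eventually_ne_zero_ofCoordinates
      (c := fun (F : PartialFlag C m) i => (F.get i).plucker) (E := fun i => ⋀[ℂ]^(m i) V)
      (P := fun e => l₀ (e a)) (IsMultihomogeneous.linear (E := fun i => ⋀[ℂ]^(m i) V) a l₀)
      (x := F) hl₀
    filter_upwards [this] with F' hF' _
    exact ⟨l₀ (PartialFlag.get (C := C) F' a).plucker, hF', by rw [smul_inv_smul₀ hF']⟩
  · simp only [map_smul, smul_eq_mul, inv_mul_eq_div]
    exact hl l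

theorem morphAt_const {S : FunctionSpace.{u}} {Y : FunctionSpace.{v}} [LocallyRinged S] (y : Y)
    (x : S) : MorphAt (X := S) (fun _ => y) x :=
  ⟨continuousAt_const, fun f _ => LocallyRinged.const (f y) x⟩

variable {V' : Type v} [AddCommGroup V'] [Module ℂ V'] [FiniteDimensional ℂ V']
  {C' : Submodule ℂ V' → Prop} {n w : ℕ}

/-- A map which is given by regular functions near a rational curve is constant on it. -/
theorem eq_of_isRationalCurve (hM : ∀ a, m a ≤ M) {E E' : ℂ → Fin M → V}
    (hE : IsRationalCurve C w E E') {γ γ' : ℂ → PartialFlag C m}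
    (hγ : ∀ t, IsFlagFrame (γ t) (E t)) (hγ' : ∀ t, IsFlagFrame (γ' t) (E' t))
    {f : flagVariety C m → Grass C' n} {D : Set (flagVariety C m)}
    (hf : HasRegularCoordinates f D) (hD : ∀ t, γ t ∈ D) (hD' : ∀ t, γ' t ∈ D) :
    f (γ 0) = f (γ' 0) := by
  obtain ⟨ρ, hρ⟩ := hf
  have h1 : ∀ t, MorphAt (X := complexLine) (Y := flagVariety C m) γ t := fun t =>
    morphAt_of_frames (S := complexLine) hM γ E (Filter.Eventually.of_forall hγ)
      fun i l => hE.entire i l t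
  have h2 : ∀ t, MorphAt (X := complexLine) (Y := flagVariety C m) γ' t := fun t =>
    morphAt_of_frames (S := complexLine) hM γ' E' (Filter.Eventually.of_forall hγ')
      fun i l => hE.entire' i l t
  -- Each normalized coordinate is constant along the curve, so the Plücker vectors at the two ends
  -- are proportional.
  have h3 : ∀ l : Dual ℂ (⋀[ℂ]^n V'),
      ρ (γ 0) * l (f (γ 0)).plucker = ρ (γ' 0) * l (f (γ' 0)).plucker := fun l =>
    regular_eq_of_curve (X := flagVariety C m) γ γ' h1 h2
      (fun t ht => (hγ t).eq (hγ' t⁻¹) (hE.glue t ht))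
      (fun F => ρ F * l (f F).plucker) (fun t => (hρ _ (hD t)).2 l) (fun t => (hρ _ (hD' t)).2 l)
  have h4 : ρ (γ 0) • (f (γ 0)).plucker = ρ (γ' 0) • (f (γ' 0)).plucker := by
    rw [← sub_eq_zero, ← Module.forall_dual_apply_eq_zero_iff ℂ]
    intro l
    rw [map_sub, map_smul, map_smul, smul_eq_mul, smul_eq_mul, h3, sub_self]
  refine Grass.eq_of_plucker_eq_smul (r := (ρ (γ 0))⁻¹ * ρ (γ' 0)) ?_
  rw [mul_smul, ← h4, inv_smul_smul₀ (hρ _ (hD 0)).1]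

/-- A map which is given by regular functions near the set of flags whose members satisfy a
condition on the span of the first `w` vectors is constant on this set. -/
theorem eq_of_hasRegularCoordinates (hC : ∀ U T : Submodule ℂ V, U ≤ T → C T → C U)
    (hm : Monotone m) (hM : ∀ a, m a ≤ M)
    (hconn : ∀ R : (Fin M → V) → Grass C' n, IsCurveInvariant C w R → ∀ e e' : Fin M → V,
      IsFrame C e → IsFrame C e' → head e w = head e' w → R e = R e')
    {f : flagVariety C m → Grass C' n}
    (hf : ∀ (F : PartialFlag C m) (e : Fin M → V), IsFlagFrame F e →
      ∃ D : Set (flagVariety C m), HasRegularCoordinates f D ∧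
        ∀ (F' : PartialFlag C m) (e' : Fin M → V), IsFlagFrame F' e' → head e' w = head e w →
          F' ∈ D)
    {F F' : PartialFlag C m} {e e' : Fin M → V} (he : IsFlagFrame F e) (he' : IsFlagFrame F' e')
    (hw : head e w = head e' w) : f F = f F' := by
  classical
  -- The map `f` is turned into a function of frames; families of vectors that are not frames
  -- receive the arbitrary flag `F`.
  have hex : ∀ e : Fin M → V, ∃ G : PartialFlag C m, IsFrame C e → IsFlagFrame G e := fun e => by
    by_cases h : IsFrame C e
    · obtain ⟨G, hG⟩ := exists_isFlagFrame hC hm hM h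
      exact ⟨G, fun _ => hG⟩
    · exact ⟨F, fun h' => absurd h' h⟩
  choose G hG using hex
  have hR : IsCurveInvariant C w (fun e => f (G e)) := by
    constructor
    · intro E E' hE
      obtain ⟨D, hD, hD'⟩ := hf _ _ (hG _ (hE.frame 0))
      exact eq_of_isRationalCurve hM hE (fun t => hG _ (hE.frame t)) (fun t => hG _ (hE.frame' t))
        hD (fun t => hD' _ _ (hG _ (hE.frame t)) (hE.fixed t))
        (fun t => hD' _ _ (hG _ (hE.frame' t)) (hE.fixed' t))
    · intro e e' he he' h
      rw [(hG e he).eq (hG e' he') h]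
  have := hconn _ hR e e' he.1 he'.1 hw
  rwa [(hG e he.1).eq he fun _ => rfl, (hG e' he'.1).eq he' fun _ => rfl] at this

end Flags

/-! ### Conditions on subspaces and their flag varieties -/

section Conditions

variable {V : Type u} [AddCommGroup V] [Module ℂ V] [FiniteDimensional ℂ V]

/-- The properties of the condition `C` on subspaces of dimension at most `D` that are common to
the ordinary, the orthogonal and the symplectic case. -/
structure IsFlagCondition (C : Submodule ℂ V → Prop) (D : ℕ) : Prop where
  bot : C ⊥
  mono : ∀ U T : Submodule ℂ V, U ≤ T → C T → C U
  extend : ∀ M ≤ D, ∀ W : Submodule ℂ V, C W → finrank ℂ W ≤ M →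
    ∃ T, W ≤ T ∧ C T ∧ finrank ℂ T = M
  sections : ∀ {d M : ℕ}, d ≤ M → M ≤ D → HasSections C d M
  conn : ∀ {M w : ℕ}, w ≤ M → ∀ {Z : Type v} (R : (Fin M → V) → Z), IsCurveInvariant C w R →
    ∀ e e', IsFrame C e → IsFrame C e' → head e w = head e' w → R e = R e'

theorem isFlagCondition_ordinary :
    IsFlagCondition.{u, v} (V := V) (fun _ => True) (finrank ℂ V) where
  bot := trivial
  mono := fun _ _ _ _ => trivial
  extend := fun M hM W _ hW => by
    obtain ⟨T, hT, -, hTM⟩ := exists_between_finrank (R := W) le_top hW (by rwa [finrank_top])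
    exact ⟨T, hT, trivial, hTM⟩
  sections := fun h hM => hasSections_ordinary h hM
  conn := fun h _ _ hR _ _ he he' hw => hR.eq_ordinary h he he' hw

variable {B : LinearMap.BilinForm ℂ V} {W₀ : MaxIsotropic B}

theorem isFlagCondition_symplectic (hA : B.IsAlt) (hB : B.Nondegenerate) :
    IsFlagCondition.{u, v} (IsIsotropic B) (finrank ℂ V / 2) where
  bot := .bot
  mono := fun _ _ h hT => hT.mono h
  extend := fun M hM W hW hWM => exists_isotropic_extension hA.isRefl
    (fun W hW => exists_alternating_vector hB hA W hW) (by omega) hW hWM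
  sections := fun h hM => hasSections_symplectic h hB hA (by omega)
  conn := fun h _ _ hR _ _ he he' hw => hR.eq_symplectic hA h he he' hw

theorem isFlagCondition_orthogonal (hS : B.IsSymm) (hB : B.Nondegenerate) :
    IsFlagCondition.{u, v} (IsOrthogonalMember B W₀) (finrank ℂ V / 2) where
  bot := W₀.toGrass.cond.mono hB bot_le
  mono := fun _ _ h hT => hT.mono hB h
  extend := fun M hM W hW hWM => exists_orthogonalMember_extension hB hS (by omega) hW hWM
  sections := fun h hM => hasSections_orthogonal h hB hS (by omega)
  conn := fun h _ _ hR _ _ he he' hw => hR.eq_orthogonal hB hS h he he' hw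

namespace IsFlagCondition

variable {C : Submodule ℂ V → Prop} {D k : ℕ} {m : Fin k → ℕ}

theorem exists_flag (hC : IsFlagCondition.{u, v} C D) (hm : Monotone m) (hD : ∀ a, m a ≤ D) :
    Nonempty (PartialFlag C m) := by
  obtain ⟨T, -, hT, hTD⟩ := hC.extend D le_rfl ⊥ hC.bot (by simp)
  obtain ⟨e, -, -, he⟩ := exists_adapted_frame (W := T) (H := T) le_rfl le_rfl hTD hTD hTD
  obtain ⟨F, -⟩ := exists_isFlagFrame (e := e) hC.mono hm hD ⟨by rw [he, hTD], by rwa [he]⟩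
  exact ⟨F⟩

/-- `M` is the dimension of the largest member, which itself satisfies `C`; for the empty type the
zero subspace serves. -/
theorem exists_frames (hC : IsFlagCondition.{u, v} C D) (hm : Monotone m) (hD : ∀ a, m a ≤ D) :
    ∃ M ≤ D, (∀ a, m a ≤ M) ∧ ∀ F : PartialFlag C m, ∃ e : Fin M → V, IsFlagFrame F e := by
  rcases k with - | k
  · exact ⟨0, Nat.zero_le _, fun a => a.elim0,
      fun F => F.exists_isFlagFrame hC.bot (finrank_bot ℂ V) fun a => a.elim0⟩
  · exact ⟨m (Fin.last k), hD _, fun a => hm (Fin.le_last a),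
      fun F => F.exists_isFlagFrame (F.cond (Fin.last k)) (F.finrank_eq _)
        fun a => F.mono (Fin.le_last a)⟩

end IsFlagCondition

end Conditions

/-! ### Marked flag varieties with well-behaved projections -/

namespace MarkedFlagVariety

variable {V : Type u} [AddCommGroup V] [Module ℂ V] [FiniteDimensional ℂ V]
  {V' : Type v} [AddCommGroup V'] [Module ℂ V'] [FiniteDimensional ℂ V']

/-- Every flag has an adapted frame whose heads are the images of the flag under the projections,
and every projection has local sections. -/
structure IsRegular (X : MarkedFlagVariety V) (D : ℕ) : Prop where
  cond : IsFlagCondition.{u, v} X.C D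
  monotone : Monotone X.m
  le : ∀ a, X.m a ≤ D
  finite : Finite X.Node
  morphAt : ∀ i F, MorphAt (fun F => X.toGrass F i) F
  node : ∀ i, ∃ M ≤ D, X.dim i ≤ M ∧ (∀ a, X.m a ≤ M) ∧
    ∀ F : PartialFlag X.C X.m, (∃ e : Fin M → V, IsFlagFrame F e) ∧
      ∀ e : Fin M → V, IsFlagFrame F e → head e (X.dim i) = (X.proj F i).space

instance (X : MarkedFlagVariety V) : LocallyRinged X.variety :=
  inferInstanceAs (LocallyRinged (flagVariety X.C X.m))

instance (X : MarkedFlagVariety V) (i : X.Node) : LocallyRinged (X.grass i) :=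
  inferInstanceAs (LocallyRinged (grassVariety X.C (X.dim i)))

variable {X : MarkedFlagVariety V} {Y : MarkedFlagVariety V'}

theorem IsHyperplaneBundle.exists_powerIso {j : Y.Node} {N : GluingData.{v, v} (Y.grass j)}
    (h : Y.IsHyperplaneBundle j N) :
    ∃ e, PowerIso (C := Y.C) (n := Y.dim j) e N := by
  by_cases hj : Y.half j
  · exact ⟨2, powerIso_two (h.2.2 hj)⟩
  · exact ⟨1, powerIso_one (h.2.1 hj)⟩

theorem PullsBackToZero.hasRegularCoordinates {φ : Morphism X.variety Y.variety} {j : Y.Node}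
    (hY : ∀ G, MorphAt (fun G => Y.toGrass G j) G) (h : PullsBackToZero φ j) :
    HasRegularCoordinates (C := Y.C) (n := Y.dim j) (fun F => Y.toGrass (φ F) j) Set.univ := by
  obtain ⟨_, ⟨N, hN, rfl⟩, h, h1, h2⟩ := h
  obtain ⟨e, he⟩ := hN.exists_powerIso
  refine hasRegularCoordinates_of_trivial (fun F => (hY (φ F)).comp (φ.morphAt F)) hN.1 he
    isOpen_univ (fun i => h i ()) (fun i F _ hi => h1 i () F ⟨hi, trivial⟩)
    fun i i' F _ hi hi' => ?_
  have := h2 i i' () () F ⟨⟨hi, hi'⟩, trivial, trivial⟩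
  rw [show (GluingData.trivial X.variety).g () () F = 1 from rfl, mul_one] at this
  exact this

/-- `D` is the preimage of a chart of 𝒪(1) around the image of `F₀`. It contains the whole fibre,
and the frame over this chart trivializes the pullback of `M_j`. -/
theorem PullsBackTo.hasRegularCoordinates {φ : Morphism X.variety Y.variety} {j : Y.Node}
    {i : X.Node} (hX : ∀ F, MorphAt (fun F => X.toGrass F i) F)
    (hY : ∀ G, MorphAt (fun G => Y.toGrass G j) G) (h : PullsBackTo φ j i) (F₀ : X.variety) :
    ∃ D, HasRegularCoordinates (C := Y.C) (n := Y.dim j) (fun F => Y.toGrass (φ F) j) D ∧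
      ∀ F, X.toGrass F i = X.toGrass F₀ i → F ∈ D := by
  obtain ⟨_, ⟨N, hN, rfl⟩, _, ⟨L, hL, rfl⟩, h, h1, h2⟩ := h
  obtain ⟨e, he⟩ := hN.exists_powerIso
  obtain ⟨b, hb⟩ := hL.1.cover (X.toGrass F₀ i)
  refine ⟨(fun F => X.toGrass F i) ⁻¹' L.U b, ?_, fun F hF => by rwa [Set.mem_preimage, hF]⟩
  refine hasRegularCoordinates_of_trivial (fun F => (hY (φ F)).comp (φ.morphAt F)) hN.1 he
    ((hL.1.isOpen b).preimage (continuous_iff_continuousAt.2 fun F => (hX F).continuousAt))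
    (fun a => h a b) (fun a F hF ha => h1 a b F ⟨ha, hF⟩) fun a a' F hF ha ha' => ?_
  have h3 := h2 a a' b b F ⟨⟨ha, ha'⟩, hF, hF⟩
  have h4 : L.g b b (X.toGrass F i) = 1 :=
    mul_right_cancel₀ (hL.1.ne_zero b b _ ⟨hF, hF⟩)
      ((hL.1.cocycle b b b _ ⟨⟨hF, hF⟩, hF⟩).trans (one_mul _).symm)
  rw [show (L.pullback fun F => X.toGrass F i).g b b F = 1 from h4, mul_one] at h3
  exact h3

variable {D D' : ℕ}

/-- The trivialization is global, so curves need not fix anything: `w = 0`. -/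
theorem PullsBackToZero.eq {φ : Morphism X.variety Y.variety} {j : Y.Node}
    (hX : IsRegular.{u, v} X D) (hY : IsRegular.{v, u} Y D') (h : PullsBackToZero φ j)
    (F F' : X.variety) : Y.toGrass (φ F) j = Y.toGrass (φ F') j := by
  obtain ⟨M, -, hM, hF⟩ := hX.cond.exists_frames hX.monotone hX.le
  obtain ⟨e, he⟩ := hF F
  obtain ⟨e', he'⟩ := hF F'
  exact eq_of_hasRegularCoordinates (C' := Y.C) (n := Y.dim j) (w := 0) hX.cond.mono hX.monotone hM
    (hX.cond.conn (Nat.zero_le M)) (f := fun F => Y.toGrass (φ F) j)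
    (fun _ _ _ => ⟨Set.univ, h.hasRegularCoordinates (hY.morphAt j), fun _ _ _ _ => trivial⟩)
    he he' (by rw [head_zero, head_zero])

/-- For adapted frames, lying in the same fibre of the projection means having the same head of
length `X.dim i`; this is the head that the connecting curves fix. -/
theorem PullsBackTo.eq {φ : Morphism X.variety Y.variety} {j : Y.Node} {i : X.Node}
    (hX : IsRegular.{u, v} X D) (hY : IsRegular.{v, u} Y D') (h : PullsBackTo φ j i)
    {F F' : X.variety} (hFF' : X.toGrass F i = X.toGrass F' i) :
    Y.toGrass (φ F) j = Y.toGrass (φ F') j := by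
  obtain ⟨M, -, hw, hM, hF⟩ := hX.node i
  obtain ⟨e, he⟩ := (hF F).1
  obtain ⟨e', he'⟩ := (hF F').1
  refine eq_of_hasRegularCoordinates (C' := Y.C) (n := Y.dim j) (w := X.dim i) hX.cond.mono
    hX.monotone hM (hX.cond.conn hw) (f := fun F => Y.toGrass (φ F) j) (fun G e he => ?_)
    he he' ?_
  · obtain ⟨D, hD, h'⟩ := h.hasRegularCoordinates (hX.morphAt i) (hY.morphAt j) G
    refine ⟨D, hD, fun G' e' he' hw => h' G' (Grass.ext ?_)⟩
    exact ((hF G').2 e' he').symm.trans (hw.trans ((hF G).2 e he))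
  · rw [(hF F).2 e he, (hF F').2 e' he']
    exact congrArg Grass.space hFF'

/-- The projections have local sections. -/
theorem IsRegular.exists_section (hX : IsRegular.{u, v} X D) (i : X.Node) (W₀ : X.grass i) :
    ∃ s : X.grass i → X.variety, (∀ᶠ W in 𝓝 W₀, X.toGrass (s W) i = W) ∧ MorphAt s W₀ := by
  obtain ⟨M, hMD, hw, hM, hF⟩ := hX.node i
  obtain ⟨F₀⟩ := hX.cond.exists_flag hX.monotone hX.le
  obtain ⟨e, he, hreg⟩ := hX.cond.sections hw hMD W₀
  have hex : ∀ W : X.grass i, ∃ F : PartialFlag X.C X.m,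
      IsFrame X.C (e W) → IsFlagFrame F (e W) := fun W => by
    by_cases h : IsFrame X.C (e W)
    · obtain ⟨G, hG⟩ := exists_isFlagFrame hX.cond.mono hX.monotone hM h
      exact ⟨G, fun _ => hG⟩
    · exact ⟨F₀, fun h' => absurd h' h⟩
  choose s hs using hex
  refine ⟨s, ?_, ?_⟩
  · filter_upwards [he] with W hW
    exact Grass.ext (((hF _).2 _ (hs W hW.1)).symm.trans hW.2)
  · refine morphAt_of_frames (S := X.grass i) hM s e ?_ hreg
    filter_upwards [he] with W hW
    exact hs W hW.1

theorem IsRegular.surjective_toGrass (hX : IsRegular.{u, v} X D) (i : X.Node) (W : X.grass i) :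
    ∃ F : X.variety, X.toGrass F i = W := by
  obtain ⟨s, hs, -⟩ := hX.exists_section i W
  exact ⟨s W, hs.self_of_nhds⟩

/-- A morphism which is constant on the fibres of a projection descends along the projection. -/
theorem IsRegular.morphAt_of_comp (hX : IsRegular.{u, v} X D) {i : X.Node} {Z : FunctionSpace.{w}}
    {f : X.variety → Z} (hf : ∀ F, MorphAt f F) {g : X.grass i → Z}
    (hg : ∀ F, g (X.toGrass F i) = f F) (W₀ : X.grass i) : MorphAt g W₀ := by
  obtain ⟨s, hs, hs'⟩ := hX.exists_section i W₀
  refine ((hf (s W₀)).comp hs').congr ?_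
  filter_upwards [hs] with W hW
  rw [← hg, hW]

theorem GrassMorphisms.prodMap_zero {p : Y.Node → Option X.Node} (Φ : GrassMorphisms X Y p)
    (x : pointVariety × ∀ i, X.grass i) (j : {j : Y.Node // p j = none}) :
    Φ.prodMap x j.1 =
      (Φ.zero x.1 : ∀ j : {j : Y.Node // p j = none}, Grass Y.C (Y.dim j.1)) j := by
  obtain ⟨j, hj⟩ := j
  unfold prodMap
  split
  · rfl
  · rename_i h
    exact nomatch h.symm.trans hj

theorem GrassMorphisms.prodMap_comp {p : Y.Node → Option X.Node} (Φ : GrassMorphisms X Y p)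
    (x : pointVariety × ∀ i, X.grass i) (i : X.Node) (j : {j : Y.Node // p j = some i}) :
    Φ.prodMap x j.1 =
      (Φ.comp i (x.2 i) : ∀ j : {j : Y.Node // p j = some i}, Grass Y.C (Y.dim j.1)) j := by
  obtain ⟨j, hj⟩ := j
  unfold prodMap
  split
  · rename_i h
    exact nomatch h.symm.trans hj
  · rename_i i' h
    obtain rfl : i' = i := Option.some.inj (h.symm.trans hj)
    rfl

theorem GrassMorphisms.ext' {p : Y.Node → Option X.Node} {Φ Ψ : GrassMorphisms X Y p}
    (h : ∀ x, Φ.zero x = Ψ.zero x) (h' : ∀ i x, Φ.comp i x = Ψ.comp i x) : Φ = Ψ := by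
  obtain ⟨a, b⟩ := Φ
  obtain ⟨c, d⟩ := Ψ
  obtain rfl : a = c := Morphism.ext' h
  obtain rfl : b = d := funext fun i => Morphism.ext' (h' i)
  rfl

theorem IsLinearEmbedding.exists_isIndexMap {φ : Morphism X.variety Y.variety}
    (h : IsLinearEmbedding φ) : ∃ p : Y.Node → Option X.Node, IsIndexMap φ p := by
  have : ∀ j, ∃ o : Option X.Node,
      (o = none → PullsBackToZero φ j) ∧ ∀ i, o = some i → PullsBackTo φ j i := fun j => by
    rcases h.2 j with h | ⟨i, h⟩
    · exact ⟨none, fun _ => h, by simp⟩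
    · refine ⟨some i, by simp, ?_⟩
      rintro _ ⟨⟩
      exact h
  choose p hp using this
  exact ⟨p, hp⟩

theorem IsRegular.linearEmbeddingsInduce (hX : IsRegular.{u, v} X D)
    (hY : IsRegular.{v, u} Y D') : LinearEmbeddingsInduce X Y := by
  intro φ hφ
  refine ⟨hφ.exists_isIndexMap, fun p hp => ?_⟩
  have := hY.finite
  obtain ⟨F₀⟩ : Nonempty X.variety := hX.cond.exists_flag hX.monotone hX.le
  have hφY : ∀ j F, MorphAt (fun F => Y.toGrass (φ F) j) F := fun j F =>
    (hY.morphAt j (φ F)).comp (φ.morphAt F)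
  -- These set-theoretic sections need not be regular. By `hcomp` the choice of the preimage does
  -- not matter, and regularity of the descended map comes from the local sections behind
  -- `IsRegular.morphAt_of_comp`.
  choose s hs using hX.surjective_toGrass
  have hprod : ∀ i F, MorphAt (Y := Y.prodGrass fun j => p j = some i)
      (fun F (j : {j : Y.Node // p j = some i}) => Y.toGrass (φ F) j.1) F := fun i F =>
    morphAt_prodGrass (S := X.variety) _ fun j => hφY j.1 F
  have hcomp : ∀ i F, (fun j : {j : Y.Node // p j = some i} =>
      Y.toGrass (φ (s i (X.toGrass F i))) j.1) =
        fun j : {j : Y.Node // p j = some i} => Y.toGrass (φ F) j.1 := fun i F =>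
    funext fun j => ((hp j.1).2 i j.2).eq hX hY (hs i _)
  let Φ : GrassMorphisms X Y p :=
    { zero := Morphism.ofMorphAt (fun _ (j : {j : Y.Node // p j = none}) => Y.toGrass (φ F₀) j.1)
        (morphAt_const (Y := Y.prodGrass fun j => p j = none) _)
      comp := fun i => Morphism.ofMorphAt
        (fun W (j : {j : Y.Node // p j = some i}) => Y.toGrass (φ (s i W)) j.1)
        (hX.morphAt_of_comp (Z := Y.prodGrass fun j => p j = some i) (hprod i) (hcomp i)) }
  refine ⟨Φ, fun pt F => funext fun j => ?_, fun Ψ hΨ => GrassMorphisms.ext' (fun x => ?_)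
    fun i W => ?_⟩
  · rcases hj : p j with - | i
    · exact (((hp j).1 hj).eq hX hY F F₀).trans (Φ.prodMap_zero (pt, X.toGrass F) ⟨j, hj⟩).symm
    · exact (congrFun (hcomp i F) ⟨j, hj⟩).symm.trans
        (Φ.prodMap_comp (pt, X.toGrass F) i ⟨j, hj⟩).symm
  · refine funext fun j => ?_
    exact (Ψ.prodMap_zero (x, X.toGrass F₀) j).symm.trans (congrFun (hΨ x F₀) j.1).symm
  · refine funext fun j => ?_
    have h1 := (Ψ.prodMap_comp ((), X.toGrass (s i W)) i j).symm.trans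
      (congrFun (hΨ () (s i W)) j.1).symm
    dsimp only at h1
    rwa [hs i W] at h1

end MarkedFlagVariety

/-! ### The three cases -/

section Cases

variable {V : Type u} [AddCommGroup V] [Module ℂ V] [FiniteDimensional ℂ V]
  {k : ℕ} {m : Fin k → ℕ}

theorem isRegular_Fl (hm : Monotone m) (h : ∀ a, m a ≤ finrank ℂ V) :
    MarkedFlagVariety.IsRegular.{u, v} (Fl V m) (finrank ℂ V) where
  cond := isFlagCondition_ordinary
  monotone := hm
  le := h
  finite := inferInstanceAs (Finite (Fin k))
  morphAt := fun a F => morphAt_get a F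
  node := fun a => by
    obtain ⟨M, hMD, hM, hF⟩ := (isFlagCondition_ordinary.{u, v} (V := V)).exists_frames hm h
    exact ⟨M, hMD, hM a, hM, fun F => ⟨hF F, fun e he => he.2 a⟩⟩

variable {B : LinearMap.BilinForm ℂ V} {W₀ : MaxIsotropic B}

theorem isRegular_FlS (hA : B.IsAlt) (hB : B.Nondegenerate) (hm : Monotone m)
    (h : ∀ a, 2 * m a ≤ finrank ℂ V) :
    MarkedFlagVariety.IsRegular.{u, v} (FlS B m) (finrank ℂ V / 2) where
  cond := isFlagCondition_symplectic hA hB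
  monotone := hm
  le := fun a => by have := h a; change m a ≤ _; omega
  finite := inferInstanceAs (Finite (Fin k))
  morphAt := fun a F => morphAt_get a F
  node := fun a => by
    obtain ⟨M, hMD, hM, hF⟩ := (isFlagCondition_symplectic.{u, v} hA hB).exists_frames hm
      fun a => (by have := h a; omega)
    exact ⟨M, hMD, hM a, hM, fun F => ⟨hF F, fun e he => he.2 a⟩⟩

/-- Locally `U` has a regular basis that extends to a regular basis of a maximal member; by
uniqueness the span of the latter is `θ(U)`. -/
theorem morphAt_theta (hS : B.IsSymm) (hB : B.Nondegenerate) {d : ℕ}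
    (hd : 2 * (d + 1) = finrank ℂ V) (U₀ : Grass (IsOrthogonalMember B W₀) d) :
    MorphAt (X := grassVariety (IsOrthogonalMember B W₀) d)
      (Y := grassVariety (IsOrthogonalMember B W₀) (finrank ℂ V / 2))
      (fun U : Grass (IsOrthogonalMember B W₀) d => theta B W₀ U.space) U₀ := by
  obtain ⟨e, he, hreg⟩ := hasSections_orthogonal (show d ≤ finrank ℂ V / 2 by omega) hB hS
    (by omega) U₀
  refine morphAt_grass_of_frames (S := grassVariety _ d) _ e ?_ hreg
  filter_upwards [he] with U hU
  rw [theta_eq hB hS (T := ⟨head (e U) (finrank ℂ V / 2), hU.1.1, hU.1.2⟩)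
    (by rwa [Grass.finrank_eq U]) (hU.2.symm.le.trans (head_mono _ (by omega)))]

theorem le_theta (hS : B.IsSymm) (hB : B.Nondegenerate) {U : Submodule ℂ V}
    (hU : IsOrthogonalMember B W₀ U) (hd : 2 * (finrank ℂ U + 1) = finrank ℂ V) :
    U ≤ (theta B W₀ U).space := by
  obtain ⟨T, hUT, hT, hTM⟩ := exists_orthogonalMember_extension (M := finrank ℂ V / 2) hB hS
    (by omega) hU (by omega)
  rw [theta_eq hB hS hd (T := ⟨T, hTM, hT⟩) hUT]
  exact hUT

theorem isRegular_FlO (hS : B.IsSymm) (hB : B.Nondegenerate) (hm : Monotone m)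
    (h : ∀ a, 2 * m a ≤ finrank ℂ V) :
    MarkedFlagVariety.IsRegular.{u, v} (FlO B W₀ m) (finrank ℂ V / 2) where
  cond := isFlagCondition_orthogonal hS hB
  monotone := hm
  le := fun a => by have := h a; change m a ≤ _; omega
  finite := inferInstanceAs (Finite (Fin k ⊕ PLift (HasExtraNode (finrank ℂ V) m)))
  morphAt := by
    rintro (a | hx) F
    · exact morphAt_get a F
    · exact (morphAt_theta hS hB hx.down.choose_spec.2 (F.get hx.down.choose)).comp
        (morphAt_get hx.down.choose F)
  node := by
    have h' : ∀ a, m a ≤ finrank ℂ V / 2 := fun a => by have := h a; omega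
    rintro (a | hx)
    · obtain ⟨M, hMD, hM, hF⟩ :=
        (isFlagCondition_orthogonal.{u, v} (W₀ := W₀) hS hB).exists_frames hm h'
      exact ⟨M, hMD, hM a, hM, fun F => ⟨hF F, fun e he => he.2 a⟩⟩
    -- For the extra generator, frames of the middle dimension are taken. Any such frame adapted to
    -- the flag spans a maximal member containing `V_{m_k}`, hence spans its image under `θ`.
    · refine ⟨finrank ℂ V / 2, le_rfl, le_rfl, h', fun F => ?_⟩
      have hd : 2 * (finrank ℂ (F.space hx.down.choose) + 1) = finrank ℂ V :=
        (congrArg (fun d => 2 * (d + 1)) (F.finrank_eq _)).trans hx.down.choose_spec.2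
      refine ⟨F.exists_isFlagFrame (theta B W₀ (F.space hx.down.choose)).cond (Grass.finrank_eq _)
        fun a => (F.mono (hx.down.choose_spec.1 a)).trans (le_theta hS hB (F.cond _) hd),
        fun e he => ?_⟩
      exact congrArg Grass.space (theta_eq hB hS hd
        (T := ⟨head e (finrank ℂ V / 2), he.1.1, he.1.2⟩)
        ((he.2 _).symm.le.trans (head_mono _ (h' _)))).symm

end Cases

theorem mainTheorem6
    {V : Type u} [AddCommGroup V] [Module ℂ V] [FiniteDimensional ℂ V]
    {V' : Type v} [AddCommGroup V'] [Module ℂ V'] [FiniteDimensional ℂ V']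
    {k k' : ℕ} (m : Fin k → ℕ) (n : Fin k' → ℕ)
    (hm : StrictMono m) (hn : StrictMono n) (hm1 : ∀ i, 1 ≤ m i) (hn1 : ∀ j, 1 ≤ n j) :
    -- ordinary flag varieties
    (2 ≤ finrank ℂ V → 2 ≤ finrank ℂ V' →
      (∀ i, m i < finrank ℂ V) → (∀ j, n j < finrank ℂ V') →
      (Fl V m).LinearEmbeddingsInduce (Fl V' n)) ∧
    -- orthogonal flag varieties
    (∀ (B : LinearMap.BilinForm ℂ V) (B' : LinearMap.BilinForm ℂ V'),
      B.IsSymm → B.Nondegenerate → B'.IsSymm → B'.Nondegenerate →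
      7 ≤ finrank ℂ V → 7 ≤ finrank ℂ V' →
      (∀ i, 2 * m i ≤ finrank ℂ V) → (∀ j, 2 * n j ≤ finrank ℂ V') →
      ∀ (W₀ : MaxIsotropic B) (W₀' : MaxIsotropic B'),
        (FlO B W₀ m).LinearEmbeddingsInduce (FlO B' W₀' n)) ∧
    -- symplectic flag varieties
    (∀ (B : LinearMap.BilinForm ℂ V) (B' : LinearMap.BilinForm ℂ V'),
      B.IsAlt → B.Nondegenerate → B'.IsAlt → B'.Nondegenerate →
      (∀ i, 2 * m i ≤ finrank ℂ V) → (∀ j, 2 * n j ≤ finrank ℂ V') →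
      (FlS B m).LinearEmbeddingsInduce (FlS B' n)) := by
  refine ⟨fun _ _ hmV hnV => ?_, fun B B' hS hB hS' hB' _ _ hmV hnV W₀ W₀' => ?_,
    fun B B' hA hB hA' hB' hmV hnV => ?_⟩
  · exact (isRegular_Fl hm.monotone fun i => (hmV i).le).linearEmbeddingsInduce
      (isRegular_Fl hn.monotone fun j => (hnV j).le)
  · exact (isRegular_FlO hS hB hm.monotone hmV).linearEmbeddingsInduce
      (isRegular_FlO hS' hB' hn.monotone hnV)
  · exact (isRegular_FlS hA hB hm.monotone hmV).linearEmbeddingsInduce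
      (isRegular_FlS hA' hB' hn.monotone hnV)
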